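/- **Setting.** Let $r$ be a fixed integer, and let $p=p_n\to\infty$, $T=T_n\to\infty$ with $T\le Cp$ for a constant $C$ and all large $n$. Everything below depends on $n$; the constants do not. Let $$X=FB^\top+E\in\mathbb R^{T\times p},\qquad E=P_1\mathcal E P_2,$$ with $B\in\mathbb R^{p\times r}$, $P_1\in\mathbb R^{T\times T}$, $P_2\in\mathbb R^{p\times p}$ deterministic and $F\in\mathbb R^{T\times r}$, $\mathcal E\in\mathbb R^{T\times p}$ random. Write $F_t,e_t$ for the $t$-th rows of $F,E$ (as column vectors), $p_{1,t}$ for the $t$-th row of $P_1$, and $\lambda_1\ge\lambda_2\ge\cdots$ for the eigenvalues of a symmetric matrix. Let $A$ be a symmetric $p\times p$ matrix with entries in $\{0,1\}$ (the observed network), $\mathcal L=\operatorname{diag}(A\mathbf 1)-A$, $\bar d=p^{-1}\sum_{i,j}A_{ij}$, $\mathcal L_n=\bar d^{-1}\mathcal L$ (and $\mathcal L_n=0$ if $A=0$), and let $u_1,\dots,u_p$ be orthonormal eigenvectors of $\mathcal L_n$ ordered by decreasing eigenvalue. With deterministic tuning parameters $\alpha=\alpha_n\ge0$ and $0\le m=m_n\le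 p$, let either $D=I_p+\alpha\mathcal L_n$ (Laplacian penalty) or $D=I_p+\alpha U_1U_1^\top$ with $U_1=(u_1,\dots,u_{p-m})$ (projection penalty). Put $S=p^{-1}B^\top D^{-1}B$, with spectral decomposition $S=\Gamma_S\Lambda_S\Gamma_S^\top$ ($\Gamma_S$ orthogonal, $\Lambda_S=\operatorname{diag}(\lambda_1(S),\dots,\lambda_r(S))$). **Assumptions.** For some constants $K,c,c_1,c_2>0$: * (Factors) $\mathbb E f_{tk}=0$, $\mathbb E f_{tk}^2=1$, $\mathbb E f_{tk}^4\le K$; $F^\top F/T=I_r$ almost surely; $\mathbb E\|v^\top F\|^2\le K$ for all $v\in\mathbb R^T$ with $\|v\|=1$. * (Loadings) $|b_{jk}|\le K$, and $p^{-1}B^\top B\to\Sigma_B$, where $c_1\ge\lambda_1(\Sigma_B)>\cdots>\lambda_r(\Sigma_B)\ge c_2$. * (Errors) The entries $\epsilon_{tj}$ of $\mathcal E$ are independent with $\mathbb E\epsilon_{tj}=0$, $\mathbb E\epsilon_{tj}^2=1$, $\mathbb E\epsilon_{tj}^4\le K$; the eigenvalues of $P_1^\top P_1$ and $P_2^\top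 P_2$ lie in $[c_2,c_1]$; $\mathcal E$ and $F$ are independent. * (Shrunk loadings) For all large $n$, $\lambda_r(S)\ge c$ and $\lambda_k(S)-\lambda_{k+1}(S)\ge c$ for $1\le k<r$. **Estimator.** Let $\hat F\in\mathbb R^{T\times r}$ be a random matrix whose columns are, almost surely, $\sqrt T$ times orthonormal eigenvectors of $(pT)^{-1}XD^{-1}X^\top$ for its $r$ largest eigenvalues, in decreasing order; $\hat F_t$ is its $t$-th row, $\Lambda_r$ the diagonal matrix of these eigenvalues, and $$H=S\,(F^\top\hat F/T)\,\Lambda_r^{-1}.$$ **Theorem.** $H$ is invertible with probability tending to one, and $H^\top H\to I_r$ in probability. Let moreover $t=t_n\le T_n$ be time indices (for instance a fixed $t$) for which the CLT assumption holds: $p^{-1/2}B^\top D^{-1}e_t\to\mathcal N(0,V_t)$ in distribution, where $V_t=\lim_n p^{-1}\operatorname{cov}(B^\top D^{-1}e_t)$. Then: 1. Suppose $\|D^{-1}\|_F/T\to0$, and let the signs of the columns of $\hat F$ be chosen so that, almost surely, the diagonal entries of $\Gamma_S^\top F^\top\hat F$ are nonnegative. Then $\sqrt p(\hat F_t-H^\top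 F_t)$ is asymptotically $\mathcal N(0,\Sigma_n)$ with $\Sigma_n=\Lambda_S^{-1}\Gamma_S^\top V_t\Gamma_S\Lambda_S^{-1}$: for every bounded continuous $f:\mathbb R^r\to\mathbb R$, $$\mathbb E f\big(\sqrt p(\hat F_t-H^\top F_t)\big)-\int f\,d\mathcal N(0,\Sigma_n)\to0 .$$ In particular, if $\Sigma_n\to\Sigma$, then $\sqrt p(\hat F_t-H^\top F_t)\to\mathcal N(0,\Sigma)$ in distribution. 2. $V_t=\lim_n\|p_{1,t}\|^2\,p^{-1}B^\top D^{-1}P_2^\top P_2D^{-1}B$; and if $\|p_{1,t}\|^2$ converges, then $p^{-1}B^\top D^{-1}P_2^\top P_2D^{-1}B$ converges as well and $V_t=\lim_n\|p_{1,t}\|^2\cdot\lim_n p^{-1}B^\top D^{-1}P_2^\top P_2D^{-1}B$. 3. If $\|D^{-1}\|_F/T$ is bounded away from zero for all large $n$, then $\hat F_t-H^\top F_t=O_p\big(\|D^{-1}\|_F/(T\sqrt p)\big)$. -/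

import Mathlib

open Filter Topology MeasureTheory ProbabilityTheory
open scoped Matrix

namespace NetFactor

noncomputable section

/-- The `k`-th largest eigenvalue, counted with multiplicity and with `k = 0, 1, …`, of a real
symmetric matrix (with the value `0` if the matrix is not symmetric or `k` is out of range). -/
def eig {ι : Type*} [Fintype ι] [DecidableEq ι] (A : Matrix ι ι ℝ) (k : ℕ) : ℝ :=
  if h : A.IsHermitian then
    if hk : k < Fintype.card ι then h.eigenvalues₀ ⟨k, hk⟩ else 0
  else 0

/-- The Frobenius norm. -/
def frobNorm {ι κ : Type*} [Fintype ι] [Fintype κ] (A : Matrix ι κ ℝ) : ℝ :=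
  Real.sqrt (∑ i, ∑ j, A i j ^ 2)

/-- The graph Laplacian `𝒟 - A`, with `𝒟` the diagonal matrix of the row sums of `A`. -/
def laplacian {q : ℕ} (A : Matrix (Fin q) (Fin q) ℝ) : Matrix (Fin q) (Fin q) ℝ :=
  Matrix.diagonal (fun i => ∑ j, A i j) - A

/-- The average degree `q⁻¹ ∑ᵢ 𝒟ᵢᵢ`. -/
def meanDegree {q : ℕ} (A : Matrix (Fin q) (Fin q) ℝ) : ℝ :=
  (q : ℝ)⁻¹ * ∑ i, ∑ j, A i j

/-- The normalized Laplacian: the Laplacian divided by the average degree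
(the zero matrix for a network without edges). -/
def normLaplacian {q : ℕ} (A : Matrix (Fin q) (Fin q) ℝ) : Matrix (Fin q) (Fin q) ℝ :=
  (meanDegree A)⁻¹ • laplacian A

/-- The two network penalties for the loadings. -/
inductive Penalty where
  | laplacian
  | projection

/-- The data of a network-linked factor model with `r` factors, along a sequence, indexed by `n`,
of numbers of variables `p n` and of sample sizes `T n`. -/
structure Model (r : ℕ) (Ω : Type*) [MeasurableSpace Ω] where
  /-- number of variables -/
  p : ℕ → ℕ
  /-- sample size -/
  T : ℕ → ℕ
  /-- factor loadings -/
  B : ∀ n, Matrix (Fin (p n)) (Fin r) ℝ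
  /-- random factor scores -/
  F : ∀ n, Ω → Matrix (Fin (T n)) (Fin r) ℝ
  measurable_F : ∀ n t k, Measurable fun ω => F n ω t k
  /-- the random matrix from which the errors are built -/
  eps : ∀ n, Ω → Matrix (Fin (T n)) (Fin (p n)) ℝ
  measurable_eps : ∀ n t j, Measurable fun ω => eps n ω t j
  /-- left (serial) factor of the error matrix -/
  P₁ : ∀ n, Matrix (Fin (T n)) (Fin (T n)) ℝ
  /-- right (cross-sectional) factor of the error matrix -/
  P₂ : ∀ n, Matrix (Fin (p n)) (Fin (p n)) ℝ
  /-- adjacency matrix of the observed network -/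
  adj : ∀ n, Matrix (Fin (p n)) (Fin (p n)) ℝ
  adj_symm : ∀ n, (adj n).IsSymm
  adj_zero_one : ∀ n i j, adj n i j = 0 ∨ adj n i j = 1
  /-- the eigenvectors of the normalized Laplacian, as the columns of a matrix -/
  U : ∀ n, Matrix (Fin (p n)) (Fin (p n)) ℝ
  U_orthogonal : ∀ n, (U n)ᵀ * U n = 1
  /-- the eigenvalues of the normalized Laplacian -/
  τ : ∀ n, Fin (p n) → ℝ
  τ_antitone : ∀ n, Antitone (τ n)
  normLaplacian_eq : ∀ n, normLaplacian (adj n) = U n * Matrix.diagonal (τ n) * (U n)ᵀ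
  /-- tuning parameter -/
  α : ℕ → ℝ
  α_nonneg : ∀ n, 0 ≤ α n
  /-- truncation parameter of the projection penalty -/
  m : ℕ → ℕ
  m_le : ∀ n, m n ≤ p n

variable {r : ℕ} {Ω : Type*} [MeasurableSpace Ω]

namespace Model

/-- The error matrix `E = P₁ ℰ P₂`. -/
def E (M : Model r Ω) (n : ℕ) (ω : Ω) : Matrix (Fin (M.T n)) (Fin (M.p n)) ℝ :=
  M.P₁ n * M.eps n ω * M.P₂ n

/-- The observed data matrix `X = F Bᵀ + E`. -/
def X (M : Model r Ω) (n : ℕ) (ω : Ω) : Matrix (Fin (M.T n)) (Fin (M.p n)) ℝ :=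
  M.F n ω * (M.B n)ᵀ + M.E n ω

/-- The leading `p - m` eigenvectors of the normalized Laplacian. -/
def U₁ (M : Model r Ω) (n : ℕ) : Matrix (Fin (M.p n)) (Fin (M.p n - M.m n)) ℝ :=
  (M.U n).submatrix id (Fin.castLE (Nat.sub_le _ _))

/-- The shrinkage matrix: `I + α 𝓛ₙ` for the Laplacian penalty and `I + α U₁ U₁ᵀ` for the
projection penalty. -/
def D (M : Model r Ω) : Penalty → ∀ n, Matrix (Fin (M.p n)) (Fin (M.p n)) ℝ
  | .laplacian => fun n => 1 + M.α n • normLaplacian (M.adj n)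
  | .projection => fun n => 1 + M.α n • (M.U₁ n * (M.U₁ n)ᵀ)

/-- `S = p⁻¹ Bᵀ D⁻¹ B`. -/
def S (M : Model r Ω) (pen : Penalty) (n : ℕ) : Matrix (Fin r) (Fin r) ℝ :=
  (M.p n : ℝ)⁻¹ • ((M.B n)ᵀ * (M.D pen n)⁻¹ * M.B n)

/-- The diagonal matrix `Λ_S` of the eigenvalues of `S`, in decreasing order. -/
def ΛS (M : Model r Ω) (pen : Penalty) (n : ℕ) : Matrix (Fin r) (Fin r) ℝ :=
  Matrix.diagonal fun k => eig (M.S pen n) k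

/-- The matrix `(pT)⁻¹ X D⁻¹ Xᵀ`. -/
def gram (M : Model r Ω) (pen : Penalty) (n : ℕ) (ω : Ω) :
    Matrix (Fin (M.T n)) (Fin (M.T n)) ℝ :=
  ((M.p n : ℝ) * (M.T n : ℝ))⁻¹ • (M.X n ω * (M.D pen n)⁻¹ * (M.X n ω)ᵀ)

/-- The diagonal matrix of the `r` leading eigenvalues of `(pT)⁻¹ X D⁻¹ Xᵀ`. -/
def Λr (M : Model r Ω) (pen : Penalty) (n : ℕ) (ω : Ω) : Matrix (Fin r) (Fin r) ℝ :=
  Matrix.diagonal fun k => eig (M.gram pen n ω) k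

/-- `Fhat` is an estimated factor score matrix: its columns are `√T` times orthonormal
eigenvectors of `(pT)⁻¹ X D⁻¹ Xᵀ` for its `r` leading eigenvalues. -/
structure IsScoreEstimator (M : Model r Ω) (P : Measure Ω) (pen : Penalty)
    (Fhat : ∀ n, Ω → Matrix (Fin (M.T n)) (Fin r) ℝ) : Prop where
  measurable : ∀ n t k, Measurable fun ω => Fhat n ω t k
  normalized : ∀ n, ∀ᵐ ω ∂P, (Fhat n ω)ᵀ * Fhat n ω = (M.T n : ℝ) • 1
  eigenvectors : ∀ n, ∀ᵐ ω ∂P, M.gram pen n ω * Fhat n ω = Fhat n ω * M.Λr pen n ω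

/-- The rotation matrix `H = S (Fᵀ Fhat / T) Λr⁻¹`. -/
def H (M : Model r Ω) (pen : Penalty) (Fhat : ∀ n, Ω → Matrix (Fin (M.T n)) (Fin r) ℝ)
    (n : ℕ) (ω : Ω) : Matrix (Fin r) (Fin r) ℝ :=
  M.S pen n * ((M.T n : ℝ)⁻¹ • ((M.F n ω)ᵀ * Fhat n ω)) * (M.Λr pen n ω)⁻¹

/-- The dimensions diverge and `T` is at most of the order of `p`. -/
structure DimensionRegime (M : Model r Ω) : Prop where
  p_tendsto : Tendsto M.p atTop atTop
  T_tendsto : Tendsto M.T atTop atTop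
  T_le : ∃ C : ℝ, ∀ᶠ n in atTop, (M.T n : ℝ) ≤ C * M.p n

/-- Moment and identifiability conditions on the factor scores. -/
structure FactorConditions (M : Model r Ω) (P : Measure Ω) : Prop where
  mean : ∀ n t k, ∫ ω, M.F n ω t k ∂P = 0
  second : ∀ n t k, ∫ ω, M.F n ω t k ^ 2 ∂P = 1
  memLp : ∀ n t k, MemLp (fun ω => M.F n ω t k) 4 P
  normalized : ∀ n, ∀ᵐ ω ∂P, (M.T n : ℝ)⁻¹ • ((M.F n ω)ᵀ * M.F n ω) = 1
  bounded : ∃ K : ℝ, 0 < K ∧ (∀ n t k, ∫ ω, M.F n ω t k ^ 4 ∂P ≤ K) ∧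
    ∀ n (v : Fin (M.T n) → ℝ), ∑ t, v t ^ 2 = 1 →
      ∫ ω, ∑ k, (v ᵥ* M.F n ω) k ^ 2 ∂P ≤ K

/-- The loadings are bounded, and `p⁻¹ Bᵀ B` converges to a matrix with distinct positive
eigenvalues. -/
structure LoadingConditions (M : Model r Ω) : Prop where
  bounded : ∃ K : ℝ, ∀ n j k, |M.B n j k| ≤ K
  limit : ∃ SB : Matrix (Fin r) (Fin r) ℝ,
    Tendsto (fun n => (M.p n : ℝ)⁻¹ • ((M.B n)ᵀ * M.B n)) atTop (𝓝 SB) ∧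
    StrictAnti (fun k : Fin r => eig SB k) ∧
    ∃ c₁ c₂ : ℝ, 0 < c₁ ∧ 0 < c₂ ∧ ∀ k : Fin r, c₂ ≤ eig SB k ∧ eig SB k ≤ c₁

/-- The entries of `ℰ` are independent with mean zero, unit variance and bounded fourth moments,
`P₁ᵀ P₁` and `P₂ᵀ P₂` have eigenvalues bounded away from zero and infinity, and `ℰ` is
independent of the factor scores. -/
structure ErrorConditions (M : Model r Ω) (P : Measure Ω) : Prop where
  indep : ∀ n, iIndepFun
    (fun (i : Fin (M.T n) × Fin (M.p n)) (ω : Ω) => M.eps n ω i.1 i.2) P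
  mean : ∀ n t j, ∫ ω, M.eps n ω t j ∂P = 0
  second : ∀ n t j, ∫ ω, M.eps n ω t j ^ 2 ∂P = 1
  memLp : ∀ n t j, MemLp (fun ω => M.eps n ω t j) 4 P
  fourth : ∃ K : ℝ, ∀ n t j, ∫ ω, M.eps n ω t j ^ 4 ∂P ≤ K
  spectra : ∃ c₁ c₂ : ℝ, 0 < c₁ ∧ 0 < c₂ ∧ ∀ n,
    spectrum ℝ ((M.P₁ n)ᵀ * M.P₁ n) ⊆ Set.Icc c₂ c₁ ∧
    spectrum ℝ ((M.P₂ n)ᵀ * M.P₂ n) ⊆ Set.Icc c₂ c₁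
  indep_F : ∀ n, IndepFun
    (fun (ω : Ω) (i : Fin (M.T n) × Fin (M.p n)) => M.eps n ω i.1 i.2)
    (fun (ω : Ω) (i : Fin (M.T n) × Fin r) => M.F n ω i.1 i.2) P

/-- The eigenvalues of `S` are asymptotically distinct and bounded away from zero: for all large
`n` the smallest one and all the gaps are at least a constant `c > 0`. -/
def ShrunkLoadingCondition (M : Model r Ω) (pen : Penalty) : Prop :=
  ∃ c : ℝ, 0 < c ∧ ∀ᶠ n in atTop,
    (∀ k : Fin r, c ≤ eig (M.S pen n) k) ∧
    ∀ k l : Fin r, k < l → c ≤ eig (M.S pen n) k - eig (M.S pen n) l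

/-- The random vector `Bᵀ D⁻¹ e_t`, where `e_t` is the `t`-th row of the error matrix. -/
def score (M : Model r Ω) (pen : Penalty) (n : ℕ) (t : Fin (M.T n)) (ω : Ω) : Fin r → ℝ :=
  ((M.B n)ᵀ * (M.D pen n)⁻¹) *ᵥ M.E n ω t

/-- The central limit assumption for time `t` (`t n` is a time index at stage `n`):
`p^{-1/2} Bᵀ D⁻¹ e_t` converges in distribution to `N(0, V)`, with
`V = lim p⁻¹ cov(Bᵀ D⁻¹ e_t)`. -/
structure ScoreCLT (M : Model r Ω) (P : Measure Ω) [IsProbabilityMeasure P] (pen : Penalty)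
    (t : ∀ n, Fin (M.T n)) (V : Matrix (Fin r) (Fin r) ℝ) : Prop where
  clt : TendstoInDistribution
    (fun n ω => WithLp.toLp 2 ((Real.sqrt (M.p n))⁻¹ • M.score pen n (t n) ω))
    atTop (id : EuclideanSpace ℝ (Fin r) → EuclideanSpace ℝ (Fin r))
    (fun _ => P) (multivariateGaussian 0 V)
  cov : Tendsto (fun n => (M.p n : ℝ)⁻¹ • (Matrix.of fun k l : Fin r =>
      covariance (fun ω => M.score pen n (t n) ω k) (fun ω => M.score pen n (t n) ω l) P))
    atTop (𝓝 V)

/-- The estimation error `Fhat_t - Hᵀ F_t`, as a vector of Euclidean space. -/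
def scoreError (M : Model r Ω) (pen : Penalty)
    (Fhat : ∀ n, Ω → Matrix (Fin (M.T n)) (Fin r) ℝ) (t : ∀ n, Fin (M.T n))
    (n : ℕ) (ω : Ω) : EuclideanSpace ℝ (Fin r) :=
  WithLp.toLp 2 (Fhat n ω (t n) - (M.H pen Fhat n ω)ᵀ *ᵥ M.F n ω (t n))

end Model

/-- `Z n = O_p(a n)`. -/
def IsBigOP {E : Type*} [Norm E] (P : Measure Ω) (Z : ℕ → Ω → E) (a : ℕ → ℝ) : Prop :=
  ∀ ε : ℝ, 0 < ε → ∃ K : ℝ, ∀ᶠ n in atTop, P {ω | K * a n < ‖Z n ω‖} ≤ ENNReal.ofReal ε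

/-- The laws of the random vectors `Z n` are asymptotic to the normal laws `N(0, C n)`, for a
sequence of covariance matrices which need not converge: the expectations of every bounded
continuous function under the two laws differ by a quantity that tends to zero. -/
def AsymptoticallyNormal (P : Measure Ω) (Z : ℕ → Ω → EuclideanSpace ℝ (Fin r))
    (C : ℕ → Matrix (Fin r) (Fin r) ℝ) : Prop :=
  ∀ f : BoundedContinuousFunction (EuclideanSpace ℝ (Fin r)) ℝ,
    Tendsto (fun n => ∫ ω, f (Z n ω) ∂P - ∫ x, f x ∂(multivariateGaussian 0 (C n)))
      atTop (𝓝 0)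

end

end NetFactor

/-! Put `N = E D⁻¹ B` and `G = (pT)⁻¹ X D⁻¹ Xᵀ`. Expanding the product gives `G = T⁻¹ F S Fᵀ + Δ`
with `Δ = (pT)⁻¹ (F Nᵀ + N Fᵀ + E D⁻¹ Eᵀ)`, a rank `r` matrix with known spectrum plus noise
(`Model.gram_eq`). Since `D = 1 + Q` with `Q` positive semidefinite, `D⁻¹` is a contraction and
`‖D⁻¹‖_F ≤ √p`. Moment bounds for linear and quadratic forms in independent variables give `‖N‖_F =
O_p(√(Tp))` and `‖E D⁻¹ Eᵀ‖_F = O_p(√(Tp) ‖D⁻¹‖_F)`, so that `‖Δ‖_F = O_p(T^{-1/2})` because `T` is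
at most of order `p`.

The argument separates probability from algebra. Chebyshev's inequality puts all error terms within
a constant multiple of their orders on an event of probability close to one (`exists_errorControl`).
On that event the structure `SpikedGram` holds with `δ = L/√T`, and the rest is deterministic
perturbation theory. Weyl's inequality (`abs_eig_sub_le`) keeps the leading eigenvalues away from
zero. The eigenvector equation gives `Fhat - F H = Δ Fhat Λr⁻¹`, which is of norm `O(δ√T)`; as
`F/√T` and `Fhat/√T` have orthonormal columns, `HᵀH` is within `O(δ)` of the identity and `H` is
invertible.

Row `t` of the same identity, multiplied by `√p`, is `Λr⁻¹ (Fᵀ Fhat/T)ᵀ p^{-1/2} Bᵀ D⁻¹ e_t` plus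
`(√p T)⁻¹ Λr⁻¹ Fhatᵀ (N F_t + E D⁻¹ e_t)`. The second term is `O_p(T^{-1/2} + ‖D⁻¹‖_F/T)`
(`norm_remainder_le`): `Fhat` depends on the noise, but it is `F H` up to an error of bounded norm,
and `F` is independent of the noise, so that multiplication by `Fᵀ` does not cost a factor `√T`. In
the first term the spectral gap and the sign convention force `T⁻¹ Γᵀ Fᵀ Fhat` to be close to the
identity, so the matrix in front of the score is close to `Λ_S⁻¹ Γᵀ` (`frobNorm_align_le`).

The matrices `Λ_S⁻¹ Γᵀ` are bounded but need not converge. Normality therefore follows by passing to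
subsequences along which they do and applying Slutsky's theorem (`asymptoticallyNormal_of_linear`).
The form of `V` is an exact covariance computation, and the rate in the last claim holds because a
lower bound on `‖D⁻¹‖_F/T` lets this quantity absorb the terms that are merely bounded. -/

namespace NetFactor

/-! ### Frobenius norm inequalities. -/

section Frobenius

variable {ι κ μ : Type*} [Fintype ι] [Fintype κ] [Fintype μ]

theorem frobNorm_nonneg (A : Matrix ι κ ℝ) : 0 ≤ frobNorm A := Real.sqrt_nonneg _

theorem frobNorm_sq (A : Matrix ι κ ℝ) : frobNorm A ^ 2 = ∑ i, ∑ j, A i j ^ 2 :=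
  Real.sq_sqrt (by positivity)

section

open scoped Matrix.Norms.Frobenius

theorem frobNorm_eq_norm (A : Matrix ι κ ℝ) : frobNorm A = ‖A‖ := by
  rw [Matrix.frobenius_norm_def, frobNorm, Real.sqrt_eq_rpow]
  simp

theorem frobNorm_add_le (A B : Matrix ι κ ℝ) : frobNorm (A + B) ≤ frobNorm A + frobNorm B := by
  simp only [frobNorm_eq_norm]; exact norm_add_le _ _

theorem frobNorm_sub_le (A B : Matrix ι κ ℝ) : frobNorm (A - B) ≤ frobNorm A + frobNorm B := by
  simp only [frobNorm_eq_norm]; exact norm_sub_le _ _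

theorem frobNorm_mul_le (A : Matrix ι κ ℝ) (B : Matrix κ μ ℝ) :
    frobNorm (A * B) ≤ frobNorm A * frobNorm B := by
  simp only [frobNorm_eq_norm]; exact Matrix.frobenius_norm_mul _ _

theorem frobNorm_transpose (A : Matrix ι κ ℝ) : frobNorm Aᵀ = frobNorm A := by
  simp only [frobNorm_eq_norm]; exact Matrix.frobenius_norm_transpose _

theorem frobNorm_smul (c : ℝ) (A : Matrix ι κ ℝ) : frobNorm (c • A) = |c| * frobNorm A := by
  simp only [frobNorm_eq_norm]; exact norm_smul _ _

theorem frobNorm_eq_zero {A : Matrix ι κ ℝ} : frobNorm A = 0 ↔ A = 0 := by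
  simp only [frobNorm_eq_norm]; exact norm_eq_zero

theorem frobNorm_replicateCol (v : ι → ℝ) :
    frobNorm (Matrix.replicateCol Unit v) = ‖WithLp.toLp 2 v‖ := by
  simp only [frobNorm_eq_norm]; exact Matrix.frobenius_norm_replicateCol _

end

theorem norm_toLp_sq (v : ι → ℝ) : ‖WithLp.toLp 2 v‖ ^ 2 = v ⬝ᵥ v := by
  rw [EuclideanSpace.norm_sq_eq]
  simp [dotProduct, sq]

theorem norm_toLp_mulVec_le (A : Matrix ι κ ℝ) (v : κ → ℝ) :
    ‖WithLp.toLp 2 (A *ᵥ v)‖ ≤ frobNorm A * ‖WithLp.toLp 2 v‖ := by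
  rw [← frobNorm_replicateCol, ← frobNorm_replicateCol, Matrix.replicateCol_mulVec]
  exact frobNorm_mul_le _ _

theorem abs_le_frobNorm (A : Matrix ι κ ℝ) (i : ι) (j : κ) : |A i j| ≤ frobNorm A := by
  refine Real.le_sqrt_of_sq_le ?_
  rw [sq_abs]
  exact (Finset.single_le_sum (f := fun j => A i j ^ 2) (fun _ _ => sq_nonneg _)
    (Finset.mem_univ j)).trans
    (Finset.single_le_sum (f := fun i => ∑ j, A i j ^ 2)
      (fun _ _ => Finset.sum_nonneg fun _ _ => sq_nonneg _) (Finset.mem_univ i))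

theorem frobNorm_le_sum (A : Matrix ι κ ℝ) : frobNorm A ≤ ∑ i, ∑ j, |A i j| := by
  refine Real.sqrt_le_iff.2 ⟨by positivity, ?_⟩
  rw [← Fintype.sum_prod_type', ← Fintype.sum_prod_type']
  refine le_trans (le_of_eq ?_) (Finset.sum_sq_le_sq_sum_of_nonneg fun _ _ => abs_nonneg _)
  simp

theorem frobNorm_sq_eq_trace (A : Matrix ι κ ℝ) : frobNorm A ^ 2 = (Aᵀ * A).trace := by
  rw [frobNorm_sq, Finset.sum_comm]
  simp [Matrix.trace, Matrix.mul_apply, sq]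

theorem frobNorm_sq_of_gram [DecidableEq κ] {A : Matrix ι κ ℝ} {c : ℝ}
    (h : Aᵀ * A = c • 1) : frobNorm A ^ 2 = c * Fintype.card κ := by
  rw [frobNorm_sq_eq_trace, h, Matrix.trace_smul, Matrix.trace_one, smul_eq_mul]

/-- Apply the bound to each column of `B`. The hypothesis is an operator norm bound written as an
inequality of quadratic forms, the form in which the bounds on `P₁`, `P₂` and `D⁻¹` are used
throughout. -/
theorem frobNorm_mul_sq_le {A : Matrix ι κ ℝ} {c : ℝ}
    (h : ∀ x, (A *ᵥ x) ⬝ᵥ (A *ᵥ x) ≤ c * (x ⬝ᵥ x)) (B : Matrix κ μ ℝ) :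
    frobNorm (A * B) ^ 2 ≤ c * frobNorm B ^ 2 := by
  rw [frobNorm_sq, frobNorm_sq, Finset.sum_comm, Finset.sum_comm (γ := κ), Finset.mul_sum]
  refine Finset.sum_le_sum fun j _ => ?_
  have := h (fun k => B k j)
  simpa [dotProduct, Matrix.mulVec, Matrix.mul_apply, sq] using this

/-- Cauchy–Schwarz on the diagonal. This is what bounds the mean of the quadratic noise terms by
`‖D⁻¹‖_F`, at the price of a factor `√p`. -/
theorem abs_trace_le [DecidableEq ι] (A : Matrix ι ι ℝ) :
    |A.trace| ≤ Real.sqrt (Fintype.card ι) * frobNorm A := by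
  refine abs_le_of_sq_le_sq ?_ (mul_nonneg (Real.sqrt_nonneg _) (frobNorm_nonneg _))
  rw [mul_pow, Real.sq_sqrt (Nat.cast_nonneg _), frobNorm_sq, Matrix.trace]
  refine (sq_sum_le_card_mul_sum_sq).trans ?_
  rw [Finset.card_univ]
  gcongr with i
  exact Finset.single_le_sum (f := fun j => A i j ^ 2) (fun _ _ => sq_nonneg _)
    (Finset.mem_univ i)

theorem abs_dotProduct_mulVec_le (A : Matrix ι ι ℝ) (x : ι → ℝ) :
    |x ⬝ᵥ (A *ᵥ x)| ≤ frobNorm A * (x ⬝ᵥ x) := by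
  have h := abs_real_inner_le_norm (WithLp.toLp 2 (A *ᵥ x)) (WithLp.toLp 2 x)
  rw [EuclideanSpace.inner_toLp_toLp] at h
  have h2 := norm_toLp_mulVec_le A x
  have h3 := norm_toLp_sq x
  simp only [star_trivial] at h
  calc |x ⬝ᵥ (A *ᵥ x)| ≤ _ := h
    _ ≤ (frobNorm A * ‖WithLp.toLp 2 x‖) * ‖WithLp.toLp 2 x‖ := by gcongr
    _ = _ := by rw [← h3]; ring

end Frobenius

/-! ### Ordered eigenvalues and Weyl's inequality. -/

section Spectral

theorem exists_orthogonal_eig {T : ℕ} {G : Matrix (Fin T) (Fin T) ℝ} (hG : G.IsHermitian) :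
    ∃ U : Matrix (Fin T) (Fin T) ℝ, Uᵀ * U = 1 ∧ U * Uᵀ = 1 ∧
      G = U * Matrix.diagonal (fun i : Fin T => eig G i) * Uᵀ ∧
      Antitone (fun i : Fin T => eig G i) := by
  have hcard : Fintype.card (Fin T) = T := Fintype.card_fin T
  -- `eigenvalues` is `eigenvalues₀` relabelled by exactly this equivalence, so permuting the
  -- eigenvector columns by `σ` puts them in the decreasing order used by `eig`.
  let e : Fin (Fintype.card (Fin T)) ≃ Fin T := Fintype.equivOfCardEq (Fintype.card_fin _)
  let σ : Fin T ≃ Fin T := (finCongr hcard.symm).trans e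
  have heig : ∀ i : Fin T, eig G i = hG.eigenvalues (σ i) := by
    intro i
    have : (i : ℕ) < Fintype.card (Fin T) := by rw [hcard]; exact i.2
    simp only [eig, hG, this, dif_pos, Matrix.IsHermitian.eigenvalues]
    congr 1
    simp [σ, e]
    rfl
  let U₀ : Matrix (Fin T) (Fin T) ℝ := hG.eigenvectorUnitary
  have hU₀ : U₀ᵀ * U₀ = 1 := Unitary.coe_star_mul_self hG.eigenvectorUnitary
  have hU₀' : U₀ * U₀ᵀ = 1 := Unitary.coe_mul_star_self hG.eigenvectorUnitary
  have hsp : G = U₀ * Matrix.diagonal hG.eigenvalues * U₀ᵀ := by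
    conv_lhs => rw [hG.spectral_theorem]
    rfl
  refine ⟨U₀.submatrix id σ, ?_, ?_, ?_, ?_⟩
  · rw [Matrix.transpose_submatrix, ← Matrix.submatrix_mul _ _ _ _ _ Function.bijective_id, hU₀]
    simp
  · rw [Matrix.transpose_submatrix, Matrix.submatrix_mul_equiv, hU₀']
    simp
  · have : Matrix.diagonal (fun i : Fin T => eig G i)
        = (Matrix.diagonal hG.eigenvalues).submatrix σ σ := by
      rw [Matrix.submatrix_diagonal_equiv]
      congr 1
      funext i
      exact heig i
    rw [this, Matrix.transpose_submatrix, Matrix.submatrix_mul_equiv, Matrix.submatrix_mul_equiv,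
      ← hsp]
    simp
  · intro i j hij
    have hi : (i : ℕ) < Fintype.card (Fin T) := by rw [hcard]; exact i.2
    have hj : (j : ℕ) < Fintype.card (Fin T) := by rw [hcard]; exact j.2
    simp only [eig, hG, hi, hj, dif_pos]
    exact hG.eigenvalues₀_antitone hij

/-- Dimension count: there are `n - (k + 1)` support constraints and at most `k` further equations,
in total fewer than `n`. This is the intersection argument of the Courant–Fischer principle in
coordinates. -/
theorem exists_ne_zero_of_lt {m n : ℕ} (N : Matrix (Fin m) (Fin n) ℝ) {k : ℕ} (hk : k < n) :
    ∃ y : Fin n → ℝ, y ≠ 0 ∧ (∀ j : Fin n, k < (j : ℕ) → y j = 0) ∧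
      ∀ i : Fin m, (i : ℕ) < k → (N *ᵥ y) i = 0 := by
  let L : (Fin n → ℝ) →ₗ[ℝ] (({j : Fin n // k < (j : ℕ)} → ℝ) × (Fin k → ℝ)) :=
    { toFun := fun y => (fun j => y j, fun i => if h : (i : ℕ) < m then (N *ᵥ y) ⟨i, h⟩ else 0)
      map_add' := by
        intro x y
        refine Prod.ext rfl ?_
        funext i
        by_cases h : (i : ℕ) < m <;> simp [h, Matrix.mulVec_add]
      map_smul' := by
        intro c y
        refine Prod.ext rfl ?_
        funext i
        by_cases h : (i : ℕ) < m <;> simp [h, Matrix.mulVec_smul] }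
  have hcard : Fintype.card {j : Fin n // k < (j : ℕ)} + (k + 1) = n := by
    have : Fintype.card {j : Fin n // k < (j : ℕ)} = (Finset.Ioi (⟨k, hk⟩ : Fin n)).card := by
      rw [Fintype.card_subtype]
      congr 1
      ext j
      simp [Fin.lt_def]
    rw [this, Fin.card_Ioi]
    simp only
    omega
  have hker : LinearMap.ker L ≠ ⊥ := by
    refine LinearMap.ker_ne_bot_of_finrank_lt ?_
    rw [Module.finrank_prod, Module.finrank_fintype_fun_eq_card, Module.finrank_fintype_fun_eq_card,
      Module.finrank_fintype_fun_eq_card, Fintype.card_fin, Fintype.card_fin]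
    omega
  obtain ⟨y, hy, hy0⟩ := (Submodule.ne_bot_iff _).1 hker
  rw [LinearMap.mem_ker, Prod.ext_iff] at hy
  refine ⟨y, hy0, fun j hj => congrFun hy.1 ⟨j, hj⟩, fun i hi => ?_⟩
  have := congrFun hy.2 ⟨i, hi⟩
  simpa [L] using this

theorem dotProduct_mulVec_self {ι κ : Type*} [Fintype ι] [Fintype κ] (A : Matrix ι κ ℝ)
    (x : κ → ℝ) : (A *ᵥ x) ⬝ᵥ (A *ᵥ x) = x ⬝ᵥ ((Aᵀ * A) *ᵥ x) := by
  rw [← Matrix.mulVec_mulVec, Matrix.dotProduct_mulVec x, Matrix.vecMul_transpose]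

theorem dotProduct_conj_diagonal {ι κ : Type*} [Fintype ι] [Fintype κ] [DecidableEq κ]
    (A : Matrix ι κ ℝ) (d : κ → ℝ) (x : ι → ℝ) :
    x ⬝ᵥ ((A * Matrix.diagonal d * Aᵀ) *ᵥ x) = ∑ j, d j * ((Aᵀ *ᵥ x) j) ^ 2 := by
  rw [← Matrix.mulVec_mulVec, ← Matrix.mulVec_mulVec, Matrix.dotProduct_mulVec,
    ← Matrix.mulVec_transpose]
  simp only [dotProduct, Matrix.mulVec_diagonal]
  exact Finset.sum_congr rfl fun j _ => by ring

/-- Bessel's inequality for a matrix with orthogonal columns of equal length. -/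
theorem transpose_mulVec_sq_le {ι κ : Type*} [Fintype ι] [Fintype κ] [DecidableEq κ]
    {A : Matrix ι κ ℝ} {c : ℝ} (hc : 0 < c) (hA : Aᵀ * A = c • 1) (x : ι → ℝ) :
    (Aᵀ *ᵥ x) ⬝ᵥ (Aᵀ *ᵥ x) ≤ c * (x ⬝ᵥ x) := by
  set y := Aᵀ *ᵥ x with hy
  have h0 : 0 ≤ (x - c⁻¹ • (A *ᵥ y)) ⬝ᵥ (x - c⁻¹ • (A *ᵥ y)) := Finset.sum_nonneg fun _ _ => mul_self_nonneg _
  have h1 : (A *ᵥ y) ⬝ᵥ (A *ᵥ y) = c * (y ⬝ᵥ y) := by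
    rw [dotProduct_mulVec_self, hA, Matrix.smul_mulVec, Matrix.one_mulVec, dotProduct_smul,
      smul_eq_mul]
  have h2 : x ⬝ᵥ (A *ᵥ y) = y ⬝ᵥ y := by
    rw [Matrix.dotProduct_mulVec, ← Matrix.mulVec_transpose]
  rw [sub_dotProduct, dotProduct_sub, dotProduct_sub, dotProduct_smul, smul_dotProduct,
    smul_dotProduct, dotProduct_smul, h1, dotProduct_comm (A *ᵥ y) x, h2] at h0
  simp only [smul_eq_mul] at h0
  have h3 : c⁻¹ * (c⁻¹ * (c * (y ⬝ᵥ y))) = c⁻¹ * (y ⬝ᵥ y) := by field_simp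
  rw [h3] at h0
  have h4 : c⁻¹ * (y ⬝ᵥ y) ≤ x ⬝ᵥ x := by linarith
  rwa [inv_mul_le_iff₀ hc] at h4

/-- Weyl's inequality for a perturbation of `A diag(s) Aᵀ`, where `A` has orthonormal columns. -/
theorem abs_eig_sub_le {T r : ℕ} {G Δ : Matrix (Fin T) (Fin T) ℝ} (hG : G.IsHermitian)
    {A : Matrix (Fin T) (Fin r) ℝ} (hA : Aᵀ * A = 1) {s : Fin r → ℝ} (hs : Antitone s)
    (hs0 : ∀ k, 0 ≤ s k) (hGA : G = A * Matrix.diagonal s * Aᵀ + Δ) (hrT : r ≤ T) (k : Fin r) :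
    |eig G k - s k| ≤ frobNorm Δ := by
  obtain ⟨U, hU, hU', hGU, hanti⟩ := exists_orthogonal_eig hG
  have hkT : (k : ℕ) < T := k.2.trans_le hrT
  set K : Fin T := ⟨k, hkT⟩ with hK
  have hquad : ∀ x, x ⬝ᵥ (G *ᵥ x) = ∑ i : Fin T, eig G i * ((Uᵀ *ᵥ x) i) ^ 2 := fun x => by
    conv_lhs => rw [hGU]
    exact dotProduct_conj_diagonal _ _ _
  have hquad' : ∀ x, x ⬝ᵥ (G *ᵥ x) = ∑ i, s i * ((Aᵀ *ᵥ x) i) ^ 2 + x ⬝ᵥ (Δ *ᵥ x) := fun x => by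
    rw [hGA, Matrix.add_mulVec, dotProduct_add, dotProduct_conj_diagonal]
  have hUx : ∀ x, ∑ i, ((Uᵀ *ᵥ x) i) ^ 2 = x ⬝ᵥ x := fun x => by
    have := dotProduct_mulVec_self Uᵀ x
    rw [Matrix.transpose_transpose, hU', Matrix.one_mulVec] at this
    rw [← this]; simp [dotProduct, sq]
  have hΔ : ∀ x, |x ⬝ᵥ (Δ *ᵥ x)| ≤ frobNorm Δ * (x ⬝ᵥ x) := abs_dotProduct_mulVec_le Δ
  have hpos : ∀ {n : ℕ} {x : Fin n → ℝ}, x ≠ 0 → 0 < x ⬝ᵥ x := fun hx =>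
    lt_of_le_of_ne (Finset.sum_nonneg fun _ _ => mul_self_nonneg _) fun h => hx (dotProduct_self_eq_zero.1 h.symm)
  rw [abs_le]
  constructor
  -- Lower bound: `x = A y` lies in the span of the first `k + 1` columns of `A` and is orthogonal
  -- to the first `k` eigenvectors of `G`. Its quadratic form is thus at most `eig G k` and at least
  -- `s k - ‖Δ‖`, per unit of squared length.
  · obtain ⟨y, hy0, hy1, hy2⟩ := exists_ne_zero_of_lt (Uᵀ * A) k.2
    have hAx : Aᵀ *ᵥ (A *ᵥ y) = y := by rw [Matrix.mulVec_mulVec, hA, Matrix.one_mulVec]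
    set x := A *ᵥ y with hx
    have hxy : x ⬝ᵥ x = y ⬝ᵥ y := by
      rw [hx, dotProduct_mulVec_self, hA, Matrix.one_mulVec]
    have h1 : x ⬝ᵥ (G *ᵥ x) ≤ eig G k * (x ⬝ᵥ x) := by
      rw [hquad, ← hUx, Finset.mul_sum]
      refine Finset.sum_le_sum fun i _ => ?_
      rcases lt_or_ge (i : ℕ) k with h | h
      · have := hy2 i h
        rw [← Matrix.mulVec_mulVec] at this
        rw [this]; simp
      · exact mul_le_mul_of_nonneg_right (hanti (show K ≤ i from h)) (sq_nonneg _)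
    have h2 : s k * (x ⬝ᵥ x) ≤ ∑ i, s i * ((Aᵀ *ᵥ x) i) ^ 2 := by
      rw [hAx, hxy, dotProduct, Finset.mul_sum]
      refine Finset.sum_le_sum fun i _ => ?_
      rcases le_or_gt i k with h | h
      · rw [sq]; exact mul_le_mul_of_nonneg_right (hs h) (mul_self_nonneg _)
      · rw [hy1 i h]; simp
    have h3 := (abs_le.1 (hΔ x)).1
    rw [hquad'] at h1
    have hx0 : 0 < x ⬝ᵥ x := hxy ▸ hpos hy0
    have : (s k - frobNorm Δ - eig G k) * (x ⬝ᵥ x) ≤ 0 := by linarith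
    nlinarith
  -- Upper bound, with the roles of the columns of `A` and of the eigenvectors of `G` exchanged.
  · obtain ⟨y, hy0, hy1, hy2⟩ := exists_ne_zero_of_lt (Aᵀ * U) hkT
    have hUy : Uᵀ *ᵥ (U *ᵥ y) = y := by rw [Matrix.mulVec_mulVec, hU, Matrix.one_mulVec]
    set x := U *ᵥ y with hx
    have hxy : x ⬝ᵥ x = y ⬝ᵥ y := by
      rw [hx, dotProduct_mulVec_self, hU, Matrix.one_mulVec]
    have h1 : eig G k * (x ⬝ᵥ x) ≤ x ⬝ᵥ (G *ᵥ x) := by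
      rw [hquad, hUy, hxy, dotProduct, Finset.mul_sum]
      refine Finset.sum_le_sum fun i _ => ?_
      rcases le_or_gt (i : ℕ) k with h | h
      · rw [sq]; exact mul_le_mul_of_nonneg_right (hanti (show i ≤ K from h)) (mul_self_nonneg _)
      · rw [hy1 i h]; simp
    have h2 : ∑ i, s i * ((Aᵀ *ᵥ x) i) ^ 2 ≤ s k * (x ⬝ᵥ x) := by
      -- The columns of `A` need not span the space, so only Bessel's inequality is available here;
      -- this is where `0 ≤ s k` is needed.
      have hb := transpose_mulVec_sq_le one_pos (by rw [hA, one_smul]) x (A := A)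
      rw [one_mul] at hb
      refine le_trans ?_ (mul_le_mul_of_nonneg_left hb (hs0 k))
      rw [dotProduct, Finset.mul_sum]
      refine Finset.sum_le_sum fun i _ => ?_
      rw [← sq]
      rcases lt_or_ge i k with h | h
      · have := hy2 i h
        rw [← Matrix.mulVec_mulVec] at this
        rw [this]; simp
      · exact mul_le_mul_of_nonneg_right (hs h) (sq_nonneg _)
    have h3 := (abs_le.1 (hΔ x)).2
    rw [hquad'] at h1
    have hx0 : 0 < x ⬝ᵥ x := hxy ▸ hpos hy0
    have : (eig G k - s k - frobNorm Δ) * (x ⬝ᵥ x) ≤ 0 := by linarith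
    nlinarith

end Spectral

end NetFactor

namespace NetFactor

/-! ### Deterministic perturbation theory of the spiked Gram matrix. -/

section Perturbation

theorem frobNorm_mul_diagonal_le {ι κ : Type*} [Fintype ι] [Fintype κ] [DecidableEq κ]
    (A : Matrix ι κ ℝ) {d : κ → ℝ} {m : ℝ} (hm : 0 ≤ m) (hd : ∀ k, |d k| ≤ m) :
    frobNorm (A * Matrix.diagonal d) ≤ m * frobNorm A := by
  refine le_of_abs_le (abs_le_of_sq_le_sq ?_ (mul_nonneg hm (frobNorm_nonneg A)))
  rw [mul_pow, frobNorm_sq, frobNorm_sq, Finset.mul_sum]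
  refine Finset.sum_le_sum fun i _ => ?_
  rw [Finset.mul_sum]
  refine Finset.sum_le_sum fun j _ => ?_
  rw [Matrix.mul_diagonal, mul_pow, mul_comm]
  exact mul_le_mul_of_nonneg_right (sq_le_sq.2 ((hd j).trans (le_abs_self m))) (sq_nonneg _)

theorem frobNorm_eq_of_gram {ι κ : Type*} [Fintype ι] [Fintype κ] [DecidableEq κ]
    {A : Matrix ι κ ℝ} {c : ℝ} (h : Aᵀ * A = c • 1) :
    frobNorm A = Real.sqrt (c * Fintype.card κ) := by
  rw [← frobNorm_sq_of_gram h, Real.sqrt_sq (frobNorm_nonneg A)]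

theorem inv_diagonal_of_ne_zero {κ : Type*} [Fintype κ] [DecidableEq κ] {d : κ → ℝ}
    (hd : ∀ k, d k ≠ 0) : (Matrix.diagonal d)⁻¹ = Matrix.diagonal fun k => (d k)⁻¹ := by
  refine Matrix.inv_eq_right_inv ?_
  rw [Matrix.diagonal_mul_diagonal, ← Matrix.diagonal_one]
  congr 1
  funext k
  exact mul_inv_cancel₀ (hd k)

/-- A symmetric matrix `G` that is a perturbation, by `Δ`, of the rank `r` matrix `T⁻¹ F S Fᵀ`,
together with its leading eigenvectors, the columns of `Fh`. -/
structure SpikedGram {T r : ℕ} (F Fh : Matrix (Fin T) (Fin r) ℝ) (S Γ : Matrix (Fin r) (Fin r) ℝ)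
    (s : Fin r → ℝ) (G Δ : Matrix (Fin T) (Fin T) ℝ) (c δ : ℝ) : Prop where
  T_pos : 0 < T
  gram_F : Fᵀ * F = (T : ℝ) • 1
  gram_Fh : Fhᵀ * Fh = (T : ℝ) • 1
  isHermitian : G.IsHermitian
  eigenvectors : G * Fh = Fh * Matrix.diagonal fun k : Fin r => eig G k
  orthogonal : Γᵀ * Γ = 1
  spectral : S = Γ * Matrix.diagonal s * Γᵀ
  c_pos : 0 < c
  le_s : ∀ k, c ≤ s k
  gap : ∀ k l : Fin r, k < l → c ≤ s k - s l
  eq_add : G = (T : ℝ)⁻¹ • (F * S * Fᵀ) + Δ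
  frobNorm_le : frobNorm Δ ≤ δ
  δ_le : δ ≤ c / 2

namespace SpikedGram

variable {T r : ℕ} {F Fh : Matrix (Fin T) (Fin r) ℝ} {S Γ : Matrix (Fin r) (Fin r) ℝ}
  {s : Fin r → ℝ} {G Δ : Matrix (Fin T) (Fin T) ℝ} {c δ : ℝ}

theorem T_pos' (h : SpikedGram F Fh S Γ s G Δ c δ) : (0 : ℝ) < T := Nat.cast_pos.2 h.T_pos

theorem δ_nonneg (h : SpikedGram F Fh S Γ s G Δ c δ) : 0 ≤ δ :=
  (frobNorm_nonneg _).trans h.frobNorm_le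

theorem orthogonal' (h : SpikedGram F Fh S Γ s G Δ c δ) : Γ * Γᵀ = 1 :=
  mul_eq_one_comm.1 h.orthogonal

theorem abs_eig_sub (h : SpikedGram F Fh S Γ s G Δ c δ) (k : Fin r) : |eig G k - s k| ≤ δ := by
  have hT := h.T_pos'
  -- For `r > T` the matrix `F` would have a kernel, contradicting the injectivity of `Fᵀ F = T`.
  have hrT : r ≤ T := by
    by_contra! hlt
    obtain ⟨y, hy0, -, hy⟩ := exists_ne_zero_of_lt F hlt
    have hFy : F *ᵥ y = 0 := funext fun i => hy i i.2
    have : (Fᵀ * F) *ᵥ y = 0 := by rw [← Matrix.mulVec_mulVec, hFy, Matrix.mulVec_zero]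
    rw [h.gram_F, Matrix.smul_mulVec, Matrix.one_mulVec] at this
    exact hy0 ((smul_eq_zero.1 this).resolve_left hT.ne')
  have hA : ((Real.sqrt T)⁻¹ • (F * Γ))ᵀ * ((Real.sqrt T)⁻¹ • (F * Γ)) = 1 := by
    rw [Matrix.transpose_smul, Matrix.smul_mul, Matrix.mul_smul, smul_smul, Matrix.transpose_mul,
      Matrix.mul_assoc, ← Matrix.mul_assoc Fᵀ, h.gram_F, Matrix.smul_mul, Matrix.one_mul,
      Matrix.mul_smul, h.orthogonal, smul_smul, ← mul_inv, Real.mul_self_sqrt hT.le,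
      inv_mul_cancel₀ hT.ne', one_smul]
  refine (abs_eig_sub_le h.isHermitian hA (s := s) ?_ ?_ (Δ := Δ) ?_ hrT k).trans h.frobNorm_le
  · intro k l hkl
    rcases hkl.eq_or_lt with rfl | hlt
    · exact le_rfl
    · have := h.gap k l hlt
      linarith [h.c_pos]
  · exact fun k => h.c_pos.le.trans (h.le_s k)
  · rw [h.eq_add, h.spectral]
    congr 1
    rw [Matrix.transpose_smul, Matrix.smul_mul, Matrix.mul_smul, Matrix.smul_mul, smul_smul,
      Matrix.transpose_mul, ← mul_inv, Real.mul_self_sqrt hT.le]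
    simp only [Matrix.mul_assoc]

theorem le_eig (h : SpikedGram F Fh S Γ s G Δ c δ) (k : Fin r) : c / 2 ≤ eig G k := by
  have := (abs_le.1 (h.abs_eig_sub k)).1
  linarith [h.le_s k, h.δ_le]

theorem eig_pos (h : SpikedGram F Fh S Γ s G Δ c δ) (k : Fin r) : 0 < eig G k :=
  (half_pos h.c_pos).trans_le (h.le_eig k)

theorem inv_eig_le (h : SpikedGram F Fh S Γ s G Δ c δ) (k : Fin r) : |(eig G k)⁻¹| ≤ 2 / c := by
  rw [abs_of_pos (inv_pos.2 (h.eig_pos k)), ← inv_div]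
  exact inv_anti₀ (half_pos h.c_pos) (h.le_eig k)

theorem inv_Λ (h : SpikedGram F Fh S Γ s G Δ c δ) :
    (Matrix.diagonal fun k : Fin r => eig G k)⁻¹ = Matrix.diagonal fun k : Fin r => (eig G k)⁻¹ :=
  inv_diagonal_of_ne_zero fun k => (h.eig_pos k).ne'

theorem Λ_mul_inv (h : SpikedGram F Fh S Γ s G Δ c δ) :
    (Matrix.diagonal fun k : Fin r => eig G k) * (Matrix.diagonal fun k : Fin r => eig G k)⁻¹
      = 1 := by
  rw [h.inv_Λ, Matrix.diagonal_mul_diagonal, ← Matrix.diagonal_one]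
  congr 1
  funext k
  exact mul_inv_cancel₀ (h.eig_pos k).ne'

theorem frobNorm_F (h : SpikedGram F Fh S Γ s G Δ c δ) : frobNorm F = Real.sqrt T * Real.sqrt r := by
  rw [frobNorm_eq_of_gram h.gram_F, Fintype.card_fin, Real.sqrt_mul h.T_pos'.le]

theorem frobNorm_Fh (h : SpikedGram F Fh S Γ s G Δ c δ) :
    frobNorm Fh = Real.sqrt T * Real.sqrt r := by
  rw [frobNorm_eq_of_gram h.gram_Fh, Fintype.card_fin, Real.sqrt_mul h.T_pos'.le]

/-- The rotation matrix `H`. -/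
noncomputable def rot {T r : ℕ} (F Fh : Matrix (Fin T) (Fin r) ℝ) (S : Matrix (Fin r) (Fin r) ℝ)
    (G : Matrix (Fin T) (Fin T) ℝ) : Matrix (Fin r) (Fin r) ℝ :=
  S * ((T : ℝ)⁻¹ • (Fᵀ * Fh)) * (Matrix.diagonal fun k : Fin r => eig G k)⁻¹

/-- The eigenvector equation reads `Fh = G Fh Λ⁻¹`, and `rot` is chosen so that `F * rot` is the
contribution of the low rank part of `G`. All later estimates of the estimation error start from
this identity. -/
theorem sub_mul_rot (h : SpikedGram F Fh S Γ s G Δ c δ) :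
    Fh - F * rot F Fh S G = Δ * Fh * (Matrix.diagonal fun k : Fin r => eig G k)⁻¹ := by
  have h1 : Fh = G * Fh * (Matrix.diagonal fun k : Fin r => eig G k)⁻¹ := by
    rw [h.eigenvectors, Matrix.mul_assoc, h.Λ_mul_inv, Matrix.mul_one]
  have h2 : F * rot F Fh S G = (T : ℝ)⁻¹ • (F * S * Fᵀ) * Fh *
      (Matrix.diagonal fun k : Fin r => eig G k)⁻¹ := by
    simp only [rot, Matrix.smul_mul, Matrix.mul_smul, Matrix.mul_assoc]
  have h3 : Δ = G - (T : ℝ)⁻¹ • (F * S * Fᵀ) := by rw [h.eq_add, add_sub_cancel_left]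
  rw [h2, h3, Matrix.sub_mul, Matrix.sub_mul, ← h1]

theorem frobNorm_sub_mul_rot (h : SpikedGram F Fh S Γ s G Δ c δ) :
    frobNorm (Fh - F * rot F Fh S G) ≤ 2 / c * (δ * (Real.sqrt T * Real.sqrt r)) := by
  rw [h.sub_mul_rot, h.inv_Λ]
  refine (frobNorm_mul_diagonal_le _ (div_nonneg two_pos.le h.c_pos.le) h.inv_eig_le).trans ?_
  refine mul_le_mul_of_nonneg_left ?_ (div_nonneg two_pos.le h.c_pos.le)
  refine (frobNorm_mul_le _ _).trans ?_
  rw [h.frobNorm_Fh]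
  exact mul_le_mul_of_nonneg_right h.frobNorm_le (by positivity)

/-- Both `F` and `Fh` have Gram matrix `T`, so `HᵀH - 1` is `T⁻¹` times the difference of the Gram
matrices of `F H = Fh - ρ` and `Fh`, hence linear and quadratic in the small residual `ρ`. -/
theorem frobNorm_rot_gram_sub (h : SpikedGram F Fh S Γ s G Δ c δ) :
    frobNorm ((rot F Fh S G)ᵀ * rot F Fh S G - 1) ≤
      (2 * Real.sqrt r + 2 / c * (δ * Real.sqrt r)) * (2 / c * (δ * Real.sqrt r)) := by
  have hT := h.T_pos'
  set ρ := Fh - F * rot F Fh S G with hρ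
  have hFH : F * rot F Fh S G = Fh - ρ := by rw [hρ]; abel
  have h1 : (F * rot F Fh S G)ᵀ * (F * rot F Fh S G)
      = (T : ℝ) • ((rot F Fh S G)ᵀ * rot F Fh S G) := by
    rw [Matrix.transpose_mul, Matrix.mul_assoc, ← Matrix.mul_assoc Fᵀ, h.gram_F, Matrix.smul_mul,
      Matrix.one_mul, Matrix.mul_smul]
  have h2 : (rot F Fh S G)ᵀ * rot F Fh S G - 1
      = (T : ℝ)⁻¹ • (ρᵀ * ρ - Fhᵀ * ρ - ρᵀ * Fh) := by
    have : (T : ℝ) • ((rot F Fh S G)ᵀ * rot F Fh S G) = (T : ℝ) • 1 +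
        (ρᵀ * ρ - Fhᵀ * ρ - ρᵀ * Fh) := by
      rw [← h1, hFH, ← h.gram_Fh, Matrix.transpose_sub, Matrix.sub_mul, Matrix.mul_sub Fhᵀ,
        Matrix.mul_sub ρᵀ]
      abel
    rw [← inv_smul_smul₀ hT.ne' ((rot F Fh S G)ᵀ * rot F Fh S G), this, smul_add,
      inv_smul_smul₀ hT.ne', add_sub_cancel_left]
  have hbd : frobNorm (ρᵀ * ρ - Fhᵀ * ρ - ρᵀ * Fh) ≤
      (2 * frobNorm Fh + frobNorm ρ) * frobNorm ρ := by
    refine (frobNorm_sub_le _ _).trans ?_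
    have e1 := frobNorm_sub_le (ρᵀ * ρ) (Fhᵀ * ρ)
    have e2 := frobNorm_mul_le ρᵀ ρ
    have e3 := frobNorm_mul_le Fhᵀ ρ
    have e4 := frobNorm_mul_le ρᵀ Fh
    rw [frobNorm_transpose] at e2 e3 e4
    nlinarith
  have hρ' := h.frobNorm_sub_mul_rot
  rw [← hρ] at hρ'
  rw [h2, frobNorm_smul, abs_of_pos (inv_pos.2 hT), inv_mul_le_iff₀ hT]
  refine hbd.trans ?_
  rw [h.frobNorm_Fh]
  have hsT : (T : ℝ) = Real.sqrt T * Real.sqrt T := (Real.mul_self_sqrt hT.le).symm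
  calc _ ≤ (2 * (Real.sqrt T * Real.sqrt r) + 2 / c * (δ * (Real.sqrt T * Real.sqrt r))) *
        (2 / c * (δ * (Real.sqrt T * Real.sqrt r))) := by
        have := h.c_pos
        have := h.δ_nonneg
        gcongr
        exact frobNorm_nonneg _
    _ = (Real.sqrt T * Real.sqrt T) * ((2 * Real.sqrt r + 2 / c * (δ * Real.sqrt r)) *
        (2 / c * (δ * Real.sqrt r))) := by ring
    _ = _ := by rw [← hsT]

/-- Multiplication by `F` scales Frobenius norms by `√T`, and `F H = Fh - ρ`, where `δ ≤ c / 2`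
makes the bound on `ρ` no larger than `‖Fh‖`. -/
theorem frobNorm_rot_le (h : SpikedGram F Fh S Γ s G Δ c δ) :
    frobNorm (rot F Fh S G) ≤ 2 * Real.sqrt r := by
  have hT := h.T_pos'
  have hsT : 0 < Real.sqrt T := Real.sqrt_pos.2 hT
  have h1 : Real.sqrt T * frobNorm (rot F Fh S G) = frobNorm (F * rot F Fh S G) := by
    rw [← Real.sqrt_sq (frobNorm_nonneg (F * rot F Fh S G)), frobNorm_sq_eq_trace,
      Matrix.transpose_mul, Matrix.mul_assoc, ← Matrix.mul_assoc Fᵀ, h.gram_F, Matrix.smul_mul,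
      Matrix.one_mul, Matrix.mul_smul, Matrix.trace_smul, ← frobNorm_sq_eq_trace, smul_eq_mul,
      Real.sqrt_mul hT.le, Real.sqrt_sq (frobNorm_nonneg _)]
  have h2 : frobNorm (F * rot F Fh S G) ≤ frobNorm Fh + frobNorm (Fh - F * rot F Fh S G) := by
    have := frobNorm_sub_le Fh (Fh - F * rot F Fh S G)
    rwa [sub_sub_cancel] at this
  have h3 := h.frobNorm_sub_mul_rot
  rw [h.frobNorm_Fh] at h2
  have h4 : 2 / c * (δ * (Real.sqrt T * Real.sqrt r)) ≤ Real.sqrt T * Real.sqrt r := by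
    rw [← mul_assoc]
    refine mul_le_of_le_one_left (by positivity) ?_
    rw [div_mul_eq_mul_div, div_le_one h.c_pos]
    linarith [h.δ_le]
  refine le_of_mul_le_mul_left ?_ hsT
  rw [h1]
  linarith

/-- A Davis–Kahan argument: `C = T⁻¹ Γᵀ Fᵀ Fh` satisfies the Sylvester equation `C Λ - diag(s) C =
T⁻¹ Γᵀ Fᵀ Δ Fh`. Off the diagonal its coefficient `eig G l - s k` is bounded below by the spectral
gap. -/
theorem abs_cross_offdiag (h : SpikedGram F Fh S Γ s G Δ c δ) {k l : Fin r} (hkl : k ≠ l) :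
    |((T : ℝ)⁻¹ • (Γᵀ * Fᵀ * Fh)) k l| ≤ 2 * r * δ / c := by
  have hT := h.T_pos'
  set C := (T : ℝ)⁻¹ • (Γᵀ * Fᵀ * Fh) with hC
  have h1 : C * (Matrix.diagonal fun k : Fin r => eig G k) - Matrix.diagonal s * C
      = (T : ℝ)⁻¹ • (Γᵀ * Fᵀ * Δ * Fh) := by
    have e1 : C * (Matrix.diagonal fun k : Fin r => eig G k)
        = (T : ℝ)⁻¹ • (Γᵀ * Fᵀ * (G * Fh)) := by
      rw [h.eigenvectors, hC, Matrix.smul_mul, Matrix.mul_assoc _ Fh]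
    have e2 : Γᵀ * Fᵀ * ((F * S * Fᵀ) * Fh) = (T : ℝ) • (Matrix.diagonal s * (Γᵀ * Fᵀ * Fh)) := by
      have : Γᵀ * Fᵀ * ((F * S * Fᵀ) * Fh) = Γᵀ * (Fᵀ * F) * S * Fᵀ * Fh := by
        simp only [Matrix.mul_assoc]
      rw [this, h.gram_F, h.spectral, Matrix.mul_smul, Matrix.mul_one]
      simp only [Matrix.smul_mul, ← Matrix.mul_assoc, h.orthogonal, Matrix.one_mul]
    rw [e1, h.eq_add, Matrix.add_mul, Matrix.mul_add, Matrix.smul_mul, Matrix.mul_smul, e2,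
      inv_smul_smul₀ hT.ne', smul_add, hC, Matrix.mul_smul, add_sub_cancel_left]
    simp only [Matrix.mul_assoc]
  have hΓ : ∀ X : Matrix (Fin r) (Fin r) ℝ, frobNorm (Γᵀ * X) = frobNorm X := fun X => by
    rw [← Real.sqrt_sq (frobNorm_nonneg (Γᵀ * X)), frobNorm_sq_eq_trace, Matrix.transpose_mul,
      Matrix.transpose_transpose, Matrix.mul_assoc, ← Matrix.mul_assoc Γ, h.orthogonal',
      Matrix.one_mul, ← frobNorm_sq_eq_trace, Real.sqrt_sq (frobNorm_nonneg _)]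
  have h2 : frobNorm ((T : ℝ)⁻¹ • (Γᵀ * Fᵀ * Δ * Fh)) ≤ r * δ := by
    rw [frobNorm_smul, abs_of_pos (inv_pos.2 hT), inv_mul_le_iff₀ hT, Matrix.mul_assoc,
      Matrix.mul_assoc, hΓ]
    calc frobNorm (Fᵀ * (Δ * Fh)) ≤ frobNorm F * (frobNorm Δ * frobNorm Fh) := by
          refine (frobNorm_mul_le _ _).trans ?_
          rw [frobNorm_transpose]
          exact mul_le_mul_of_nonneg_left (frobNorm_mul_le _ _) (frobNorm_nonneg _)
      _ ≤ frobNorm F * (δ * frobNorm Fh) := by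
          gcongr
          · exact frobNorm_nonneg _
          · exact frobNorm_nonneg _
          · exact h.frobNorm_le
      _ = (Real.sqrt T * Real.sqrt T) * ((Real.sqrt r * Real.sqrt r) * δ) := by
          rw [h.frobNorm_F, h.frobNorm_Fh]; ring
      _ = T * (r * δ) := by rw [Real.mul_self_sqrt hT.le, Real.mul_self_sqrt (Nat.cast_nonneg _)]
  have h3 : |C k l * (eig G l - s k)| ≤ r * δ := by
    refine le_trans (le_of_eq ?_) ((abs_le_frobNorm _ k l).trans h2)
    rw [← h1, Matrix.sub_apply, Matrix.mul_diagonal, Matrix.diagonal_mul]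
    congr 1; ring
  -- The gap between `s l` and `s k` is at least `c`, and Weyl's inequality moves it by at most `δ ≤
  -- c / 2`.
  have h4 : c / 2 ≤ |eig G l - s k| := by
    have e := abs_le.1 (h.abs_eig_sub l)
    rcases lt_or_gt_of_ne hkl with hlt | hlt
    · have := h.gap k l hlt
      rw [abs_sub_comm]
      refine le_trans ?_ (le_abs_self _)
      linarith [h.δ_le]
    · have := h.gap l k hlt
      refine le_trans ?_ (le_abs_self _)
      linarith [h.δ_le]
  rw [abs_mul] at h3
  have h5 := mul_le_mul_of_nonneg_left h4 (abs_nonneg (C k l))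
  rw [le_div_iff₀ h.c_pos]
  linarith

/-- Column `l` of `C` has squared length `1` up to the part of `Fh` outside the column space of `F`,
which is of order `δ²`, and its off-diagonal entries are of order `δ`. So `C l l ^ 2` is within
`O(δ²)` of `1`, and the sign hypothesis selects the root `1` rather than `-1`. -/
theorem abs_one_sub_cross_diag (h : SpikedGram F Fh S Γ s G Δ c δ) {l : Fin r}
    (hl : 0 ≤ (Γᵀ * Fᵀ * Fh) l l) :
    |1 - ((T : ℝ)⁻¹ • (Γᵀ * Fᵀ * Fh)) l l| ≤
      (1 + r) ^ 2 * (2 / c * (δ * Real.sqrt r)) ^ 2 + r * (2 * r * δ / c) ^ 2 := by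
  have hT := h.T_pos'
  set C := (T : ℝ)⁻¹ • (Γᵀ * Fᵀ * Fh) with hC
  set R := (T : ℝ)⁻¹ • (Fᵀ * Fh) with hR
  have hCR : C = Γᵀ * R := by rw [hC, hR, Matrix.mul_smul, Matrix.mul_assoc]
  have hCC : Cᵀ * C = Rᵀ * R := by
    rw [hCR, Matrix.transpose_mul, Matrix.transpose_transpose, Matrix.mul_assoc,
      ← Matrix.mul_assoc Γ, h.orthogonal', Matrix.one_mul]
  have hFFh : Fᵀ * Fh = (T : ℝ) • R := by rw [hR, smul_inv_smul₀ hT.ne']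
  have hFhF : Fhᵀ * F = (T : ℝ) • Rᵀ := by
    rw [← Matrix.transpose_smul, ← hFFh, Matrix.transpose_mul, Matrix.transpose_transpose]
  -- Pythagoras: `F * R` is the orthogonal projection of `Fh` onto the column space of `F`, so the
  -- defect `1 - RᵀR` is a normalized residual Gram matrix and is quadratic in the residual.
  have hres : (T : ℝ)⁻¹ • ((Fh - F * R)ᵀ * (Fh - F * R)) = 1 - Rᵀ * R := by
    have : (Fh - F * R)ᵀ * (Fh - F * R) = (T : ℝ) • (1 - Rᵀ * R) := by
      rw [Matrix.transpose_sub, Matrix.transpose_mul, Matrix.sub_mul, Matrix.mul_sub,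
        Matrix.mul_sub, h.gram_Fh, ← Matrix.mul_assoc, hFhF, Matrix.mul_assoc, hFFh,
        Matrix.mul_assoc Rᵀ, ← Matrix.mul_assoc Fᵀ F, h.gram_F]
      simp only [Matrix.smul_mul, Matrix.mul_smul, Matrix.one_mul, smul_sub]
      abel
    rw [this, inv_smul_smul₀ hT.ne']
  set ρ := Fh - F * rot F Fh S G with hρ
  -- `Fh` and `ρ` differ by `F H`, which the projection leaves fixed, so they have the same
  -- residual.
  have hproj : Fh - F * R = ρ - F * ((T : ℝ)⁻¹ • (Fᵀ * ρ)) := by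
    have : Fᵀ * ρ = (T : ℝ) • (R - rot F Fh S G) := by
      rw [hρ, Matrix.mul_sub, hFFh, ← Matrix.mul_assoc, h.gram_F, Matrix.smul_mul, Matrix.one_mul,
        smul_sub]
    rw [this, inv_smul_smul₀ hT.ne', Matrix.mul_sub, hρ]
    abel
  have hFF : frobNorm F * frobNorm F = T * r := by
    rw [h.frobNorm_F, mul_mul_mul_comm, Real.mul_self_sqrt hT.le,
      Real.mul_self_sqrt (Nat.cast_nonneg _)]
  have hnorm : frobNorm (Fh - F * R) ≤ (1 + r) * frobNorm ρ := by
    have e1 : frobNorm (F * ((T : ℝ)⁻¹ • (Fᵀ * ρ))) ≤ r * frobNorm ρ := by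
      rw [Matrix.mul_smul, frobNorm_smul, abs_of_pos (inv_pos.2 hT), inv_mul_le_iff₀ hT]
      calc _ ≤ frobNorm F * (frobNorm F * frobNorm ρ) := by
            refine (frobNorm_mul_le _ _).trans ?_
            have := frobNorm_mul_le Fᵀ ρ
            rw [frobNorm_transpose] at this
            exact mul_le_mul_of_nonneg_left this (frobNorm_nonneg _)
        _ = _ := by rw [← mul_assoc, hFF, mul_assoc]
    rw [hproj]
    refine (frobNorm_sub_le _ _).trans ?_
    linarith
  have hρn : frobNorm ρ ≤ Real.sqrt T * (2 / c * (δ * Real.sqrt r)) :=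
    h.frobNorm_sub_mul_rot.trans_eq (by ring)
  have hdef : |(1 - Rᵀ * R) l l| ≤ (1 + r) ^ 2 * (2 / c * (δ * Real.sqrt r)) ^ 2 := by
    refine (abs_le_frobNorm _ l l).trans ?_
    rw [← hres, frobNorm_smul, abs_of_pos (inv_pos.2 hT), inv_mul_le_iff₀ hT]
    have := frobNorm_mul_le (Fh - F * R)ᵀ (Fh - F * R)
    rw [frobNorm_transpose] at this
    refine this.trans ?_
    have e2 : frobNorm (Fh - F * R) ≤ (1 + r) * (Real.sqrt T * (2 / c * (δ * Real.sqrt r))) :=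
      hnorm.trans (mul_le_mul_of_nonneg_left hρn (by positivity))
    calc _ ≤ ((1 + r) * (Real.sqrt T * (2 / c * (δ * Real.sqrt r)))) *
          ((1 + r) * (Real.sqrt T * (2 / c * (δ * Real.sqrt r)))) :=
          mul_self_le_mul_self (frobNorm_nonneg _) e2
      _ = (Real.sqrt T * Real.sqrt T) * ((1 + r) ^ 2 * (2 / c * (δ * Real.sqrt r)) ^ 2) := by ring
      _ = _ := by rw [Real.mul_self_sqrt hT.le]
  have hsum : (Cᵀ * C) l l = C l l ^ 2 + ∑ k ∈ Finset.univ.erase l, C k l ^ 2 := by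
    rw [Matrix.mul_apply, Finset.add_sum_erase _ (fun k => C k l ^ 2) (Finset.mem_univ l)]
    simp [sq]
  have hoff : ∑ k ∈ Finset.univ.erase l, C k l ^ 2 ≤ r * (2 * r * δ / c) ^ 2 := by
    calc _ ≤ ∑ k ∈ (Finset.univ.erase l : Finset (Fin r)), (2 * r * δ / c) ^ 2 := by
          refine Finset.sum_le_sum fun k hk => ?_
          have := h.abs_cross_offdiag (Finset.ne_of_mem_erase hk)
          rw [← sq_abs]
          exact pow_le_pow_left₀ (abs_nonneg _) this 2
      _ ≤ _ := by
          rw [Finset.sum_const, nsmul_eq_mul]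
          refine mul_le_mul_of_nonneg_right ?_ (sq_nonneg _)
          have := Finset.card_le_univ (Finset.univ.erase l : Finset (Fin r))
          rw [Fintype.card_fin] at this
          exact_mod_cast this
  have hoff0 : 0 ≤ ∑ k ∈ Finset.univ.erase l, C k l ^ 2 :=
    Finset.sum_nonneg fun _ _ => sq_nonneg _
  have hl' : 0 ≤ C l l := mul_nonneg (inv_nonneg.2 hT.le) hl
  rw [← hCC, Matrix.sub_apply, Matrix.one_apply_eq, hsum] at hdef
  have hsq : |1 - C l l ^ 2| ≤
      (1 + r) ^ 2 * (2 / c * (δ * Real.sqrt r)) ^ 2 + r * (2 * r * δ / c) ^ 2 := by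
    rw [abs_le] at hdef ⊢
    constructor <;> nlinarith
  refine le_trans ?_ hsq
  have : 1 - C l l ^ 2 = (1 - C l l) * (1 + C l l) := by ring
  rw [this, abs_mul]
  refine le_mul_of_one_le_right (abs_nonneg _) ?_
  rw [abs_of_nonneg (by linarith)]
  linarith

/-- The constant in `frobNorm_align_le`. -/
noncomputable def alignConst (r : ℕ) (c : ℝ) : ℝ :=
  r * (r * (2 / c * (2 * r / c + ((1 + r) ^ 2 * (2 / c * Real.sqrt r) ^ 2 +
    r * (2 * r / c) ^ 2) * (c / 2)) + 2 / c ^ 2))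

/-- With `C` the cross matrix, the left side is `Λ⁻¹ Cᵀ - diag(s)⁻¹`. It is small because `C` is
close to the identity and the eigenvalues of `G` are close to `s`. -/
theorem frobNorm_align_le (h : SpikedGram F Fh S Γ s G Δ c δ)
    (hsign : ∀ l, 0 ≤ (Γᵀ * Fᵀ * Fh) l l) :
    frobNorm ((Matrix.diagonal fun k : Fin r => eig G k)⁻¹ * ((T : ℝ)⁻¹ • (Fᵀ * Fh))ᵀ * Γ -
      (Matrix.diagonal s)⁻¹) ≤ alignConst r c * δ := by
  have hc := h.c_pos
  have hδ := h.δ_nonneg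
  have hs : ∀ k, 0 < s k := fun k => hc.trans_le (h.le_s k)
  set C := (T : ℝ)⁻¹ • (Γᵀ * Fᵀ * Fh) with hC
  have hCt : ((T : ℝ)⁻¹ • (Fᵀ * Fh))ᵀ * Γ = Cᵀ := by
    rw [hC]
    simp only [Matrix.transpose_smul, Matrix.transpose_mul, Matrix.transpose_transpose,
      Matrix.smul_mul, Matrix.mul_assoc]
  -- The diagonal defect is `κ δ²`, made linear in `δ` by `δ ≤ c / 2`. The entrywise bound adds the
  -- diagonal and off-diagonal estimates so as to cover both cases.
  set κ : ℝ := (1 + r) ^ 2 * (2 / c * Real.sqrt r) ^ 2 + r * (2 * r / c) ^ 2 with hκ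
  have hκ0 : 0 ≤ κ := by positivity
  have hentry : ∀ l k, |((Matrix.diagonal fun k : Fin r => eig G k)⁻¹ * Cᵀ -
      (Matrix.diagonal s)⁻¹) l k| ≤ (2 / c * (2 * r / c + κ * (c / 2)) + 2 / c ^ 2) * δ := by
    intro l k
    rw [h.inv_Λ, inv_diagonal_of_ne_zero fun k => (hs k).ne', Matrix.sub_apply,
      Matrix.diagonal_mul, Matrix.transpose_apply]
    have hinv := h.inv_eig_le l
    by_cases hkl : k = l
    · subst hkl
      rw [Matrix.diagonal_apply_eq]
      have e1 : |1 - C k k| ≤ κ * δ * (c / 2) := by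
        refine (h.abs_one_sub_cross_diag (hsign k)).trans ?_
        calc _ = κ * δ * δ := by rw [hκ]; ring
          _ ≤ _ := by gcongr; exact h.δ_le
      have e2 : |(eig G k)⁻¹ - (s k)⁻¹| ≤ 2 / c ^ 2 * δ := by
        rw [inv_sub_inv (h.eig_pos k).ne' (hs k).ne', abs_div, abs_sub_comm,
          abs_of_pos (mul_pos (h.eig_pos k) (hs k))]
        calc _ ≤ δ / (c / 2 * c) := by
              have := (h.eig_pos k).le
              refine div_le_div₀ hδ (h.abs_eig_sub k) (by positivity) ?_
              exact mul_le_mul (h.le_eig k) (h.le_s k) hc.le this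
          _ = _ := by field_simp
      calc |(eig G k)⁻¹ * C k k - (s k)⁻¹|
          = |(eig G k)⁻¹ * (C k k - 1) + ((eig G k)⁻¹ - (s k)⁻¹)| := by congr 1; ring
        _ ≤ |(eig G k)⁻¹| * |C k k - 1| + |(eig G k)⁻¹ - (s k)⁻¹| := by
            rw [← abs_mul]; exact abs_add_le _ _
        _ ≤ 2 / c * (κ * δ * (c / 2)) + 2 / c ^ 2 * δ := by
            rw [abs_sub_comm] at e1
            gcongr
        _ ≤ _ := by
            have : 0 ≤ 2 / c * (2 * r / c) * δ := by positivity
            nlinarith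
    · rw [Matrix.diagonal_apply_ne' _ hkl, sub_zero, abs_mul]
      calc _ ≤ 2 / c * (2 * r * δ / c) := by
            gcongr
            exact h.abs_cross_offdiag hkl
        _ ≤ _ := by
            have e1 : 0 ≤ 2 / c * (κ * (c / 2)) * δ := by positivity
            have e2 : 0 ≤ 2 / c ^ 2 * δ := by positivity
            have e3 : 2 / c * (2 * r * δ / c) = 2 / c * (2 * r / c) * δ := by ring
            nlinarith
  rw [Matrix.mul_assoc, hCt]
  refine (frobNorm_le_sum _).trans ?_
  calc _ ≤ ∑ _l : Fin r, ∑ _k : Fin r, (2 / c * (2 * r / c + κ * (c / 2)) + 2 / c ^ 2) * δ :=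
        Finset.sum_le_sum fun l _ => Finset.sum_le_sum fun k _ => hentry l k
    _ = _ := by
        simp only [Finset.sum_const, Finset.card_univ, Fintype.card_fin, nsmul_eq_mul, alignConst,
          hκ]
        ring

end SpikedGram

end Perturbation

end NetFactor

namespace NetFactor

/-! ### Second moments of linear and quadratic forms in independent noise. -/

section Moments

variable {Ω : Type*} [MeasurableSpace Ω] {P : Measure Ω}

theorem memLp_two_mul_of_indepFun {Y L : Ω → ℝ} (hY : MemLp Y 2 P) (hL : MemLp L 2 P)
    (h : IndepFun Y L P) : MemLp (fun ω => Y ω * L ω) 2 P := by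
  refine (memLp_two_iff_integrable_sq (f := fun ω => Y ω * L ω) (hY.1.mul hL.1)).2 ?_
  have h2 : IndepFun (fun ω => Y ω ^ 2) (fun ω => L ω ^ 2) P :=
    h.comp (φ := fun x => x ^ 2) (ψ := fun x => x ^ 2) (by fun_prop) (by fun_prop)
  have := h2.integrable_mul hY.integrable_sq hL.integrable_sq
  refine this.congr (Eventually.of_forall fun ω => ?_)
  simp [mul_pow]

theorem memLp_two_sq {Y : Ω → ℝ} (hY : MemLp Y 4 P) : MemLp (fun ω => Y ω ^ 2) 2 P := by
  refine (memLp_two_iff_integrable_sq (f := fun ω => Y ω ^ 2) (hY.1.pow 2)).2 ?_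
  have := hY.integrable_norm_pow (p := 4) (by norm_num)
  refine this.congr (Eventually.of_forall fun ω => ?_)
  simp only [Real.norm_eq_abs]
  rw [← pow_mul, Even.pow_abs (by decide)]

/-- The second moment of one step of a centred quadratic form in independent variables. -/
theorem integral_sq_quadratic_step [IsProbabilityMeasure P]
    {X L Y : Ω → ℝ} (n : ℝ) (hX : MemLp X 2 P) (hL : MemLp L 2 P)
    (hY : MemLp Y 4 P) (hind : IndepFun Y (fun ω => (X ω, L ω)) P)
    (hX0 : ∫ ω, X ω ∂P = 0) (hL0 : ∫ ω, L ω ∂P = 0) (hY0 : ∫ ω, Y ω ∂P = 0)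
    (hY1 : ∫ ω, Y ω ^ 2 ∂P = 1) :
    MemLp (fun ω => X ω + Y ω * L ω + n * (Y ω ^ 2 - 1)) 2 P ∧
    ∫ ω, (X ω + Y ω * L ω + n * (Y ω ^ 2 - 1)) ∂P = 0 ∧
    ∫ ω, (X ω + Y ω * L ω + n * (Y ω ^ 2 - 1)) ^ 2 ∂P =
      ∫ ω, X ω ^ 2 ∂P + ∫ ω, L ω ^ 2 ∂P + n ^ 2 * (∫ ω, Y ω ^ 4 ∂P - 1) := by
  have hY2 : MemLp Y 2 P := hY.mono_exponent (by norm_num)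
  have hYL : IndepFun Y L P := hind.comp (φ := id) (ψ := Prod.snd) measurable_id measurable_snd
  have hYX : IndepFun Y X P := hind.comp (φ := id) (ψ := Prod.fst) measurable_id measurable_fst
  have mYL := memLp_two_mul_of_indepFun hY2 hL hYL
  have mZ : MemLp (fun ω => Y ω ^ 2 - 1) 2 P := (memLp_two_sq hY).sub (memLp_const 1)
  have mnZ : MemLp (fun ω => n * (Y ω ^ 2 - 1)) 2 P := mZ.const_mul n
  have iX := hX.integrable one_le_two
  have iL := hL.integrable one_le_two
  have iYL := mYL.integrable one_le_two
  have iY := hY2.integrable one_le_two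
  have iZ := mZ.integrable one_le_two
  have hZ0 : ∫ ω, (Y ω ^ 2 - 1) ∂P = 0 := by
    rw [integral_sub ((memLp_two_sq hY).integrable one_le_two) (integrable_const _), hY1]
    simp
  have eYL : ∫ ω, Y ω * L ω ∂P = 0 := by
    have := hYL.integral_mul_eq_mul_integral hY.1 hL.1
    simp only [Pi.mul_apply] at this
    rw [this, hY0, zero_mul]
  refine ⟨(hX.add mYL).add mnZ, ?_, ?_⟩
  · rw [integral_add (f := fun ω => X ω + Y ω * L ω) (iX.add iYL) (mnZ.integrable one_le_two),
      integral_add iX iYL,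
      integral_const_mul, hX0, eYL, hZ0]
    simp
  · have iXL : Integrable (fun ω => X ω * L ω) P := hX.integrable_mul hL
    have e1 : ∫ ω, Y ω ^ 2 * L ω ^ 2 ∂P = ∫ ω, L ω ^ 2 ∂P := by
      have h2 : IndepFun (fun ω => Y ω ^ 2) (fun ω => L ω ^ 2) P :=
        hYL.comp (φ := fun x => x ^ 2) (ψ := fun x => x ^ 2) (by fun_prop) (by fun_prop)
      have := h2.integral_mul_eq_mul_integral (hY.1.pow 2) (hL.1.pow 2)
      simp only [Pi.mul_apply] at this
      rw [this, hY1, one_mul]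
    have i1 : Integrable (fun ω => Y ω ^ 2 * L ω ^ 2) P := by
      refine mYL.integrable_sq.congr (Eventually.of_forall fun ω => ?_)
      simp [mul_pow]
    have h3 : IndepFun Y (fun ω => X ω * L ω) P :=
      hind.comp (φ := id) (ψ := fun z : ℝ × ℝ => z.1 * z.2) measurable_id (by fun_prop)
    have i3 : Integrable (fun ω => Y ω * (X ω * L ω)) P := h3.integrable_mul iY iXL
    have e3 : ∫ ω, Y ω * (X ω * L ω) ∂P = 0 := by
      have := h3.integral_mul_eq_mul_integral hY.1 iXL.1
      simp only [Pi.mul_apply] at this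
      rw [this, hY0, zero_mul]
    have h4 : IndepFun (fun ω => Y ω ^ 2 - 1) X P :=
      hYX.comp (φ := fun x => x ^ 2 - 1) (ψ := id) (by fun_prop) measurable_id
    have i4 : Integrable (fun ω => (Y ω ^ 2 - 1) * X ω) P := h4.integrable_mul iZ iX
    have e4 : ∫ ω, (Y ω ^ 2 - 1) * X ω ∂P = 0 := by
      have := h4.integral_mul_eq_mul_integral iZ.1 iX.1
      simp only [Pi.mul_apply] at this
      rw [this, hX0, mul_zero]
    have h5 : IndepFun (fun ω => Y ω * (Y ω ^ 2 - 1)) L P :=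
      hYL.comp (φ := fun x => x * (x ^ 2 - 1)) (ψ := id) (by fun_prop) measurable_id
    have iYZ : Integrable (fun ω => Y ω * (Y ω ^ 2 - 1)) P := hY2.integrable_mul mZ
    have i5 : Integrable (fun ω => Y ω * (Y ω ^ 2 - 1) * L ω) P := h5.integrable_mul iYZ iL
    have e5 : ∫ ω, Y ω * (Y ω ^ 2 - 1) * L ω ∂P = 0 := by
      have := h5.integral_mul_eq_mul_integral iYZ.1 iL.1
      simp only [Pi.mul_apply] at this
      rw [this, hL0, mul_zero]
    have i6 := mZ.integrable_sq
    have iY4 : Integrable (fun ω => Y ω ^ 4) P := by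
      refine (memLp_two_sq hY).integrable_sq.congr (Eventually.of_forall fun ω => ?_)
      simp only; ring
    have e6 : ∫ ω, (Y ω ^ 2 - 1) ^ 2 ∂P = ∫ ω, Y ω ^ 4 ∂P - 1 := by
      have : ∀ ω, (Y ω ^ 2 - 1) ^ 2 = Y ω ^ 4 - 2 * (Y ω ^ 2 - 1) - 1 := fun ω => by ring
      simp only [this]
      rw [integral_sub (f := fun ω => Y ω ^ 4 - 2 * (Y ω ^ 2 - 1)) (iY4.sub (iZ.const_mul 2))
        (integrable_const _),
        integral_sub iY4 (iZ.const_mul 2), integral_const_mul, hZ0]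
      simp
    -- The last three terms integrate to zero: each is a product over independent factors, one of
    -- which is `Y`, `X` or `L` and has mean zero.
    have hexp : ∀ ω, (X ω + Y ω * L ω + n * (Y ω ^ 2 - 1)) ^ 2 =
        X ω ^ 2 + (Y ω ^ 2 * L ω ^ 2 + (n ^ 2 * (Y ω ^ 2 - 1) ^ 2 + (2 * (Y ω * (X ω * L ω)) +
          (2 * n * ((Y ω ^ 2 - 1) * X ω) + 2 * n * (Y ω * (Y ω ^ 2 - 1) * L ω))))) := fun ω => by
      ring
    simp only [hexp]
    have j5 : Integrable (fun ω => 2 * n * ((Y ω ^ 2 - 1) * X ω) +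
        2 * n * (Y ω * (Y ω ^ 2 - 1) * L ω)) P :=
      (i4.const_mul (2 * n)).add (i5.const_mul (2 * n))
    have j4 : Integrable (fun ω => 2 * (Y ω * (X ω * L ω)) + (2 * n * ((Y ω ^ 2 - 1) * X ω) +
        2 * n * (Y ω * (Y ω ^ 2 - 1) * L ω))) P := (i3.const_mul 2).add j5
    have j3 : Integrable (fun ω => n ^ 2 * (Y ω ^ 2 - 1) ^ 2 + (2 * (Y ω * (X ω * L ω)) +
        (2 * n * ((Y ω ^ 2 - 1) * X ω) + 2 * n * (Y ω * (Y ω ^ 2 - 1) * L ω)))) P :=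
      (i6.const_mul (n ^ 2)).add j4
    have j2 : Integrable (fun ω => Y ω ^ 2 * L ω ^ 2 + (n ^ 2 * (Y ω ^ 2 - 1) ^ 2 +
        (2 * (Y ω * (X ω * L ω)) + (2 * n * ((Y ω ^ 2 - 1) * X ω) +
          2 * n * (Y ω * (Y ω ^ 2 - 1) * L ω))))) P := i1.add j3
    rw [integral_add hX.integrable_sq j2, integral_add i1 j3,
      integral_add (i6.const_mul (n ^ 2)) j4, integral_add (i3.const_mul 2) j5,
      integral_add (i4.const_mul (2 * n)) (i5.const_mul (2 * n)), integral_const_mul,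
      integral_const_mul, integral_const_mul, integral_const_mul, e1, e3, e4, e5, e6]
    ring

/-- Independent standardized random variables with fourth moments at most `K`. -/
structure IsNoise {ι : Type*} (P : Measure Ω) (ε : ι → Ω → ℝ) (K : ℝ) : Prop where
  measurable : ∀ i, Measurable (ε i)
  indep : iIndepFun ε P
  mean : ∀ i, ∫ ω, ε i ω ∂P = 0
  second : ∀ i, ∫ ω, ε i ω ^ 2 ∂P = 1
  memLp : ∀ i, MemLp (ε i) 4 P
  fourth : ∀ i, ∫ ω, ε i ω ^ 4 ∂P ≤ K

namespace IsNoise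

variable {ι : Type*} {ε : ι → Ω → ℝ} {K : ℝ}

theorem memLp_two [IsProbabilityMeasure P]
    (h : IsNoise P ε K) (i : ι) : MemLp (ε i) 2 P :=
  (h.memLp i).mono_exponent (by norm_num)

theorem memLp_linear [IsProbabilityMeasure P]
    (h : IsNoise P ε K) (s : Finset ι) (a : ι → ℝ) :
    MemLp (fun ω => ∑ i ∈ s, a i * ε i ω) 2 P :=
  memLp_finsetSum s fun i _ => (h.memLp_two i).const_mul (a i)

theorem integral_linear [IsProbabilityMeasure P]
    (h : IsNoise P ε K) (s : Finset ι) (a : ι → ℝ) :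
    ∫ ω, ∑ i ∈ s, a i * ε i ω ∂P = 0 := by
  rw [integral_finsetSum _ fun i _ => ((h.memLp_two i).integrable one_le_two).const_mul (a i)]
  refine Finset.sum_eq_zero fun i _ => ?_
  rw [integral_const_mul, h.mean, mul_zero]

theorem integral_mul [DecidableEq ι] (h : IsNoise P ε K) (i j : ι) :
    ∫ ω, ε i ω * ε j ω ∂P = if i = j then 1 else 0 := by
  split_ifs with hij
  · subst hij
    simp only [← sq, h.second]
  · have := (h.indep.indepFun hij).integral_mul_eq_mul_integral (h.memLp i).1 (h.memLp j).1
    simp only [Pi.mul_apply] at this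
    rw [this, h.mean, zero_mul]

theorem integral_linear_mul [IsProbabilityMeasure P]
    (h : IsNoise P ε K) (s : Finset ι) (a b : ι → ℝ) :
    ∫ ω, (∑ i ∈ s, a i * ε i ω) * (∑ i ∈ s, b i * ε i ω) ∂P = ∑ i ∈ s, a i * b i := by
  classical
  have hint : ∀ i j, Integrable (fun ω => a i * ε i ω * (b j * ε j ω)) P := fun i j =>
    ((h.memLp_two i).const_mul (a i)).integrable_mul ((h.memLp_two j).const_mul (b j))
  simp only [Finset.sum_mul_sum]
  rw [integral_finsetSum _ fun i _ => integrable_finsetSum _ fun j _ => hint i j]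
  refine Finset.sum_congr rfl fun i hi => ?_
  rw [integral_finsetSum _ fun j _ => hint i j]
  have : ∀ j, ∫ ω, a i * ε i ω * (b j * ε j ω) ∂P = if i = j then a i * b j else 0 := fun j => by
    have e : ∀ ω, a i * ε i ω * (b j * ε j ω) = (a i * b j) * (ε i ω * ε j ω) := fun ω => by ring
    simp only [e]
    rw [integral_const_mul, h.integral_mul]
    split_ifs <;> simp
  simp only [this, Finset.sum_ite_eq, hi, if_true]

/-- The second moment of a centred quadratic form. -/
theorem centred_quadratic [IsProbabilityMeasure P]
    (h : IsNoise P ε K) (N : ι → ι → ℝ) (s : Finset ι) :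
    MemLp (fun ω => ∑ i ∈ s, ∑ j ∈ s, N i j * (ε i ω * ε j ω) - ∑ i ∈ s, N i i) 2 P ∧
    ∫ ω, (∑ i ∈ s, ∑ j ∈ s, N i j * (ε i ω * ε j ω) - ∑ i ∈ s, N i i) ∂P = 0 ∧
    ∫ ω, (∑ i ∈ s, ∑ j ∈ s, N i j * (ε i ω * ε j ω) - ∑ i ∈ s, N i i) ^ 2 ∂P ≤
      (K + 2) * ∑ i ∈ s, ∑ j ∈ s, N i j ^ 2 := by
  classical
  induction s using Finset.induction_on with
  | empty => simp
  | insert i s hi ih =>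
    obtain ⟨ihm, ih0, ih2⟩ := ih
    set X : Ω → ℝ := fun ω => ∑ i ∈ s, ∑ j ∈ s, N i j * (ε i ω * ε j ω) - ∑ i ∈ s, N i i with hX
    set L : Ω → ℝ := fun ω => ∑ j ∈ s, (N i j + N j i) * ε j ω with hL
    -- Adding an index adds a term linear in the new variable and a centred square. The variable is
    -- independent of the pair `(X, L)`, so the second moments simply add up. The fourth moment
    -- enters only through the diagonal, and the off-diagonal entries cost the factor `2`.
    have hexp : ∀ ω, ∑ a ∈ insert i s, ∑ b ∈ insert i s, N a b * (ε a ω * ε b ω) -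
        ∑ a ∈ insert i s, N a a = X ω + ε i ω * L ω + N i i * (ε i ω ^ 2 - 1) := by
      intro ω
      simp only [Finset.sum_insert hi, hX, hL, Finset.sum_add_distrib, add_mul, mul_add,
        Finset.mul_sum]
      have e1 : ∀ x ∈ s, N x i * (ε x ω * ε i ω) = ε i ω * (N x i * ε x ω) := fun x _ => by ring
      have e2 : ∀ x ∈ s, N i x * (ε i ω * ε x ω) = ε i ω * (N i x * ε x ω) := fun x _ => by ring
      rw [Finset.sum_congr rfl e1, Finset.sum_congr rfl e2]
      ring
    have hind : IndepFun (ε i) (fun ω => (X ω, L ω)) P := by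
      have h1 := h.indep.indepFun_finset {i} s (by simpa using hi) h.measurable
      refine h1.comp (φ := fun x => x ⟨i, Finset.mem_singleton_self i⟩)
        (ψ := fun x => (∑ a : s, ∑ b : s, N a b * (x a * x b) - ∑ a ∈ s, N a a,
          ∑ b : s, (N i b + N b i) * x b)) (by fun_prop) (by fun_prop) |>.congr ?_ ?_
      · exact Eventually.of_forall fun ω => rfl
      · refine Eventually.of_forall fun ω => ?_
        simp only [Function.comp, hX, hL]
        congr 1
        · congr 1
          rw [← Finset.sum_coe_sort s]
          refine Finset.sum_congr rfl fun a _ => ?_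
          rw [← Finset.sum_coe_sort s]
        · rw [← Finset.sum_coe_sort s]
    obtain ⟨r1, r2, r3⟩ := integral_sq_quadratic_step (N i i) ihm (h.memLp_linear s _) (h.memLp i)
      hind ih0 (h.integral_linear s _) (h.mean i) (h.second i)
    simp only [hexp]
    refine ⟨r1, r2, ?_⟩
    rw [r3]
    have hL2 : ∫ ω, L ω ^ 2 ∂P = ∑ j ∈ s, (N i j + N j i) ^ 2 := by
      have := h.integral_linear_mul s (fun j => N i j + N j i) (fun j => N i j + N j i)
      simpa only [← sq] using this
    have hK : 0 ≤ K := le_trans (integral_nonneg fun ω => by positivity) (h.fourth i)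
    have hsum : ∑ a ∈ insert i s, ∑ b ∈ insert i s, N a b ^ 2 =
        ∑ a ∈ s, ∑ b ∈ s, N a b ^ 2 + (∑ j ∈ s, N i j ^ 2 + ∑ j ∈ s, N j i ^ 2) + N i i ^ 2 := by
      simp only [Finset.sum_insert hi, Finset.sum_add_distrib]
      ring
    have hLe : ∑ j ∈ s, (N i j + N j i) ^ 2 ≤ 2 * (∑ j ∈ s, N i j ^ 2 + ∑ j ∈ s, N j i ^ 2) := by
      rw [← Finset.sum_add_distrib, Finset.mul_sum]
      exact Finset.sum_le_sum fun j _ => by nlinarith [sq_nonneg (N i j - N j i)]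
    have h0 : 0 ≤ ∑ j ∈ s, N i j ^ 2 + ∑ j ∈ s, N j i ^ 2 := by positivity
    rw [hL2, hsum]
    nlinarith [sq_nonneg (N i i), h.fourth i, mul_nonneg hK h0,
      mul_le_mul_of_nonneg_left (h.fourth i) (sq_nonneg (N i i))]

theorem lintegral_linear_sq [IsProbabilityMeasure P]
    [Fintype ι] (h : IsNoise P ε K) (a : ι → ℝ) :
    ∫⁻ ω, ENNReal.ofReal ((∑ i, a i * ε i ω) ^ 2) ∂P = ENNReal.ofReal (∑ i, a i ^ 2) := by
  rw [← ofReal_integral_eq_lintegral_ofReal (h.memLp_linear _ a).integrable_sq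
    (Eventually.of_forall fun ω => sq_nonneg _)]
  congr 1
  have := h.integral_linear_mul Finset.univ a a
  simpa only [← sq] using this

/-- The form is its mean, the trace of the kernel, plus the centred form; the square of the sum is
at most twice the sum of squares. -/
theorem lintegral_quadratic_sq [IsProbabilityMeasure P]
    [Fintype ι] (h : IsNoise P ε K) (N : ι → ι → ℝ) :
    ∫⁻ ω, ENNReal.ofReal ((∑ i, ∑ j, N i j * (ε i ω * ε j ω)) ^ 2) ∂P ≤
      ENNReal.ofReal (2 * (∑ i, N i i) ^ 2 + 2 * (K + 2) * ∑ i, ∑ j, N i j ^ 2) := by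
  obtain ⟨m, -, i⟩ := h.centred_quadratic N Finset.univ
  set Q : Ω → ℝ := fun ω => ∑ i, ∑ j, N i j * (ε i ω * ε j ω) - ∑ i, N i i with hQ
  have hle : ∀ ω, (∑ i, ∑ j, N i j * (ε i ω * ε j ω)) ^ 2 ≤
      2 * (∑ i, N i i) ^ 2 + 2 * Q ω ^ 2 := fun ω => by
    have : ∑ i, ∑ j, N i j * (ε i ω * ε j ω) = ∑ i, N i i + Q ω := by rw [hQ]; ring
    rw [this]
    nlinarith [sq_nonneg (∑ i, N i i - Q ω)]
  calc _ ≤ ∫⁻ ω, ENNReal.ofReal (2 * (∑ i, N i i) ^ 2 + 2 * Q ω ^ 2) ∂P :=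
        lintegral_mono fun ω => ENNReal.ofReal_le_ofReal (hle ω)
    _ = ENNReal.ofReal (∫ ω, (2 * (∑ i, N i i) ^ 2 + 2 * Q ω ^ 2) ∂P) :=
        (ofReal_integral_eq_lintegral_ofReal ((integrable_const _).add
          (m.integrable_sq.const_mul 2)) (Eventually.of_forall fun ω =>
            add_nonneg (mul_nonneg two_pos.le (sq_nonneg _))
              (mul_nonneg two_pos.le (sq_nonneg _)))).symm
    _ ≤ _ := by
        refine ENNReal.ofReal_le_ofReal ?_
        have hi : ∫ ω, Q ω ^ 2 ∂P ≤ (K + 2) * ∑ i, ∑ j, N i j ^ 2 := i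
        rw [integral_add (integrable_const _) (m.integrable_sq.const_mul 2), integral_const,
          integral_const_mul, probReal_univ, one_smul]
        linarith

end IsNoise

section MatrixNoise

variable {τ π κ μ : Type*} [Fintype τ] [Fintype π] [Fintype κ] [Fintype μ]
  {ε : Ω → Matrix τ π ℝ} {K : ℝ}

theorem lintegral_frobNorm_sq_le {Z : Ω → Matrix κ μ ℝ}
    (hZ : ∀ k l, Measurable fun ω => Z ω k l) {b : κ → μ → ℝ} (hb : ∀ k l, 0 ≤ b k l)
    (h : ∀ k l, ∫⁻ ω, ENNReal.ofReal (Z ω k l ^ 2) ∂P ≤ ENNReal.ofReal (b k l)) :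
    ∫⁻ ω, ENNReal.ofReal (frobNorm (Z ω) ^ 2) ∂P ≤ ENNReal.ofReal (∑ k, ∑ l, b k l) := by
  have e : ∀ ω, ENNReal.ofReal (frobNorm (Z ω) ^ 2)
      = ∑ k, ∑ l, ENNReal.ofReal (Z ω k l ^ 2) := fun ω => by
    rw [frobNorm_sq, ENNReal.ofReal_sum_of_nonneg (f := fun k => ∑ l, Z ω k l ^ 2)
      fun k _ => Finset.sum_nonneg fun l _ => sq_nonneg _]
    refine Finset.sum_congr rfl fun k _ => ?_
    rw [ENNReal.ofReal_sum_of_nonneg (f := fun l => Z ω k l ^ 2) fun l _ => sq_nonneg _]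
  simp only [e]
  have hm : ∀ k l, Measurable fun ω => ENNReal.ofReal (Z ω k l ^ 2) := fun k l =>
    ((hZ k l).pow_const 2).ennreal_ofReal
  rw [lintegral_finsetSum _ fun k _ => Finset.measurable_sum _ fun l _ => hm k l,
    ENNReal.ofReal_sum_of_nonneg fun k _ => Finset.sum_nonneg fun l _ => hb k l]
  refine Finset.sum_le_sum fun k _ => ?_
  rw [lintegral_finsetSum _ fun l _ => hm k l, ENNReal.ofReal_sum_of_nonneg fun l _ => hb k l]
  exact Finset.sum_le_sum fun l _ => h k l

theorem measurable_mul_apply {κ μ : Type*} {A : Ω → Matrix κ τ ℝ} {B : Ω → Matrix τ μ ℝ}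
    (hA : ∀ i j, Measurable fun ω => A ω i j) (hB : ∀ i j, Measurable fun ω => B ω i j)
    (i : κ) (j : μ) : Measurable fun ω => (A ω * B ω) i j := by
  simp only [Matrix.mul_apply]
  exact Finset.measurable_sum _ fun k _ => (hA i k).mul (hB k j)

theorem lintegral_linear_frobNorm_sq [IsProbabilityMeasure P]
    (h : IsNoise P (fun (i : τ × π) ω => ε ω i.1 i.2) K)
    (A : Matrix κ τ ℝ) (N : Matrix π μ ℝ) :
    ∫⁻ ω, ENNReal.ofReal (frobNorm (A * ε ω * N) ^ 2) ∂P ≤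
      ENNReal.ofReal (frobNorm A ^ 2 * frobNorm N ^ 2) := by
  have hε : ∀ i j, Measurable fun ω => ε ω i j := fun i j => h.measurable (i, j)
  have hentry : ∀ ω k l, (A * ε ω * N) k l = ∑ i : τ × π, (A k i.1 * N i.2 l) * ε ω i.1 i.2 := by
    intro ω k l
    rw [Fintype.sum_prod_type_right, Matrix.mul_apply]
    refine Finset.sum_congr rfl fun j _ => ?_
    rw [Matrix.mul_apply, Finset.sum_mul]
    exact Finset.sum_congr rfl fun i _ => by ring
  have hm : ∀ k l, Measurable fun ω => (A * ε ω * N) k l := fun k l => by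
    simp only [hentry]
    exact Finset.measurable_sum _ fun i _ => (hε _ _).const_mul _
  have hle : ∀ k l, ∫⁻ ω, ENNReal.ofReal ((A * ε ω * N) k l ^ 2) ∂P ≤
      ENNReal.ofReal (∑ i : τ × π, (A k i.1 * N i.2 l) ^ 2) := fun k l => by
    simp only [hentry]
    exact (h.lintegral_linear_sq fun i => A k i.1 * N i.2 l).le
  refine (lintegral_frobNorm_sq_le hm (fun k l => by positivity) hle).trans_eq ?_
  · congr 1
    rw [frobNorm_sq, frobNorm_sq, Finset.sum_comm (γ := π), Finset.sum_mul]
    refine Finset.sum_congr rfl fun k _ => ?_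
    rw [Finset.mul_sum]
    refine Finset.sum_congr rfl fun l _ => ?_
    rw [Fintype.sum_prod_type, Finset.sum_mul_sum]
    simp only [mul_pow]

/-- Each entry is a quadratic form whose kernel is a product of entries of `A`, `M` and `Q`. Its
trace factors as `(A Q) k l` times `tr M`, and its sum of squares factors as well. Keeping `‖A Q‖`
in the mean, instead of `‖A‖ ‖Q‖`, is essential for the sharp rates. -/
theorem lintegral_quadratic_frobNorm_sq [IsProbabilityMeasure P]
    (hK : 0 ≤ K)
    (h : IsNoise P (fun (i : τ × π) ω => ε ω i.1 i.2) K)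
    (A : Matrix κ τ ℝ) (M : Matrix π π ℝ) (Q : Matrix τ μ ℝ) :
    ∫⁻ ω, ENNReal.ofReal (frobNorm (A * ε ω * M * (ε ω)ᵀ * Q) ^ 2) ∂P ≤
      ENNReal.ofReal (2 * (frobNorm (A * Q) ^ 2 * M.trace ^ 2) +
        2 * (K + 2) * (frobNorm A ^ 2 * frobNorm Q ^ 2 * frobNorm M ^ 2)) := by
  have hε : ∀ i j, Measurable fun ω => ε ω i j := fun i j => h.measurable (i, j)
  let N : κ → μ → τ × π → τ × π → ℝ := fun k l i j => A k i.1 * M i.2 j.2 * Q j.1 l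
  have hentry : ∀ ω k l, (A * ε ω * M * (ε ω)ᵀ * Q) k l =
      ∑ i : τ × π, ∑ j : τ × π, N k l i j * (ε ω i.1 i.2 * ε ω j.1 j.2) := by
    intro ω k l
    have : A * ε ω * M * (ε ω)ᵀ * Q = (A * ε ω) * (M * ((ε ω)ᵀ * Q)) := by
      simp only [Matrix.mul_assoc]
    rw [this]
    rw [Matrix.mul_apply, Fintype.sum_prod_type_right]
    refine Finset.sum_congr rfl fun a _ => ?_
    rw [Matrix.mul_apply, Matrix.mul_apply, Finset.sum_mul]
    refine Finset.sum_congr rfl fun b _ => ?_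
    rw [Finset.mul_sum, Fintype.sum_prod_type_right]
    refine Finset.sum_congr rfl fun c _ => ?_
    rw [Matrix.mul_apply, Finset.mul_sum, Finset.mul_sum]
    refine Finset.sum_congr rfl fun d _ => ?_
    simp only [N, Matrix.transpose_apply]
    ring
  have hm : ∀ k l, Measurable fun ω => (A * ε ω * M * (ε ω)ᵀ * Q) k l := fun k l => by
    simp only [hentry]
    exact Finset.measurable_sum _ fun i _ => Finset.measurable_sum _ fun j _ =>
      ((hε _ _).mul (hε _ _)).const_mul _
  have hle : ∀ k l, ∫⁻ ω, ENNReal.ofReal ((A * ε ω * M * (ε ω)ᵀ * Q) k l ^ 2) ∂P ≤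
      ENNReal.ofReal (2 * (∑ i, N k l i i) ^ 2 + 2 * (K + 2) * ∑ i, ∑ j, N k l i j ^ 2) :=
    fun k l => by
      simp only [hentry]
      exact h.lintegral_quadratic_sq (N k l)
  refine (lintegral_frobNorm_sq_le hm (fun k l => by positivity) hle).trans_eq ?_
  · congr 1
    have e1 : ∀ k l, ∑ i, N k l i i = (A * Q) k l * M.trace := by
      intro k l
      simp only [N, Matrix.mul_apply, Matrix.trace, Fintype.sum_prod_type, Finset.sum_mul_sum,
        Matrix.diag_apply]
      refine Finset.sum_congr rfl fun a _ => Finset.sum_congr rfl fun b _ => ?_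
      ring
    have e2 : ∀ k l, ∑ i, ∑ j, N k l i j ^ 2 =
        (∑ t, A k t ^ 2) * (∑ t, Q t l ^ 2) * frobNorm M ^ 2 := by
      intro k l
      rw [frobNorm_sq, mul_assoc, Finset.sum_mul, Fintype.sum_prod_type]
      refine Finset.sum_congr rfl fun a _ => ?_
      rw [Finset.mul_sum, Finset.mul_sum]
      refine Finset.sum_congr rfl fun b _ => ?_
      rw [Finset.sum_mul, Finset.mul_sum, Fintype.sum_prod_type]
      refine Finset.sum_congr rfl fun c _ => ?_
      rw [Finset.mul_sum, Finset.mul_sum]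
      refine Finset.sum_congr rfl fun d _ => ?_
      simp only [N]
      ring
    simp only [e1, e2, Finset.sum_add_distrib, ← Finset.mul_sum, mul_pow]
    congr 2
    · rw [frobNorm_sq]
      simp only [Finset.sum_mul]
    · rw [frobNorm_sq A, frobNorm_sq Q, Finset.sum_comm (γ := τ) (f := fun i j => Q i j ^ 2)]
      simp only [← Finset.sum_mul, ← Finset.mul_sum]

end MatrixNoise

/-- Tonelli for the joint law, which is a product by independence. It allows the noise bounds to be
applied with the factor scores frozen. -/
theorem lintegral_indepFun [IsProbabilityMeasure P]
    {α β : Type*} [MeasurableSpace α] [MeasurableSpace β] {X : Ω → α}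
    {Y : Ω → β} (hX : Measurable X) (hY : Measurable Y) (h : IndepFun X Y P)
    {φ : α → β → ENNReal} (hφ : Measurable (Function.uncurry φ)) :
    ∫⁻ ω, φ (X ω) (Y ω) ∂P = ∫⁻ ω, ∫⁻ ω', φ (X ω') (Y ω) ∂P ∂P := by
  have h1 := (indepFun_iff_map_prod_eq_prod_map_map hX.aemeasurable hY.aemeasurable).1 h
  have : IsProbabilityMeasure (P.map X) := Measure.isProbabilityMeasure_map hX.aemeasurable
  have : IsProbabilityMeasure (P.map Y) := Measure.isProbabilityMeasure_map hY.aemeasurable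
  calc ∫⁻ ω, φ (X ω) (Y ω) ∂P
      = ∫⁻ z, Function.uncurry φ z ∂(P.map fun ω => (X ω, Y ω)) :=
        (lintegral_map hφ (hX.prodMk hY)).symm
    _ = ∫⁻ y, ∫⁻ x, Function.uncurry φ (x, y) ∂(P.map X) ∂(P.map Y) := by
        rw [h1, lintegral_prod_symm' _ hφ]
    _ = ∫⁻ ω, ∫⁻ x, Function.uncurry φ (x, Y ω) ∂(P.map X) ∂P :=
        lintegral_map hφ.lintegral_prod_left' hY
    _ = _ := by
        refine lintegral_congr fun ω => ?_
        exact lintegral_map (f := fun x => Function.uncurry φ (x, Y ω))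
          (hφ.comp (measurable_id.prodMk measurable_const)) hX

end Moments

end NetFactor

namespace NetFactor

/-! ### Quadratic form bounds for matrices, transposes and inverses. -/

section MatrixBounds

variable {ι κ : Type*} [Fintype ι] [Fintype κ]

theorem isUnit_one_add [DecidableEq ι] {Q : Matrix ι ι ℝ} (hQ : ∀ x, 0 ≤ x ⬝ᵥ (Q *ᵥ x)) : IsUnit (1 + Q) := by
  rw [← Matrix.mulVec_injective_iff_isUnit]
  refine (injective_iff_map_eq_zero (Matrix.mulVecLin (1 + Q))).2 fun x hx => ?_
  have h1 : x ⬝ᵥ ((1 + Q) *ᵥ x) = 0 := by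
    rw [show (1 + Q) *ᵥ x = 0 from hx, dotProduct_zero]
  rw [Matrix.add_mulVec, Matrix.one_mulVec, dotProduct_add] at h1
  have h2 : 0 ≤ x ⬝ᵥ x := Finset.sum_nonneg fun _ _ => mul_self_nonneg _
  exact dotProduct_self_eq_zero.1 (le_antisymm (by linarith [hQ x]) h2)

/-- With `x = y + Q y`, the squared length of `x` is that of `y` plus the nonnegative terms `2 y·Qy`
and `‖Qy‖²`. -/
theorem inv_one_add_contraction [DecidableEq ι] {Q : Matrix ι ι ℝ}
    (hQ : ∀ x, 0 ≤ x ⬝ᵥ (Q *ᵥ x)) (x : ι → ℝ) :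
    (((1 + Q)⁻¹) *ᵥ x) ⬝ᵥ (((1 + Q)⁻¹) *ᵥ x) ≤ x ⬝ᵥ x := by
  have hdet := (Matrix.isUnit_iff_isUnit_det _).1 (isUnit_one_add hQ)
  set y := ((1 + Q)⁻¹) *ᵥ x with hy
  have hx : x = y + Q *ᵥ y := by
    have : (1 + Q) *ᵥ y = x := by
      rw [hy, Matrix.mulVec_mulVec, Matrix.mul_nonsing_inv _ hdet, Matrix.one_mulVec]
    rw [← this, Matrix.add_mulVec, Matrix.one_mulVec]
  have h2 : 0 ≤ (Q *ᵥ y) ⬝ᵥ (Q *ᵥ y) := Finset.sum_nonneg fun _ _ => mul_self_nonneg _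
  rw [hx, add_dotProduct, dotProduct_add, dotProduct_add, dotProduct_comm (Q *ᵥ y) y]
  linarith [hQ y]

theorem mulVec_sq_bounds [DecidableEq κ] {A : Matrix ι κ ℝ} {a b : ℝ}
    (h : spectrum ℝ (Aᵀ * A) ⊆ Set.Icc a b) (x : κ → ℝ) :
    a * (x ⬝ᵥ x) ≤ (A *ᵥ x) ⬝ᵥ (A *ᵥ x) ∧ (A *ᵥ x) ⬝ᵥ (A *ᵥ x) ≤ b * (x ⬝ᵥ x) := by
  have hG : (Aᵀ * A).IsHermitian := Matrix.isHermitian_conjTranspose_mul_self A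
  let U : Matrix κ κ ℝ := hG.eigenvectorUnitary
  have hU' : U * Uᵀ = 1 := Unitary.coe_mul_star_self hG.eigenvectorUnitary
  have hsp : Aᵀ * A = U * Matrix.diagonal hG.eigenvalues * Uᵀ := by
    conv_lhs => rw [hG.spectral_theorem]
    rfl
  have hx : x ⬝ᵥ x = ∑ j, ((Uᵀ *ᵥ x) j) ^ 2 := by
    have := dotProduct_mulVec_self Uᵀ x
    rw [Matrix.transpose_transpose, hU', Matrix.one_mulVec] at this
    rw [← this]; simp [dotProduct, sq]
  have hq : (A *ᵥ x) ⬝ᵥ (A *ᵥ x) = ∑ j, hG.eigenvalues j * ((Uᵀ *ᵥ x) j) ^ 2 := by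
    rw [dotProduct_mulVec_self]
    conv_lhs => rw [hsp]
    exact dotProduct_conj_diagonal _ _ _
  have hmem := fun j => h (hG.eigenvalues_mem_spectrum_real j)
  rw [hq, hx, Finset.mul_sum, Finset.mul_sum]
  exact ⟨Finset.sum_le_sum fun j _ => mul_le_mul_of_nonneg_right (hmem j).1 (sq_nonneg _),
    Finset.sum_le_sum fun j _ => mul_le_mul_of_nonneg_right (hmem j).2 (sq_nonneg _)⟩

theorem dotProduct_sq_le (x y : ι → ℝ) : (x ⬝ᵥ y) ^ 2 ≤ (x ⬝ᵥ x) * (y ⬝ᵥ y) := by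
  have := Finset.sum_mul_sq_le_sq_mul_sq Finset.univ x y
  simpa only [dotProduct, sq] using this

theorem transpose_mulVec_le {A : Matrix ι κ ℝ} {b : ℝ} (hb : 0 ≤ b)
    (h : ∀ x, (A *ᵥ x) ⬝ᵥ (A *ᵥ x) ≤ b * (x ⬝ᵥ x)) (x : ι → ℝ) :
    (Aᵀ *ᵥ x) ⬝ᵥ (Aᵀ *ᵥ x) ≤ b * (x ⬝ᵥ x) := by
  set y := Aᵀ *ᵥ x with hy
  have h1 : y ⬝ᵥ y = x ⬝ᵥ (A *ᵥ y) := by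
    conv_lhs => rw [hy]
    rw [dotProduct_comm, Matrix.dotProduct_mulVec, Matrix.vecMul_transpose, dotProduct_comm]
  have h2 := dotProduct_sq_le x (A *ᵥ y)
  rw [← h1] at h2
  have hx : 0 ≤ x ⬝ᵥ x := Finset.sum_nonneg fun _ _ => mul_self_nonneg _
  have hy0 : 0 ≤ y ⬝ᵥ y := Finset.sum_nonneg fun _ _ => mul_self_nonneg _
  rcases hy0.eq_or_lt with h0 | h0
  · rw [← h0]; positivity
  · have := h2.trans (mul_le_mul_of_nonneg_left (h y) hx)
    nlinarith

/-- A square matrix that is bounded below is onto, so `x = A y` with `a ‖y‖² ≤ ‖x‖²`, and `‖x‖² =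
Aᵀx · y` is estimated by Cauchy–Schwarz. It serves to bound the rows of `P₁` from below. -/
theorem le_transpose_mulVec {A : Matrix ι ι ℝ} {a : ℝ} (ha : 0 < a)
    (h : ∀ x, a * (x ⬝ᵥ x) ≤ (A *ᵥ x) ⬝ᵥ (A *ᵥ x)) (x : ι → ℝ) :
    a * (x ⬝ᵥ x) ≤ (Aᵀ *ᵥ x) ⬝ᵥ (Aᵀ *ᵥ x) := by
  have hnn : ∀ z : ι → ℝ, 0 ≤ z ⬝ᵥ z := fun z => Finset.sum_nonneg fun _ _ => mul_self_nonneg _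
  have hinj : Function.Injective (Matrix.mulVecLin A) := by
    refine (injective_iff_map_eq_zero _).2 fun z hz => ?_
    have h1 := h z
    rw [show A *ᵥ z = 0 from hz, dotProduct_zero] at h1
    exact dotProduct_self_eq_zero.1 (le_antisymm (by nlinarith [hnn z]) (hnn z))
  obtain ⟨y, hy⟩ := LinearMap.injective_iff_surjective.1 hinj x
  have hy' : A *ᵥ y = x := hy
  have h1 : x ⬝ᵥ x = (Aᵀ *ᵥ x) ⬝ᵥ y := by
    conv_lhs => rw [← hy']
    rw [hy', dotProduct_comm, ← hy', Matrix.dotProduct_mulVec, ← Matrix.mulVec_transpose, hy']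
  have h2 := dotProduct_sq_le (Aᵀ *ᵥ x) y
  rw [← h1] at h2
  have h3 := h y
  rw [hy'] at h3
  have := hnn x
  have h4 := hnn (Aᵀ *ᵥ x)
  rcases this.eq_or_lt with h0 | h0
  · rw [← h0]; simpa using h4
  · have h5 := mul_le_mul_of_nonneg_left h3 h4
    nlinarith

end MatrixBounds

/-! ### The two shrinkage matrices. -/

section Penalties

/-- By symmetry of `A`, twice the form is the sum of `A i j * (x i - x j) ^ 2`. -/
theorem laplacian_quadratic_nonneg {q : ℕ} {A : Matrix (Fin q) (Fin q) ℝ} (hA : A.IsSymm)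
    (h0 : ∀ i j, 0 ≤ A i j) (x : Fin q → ℝ) : 0 ≤ x ⬝ᵥ (laplacian A *ᵥ x) := by
  have h1 : x ⬝ᵥ (laplacian A *ᵥ x) = ∑ i, ∑ j, A i j * (x i * x i - x i * x j) := by
    simp only [laplacian, Matrix.sub_mulVec, dotProduct, Pi.sub_apply, Matrix.mulVec_diagonal]
    refine Finset.sum_congr rfl fun i _ => ?_
    simp only [Matrix.mulVec, dotProduct]
    rw [Finset.sum_mul, ← Finset.sum_sub_distrib, Finset.mul_sum]
    exact Finset.sum_congr rfl fun j _ => by ring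
  have h2 : x ⬝ᵥ (laplacian A *ᵥ x) = ∑ i, ∑ j, A i j * (x j * x j - x i * x j) := by
    rw [h1, Finset.sum_comm]
    refine Finset.sum_congr rfl fun i _ => Finset.sum_congr rfl fun j _ => ?_
    rw [hA.apply i j]; ring
  have h3 : x ⬝ᵥ (laplacian A *ᵥ x) + x ⬝ᵥ (laplacian A *ᵥ x)
      = ∑ i, ∑ j, A i j * (x i - x j) ^ 2 := by
    nth_rewrite 1 [h1]
    rw [h2, ← Finset.sum_add_distrib]
    refine Finset.sum_congr rfl fun i _ => ?_
    rw [← Finset.sum_add_distrib]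
    exact Finset.sum_congr rfl fun j _ => by ring
  have h4 : 0 ≤ ∑ i, ∑ j, A i j * (x i - x j) ^ 2 :=
    Finset.sum_nonneg fun i _ => Finset.sum_nonneg fun j _ => mul_nonneg (h0 i j) (sq_nonneg _)
  linarith

variable {r : ℕ} {Ω : Type*} [MeasurableSpace Ω]

namespace Model

/-- The only information about the penalty that the later estimates need; it treats both penalties
at once. -/
theorem exists_D_eq (M : Model r Ω) (pen : Penalty) (n : ℕ) :
    ∃ Q : Matrix (Fin (M.p n)) (Fin (M.p n)) ℝ, M.D pen n = 1 + Q ∧ Qᵀ = Q ∧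
      ∀ x, 0 ≤ x ⬝ᵥ (Q *ᵥ x) := by
  have h0 : ∀ i j, 0 ≤ M.adj n i j := fun i j => by
    rcases M.adj_zero_one n i j with h | h <;> simp [h]
  cases pen with
  | laplacian =>
    refine ⟨_, rfl, ?_, fun x => ?_⟩
    · rw [normLaplacian, laplacian, Matrix.transpose_smul, Matrix.transpose_smul,
        Matrix.transpose_sub, Matrix.diagonal_transpose, (M.adj_symm n).eq]
    · rw [normLaplacian, Matrix.smul_mulVec, Matrix.smul_mulVec, dotProduct_smul, dotProduct_smul]
      have hd : 0 ≤ meanDegree (M.adj n) := mul_nonneg (by positivity)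
        (Finset.sum_nonneg fun i _ => Finset.sum_nonneg fun j _ => h0 i j)
      exact mul_nonneg (M.α_nonneg n) (mul_nonneg (inv_nonneg.2 hd)
        (laplacian_quadratic_nonneg (M.adj_symm n) h0 x))
  | projection =>
    refine ⟨_, rfl, ?_, fun x => ?_⟩
    · rw [Matrix.transpose_smul, Matrix.transpose_mul, Matrix.transpose_transpose]
    · rw [Matrix.smul_mulVec, dotProduct_smul]
      refine mul_nonneg (M.α_nonneg n) ?_
      have := dotProduct_mulVec_self (M.U₁ n)ᵀ x
      rw [Matrix.transpose_transpose] at this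
      rw [← this]
      exact Finset.sum_nonneg fun _ _ => mul_self_nonneg _

theorem inv_D_transpose (M : Model r Ω) (pen : Penalty) (n : ℕ) :
    ((M.D pen n)⁻¹)ᵀ = (M.D pen n)⁻¹ := by
  obtain ⟨Q, hQ, hQt, -⟩ := M.exists_D_eq pen n
  rw [Matrix.transpose_nonsing_inv, hQ, Matrix.transpose_add, Matrix.transpose_one, hQt]

theorem inv_D_contraction (M : Model r Ω) (pen : Penalty) (n : ℕ) (x : Fin (M.p n) → ℝ) :
    ((M.D pen n)⁻¹ *ᵥ x) ⬝ᵥ ((M.D pen n)⁻¹ *ᵥ x) ≤ x ⬝ᵥ x := by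
  obtain ⟨Q, hQ, -, hQ0⟩ := M.exists_D_eq pen n
  rw [hQ]
  exact inv_one_add_contraction hQ0 x

theorem frobNorm_inv_D_le (M : Model r Ω) (pen : Penalty) (n : ℕ) :
    frobNorm (M.D pen n)⁻¹ ^ 2 ≤ M.p n := by
  have h := frobNorm_mul_sq_le (c := 1) (A := (M.D pen n)⁻¹)
    (fun x => by rw [one_mul]; exact M.inv_D_contraction pen n x)
    (1 : Matrix (Fin (M.p n)) (Fin (M.p n)) ℝ)
  rw [Matrix.mul_one, frobNorm_sq_of_gram (A := (1 : Matrix (Fin (M.p n)) (Fin (M.p n)) ℝ)) (c := 1)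
    (by simp)] at h
  simpa using h

theorem frobNorm_inv_D_pos (M : Model r Ω) (pen : Penalty) {n : ℕ} (hp : 0 < M.p n) :
    0 < frobNorm (M.D pen n)⁻¹ := by
  obtain ⟨Q, hQ, -, hQ0⟩ := M.exists_D_eq pen n
  have hdet := (Matrix.isUnit_iff_isUnit_det _).1 (isUnit_one_add hQ0)
  refine lt_of_le_of_ne (frobNorm_nonneg _) fun h => ?_
  have h0 := frobNorm_eq_zero.1 h.symm
  have h1 := Matrix.mul_nonsing_inv _ hdet
  rw [← hQ, h0, Matrix.mul_zero] at h1
  have := congrFun (congrFun h1 ⟨0, hp⟩) ⟨0, hp⟩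
  simp at this

end Model

end Penalties

/-! ### Stochastic boundedness from second moments. -/

section Tightness

variable {Ω : Type*} [MeasurableSpace Ω] {P : Measure Ω}

theorem isBigOP_of_lintegral {Z : ℕ → Ω → ℝ} {a : ℕ → ℝ} {C : ℝ} (hZ : ∀ n, Measurable (Z n))
    (ha : ∀ᶠ n in atTop, 0 < a n)
    (h : ∀ᶠ n in atTop, ∫⁻ ω, ENNReal.ofReal (Z n ω ^ 2) ∂P ≤ ENNReal.ofReal (C * a n ^ 2)) :
    IsBigOP P Z a := by
  intro ε hε
  -- Chebyshev gives the probability bound `C / K²`, which is at most `ε` once `K² ≥ |C| / ε`; the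
  -- summand `1` keeps `K` positive.
  set K : ℝ := Real.sqrt (|C| / ε) + 1 with hK
  have hK0 : 0 < K := by positivity
  have hK2 : |C| ≤ ε * K ^ 2 := by
    have h1 : |C| / ε ≤ K ^ 2 := by
      rw [← Real.sq_sqrt (show 0 ≤ |C| / ε by positivity)]
      exact pow_le_pow_left₀ (Real.sqrt_nonneg _) (by rw [hK]; linarith) 2
    rwa [div_le_iff₀ hε, mul_comm] at h1
  refine ⟨K, ?_⟩
  filter_upwards [ha, h] with n han hn
  have hpos : 0 < (K * a n) ^ 2 := by positivity
  calc P {ω | K * a n < ‖Z n ω‖}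
      ≤ P {ω | ENNReal.ofReal ((K * a n) ^ 2) ≤ ENNReal.ofReal (Z n ω ^ 2)} := by
        refine measure_mono fun ω hω => ENNReal.ofReal_le_ofReal ?_
        rw [← sq_abs (Z n ω)]
        exact pow_le_pow_left₀ (by positivity) (le_of_lt hω) 2
    _ ≤ (∫⁻ ω, ENNReal.ofReal (Z n ω ^ 2) ∂P) / ENNReal.ofReal ((K * a n) ^ 2) :=
        meas_ge_le_lintegral_div ((hZ n).pow_const 2).ennreal_ofReal.aemeasurable
          (ENNReal.ofReal_pos.2 hpos).ne' ENNReal.ofReal_ne_top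
    _ ≤ ENNReal.ofReal (C * a n ^ 2) / ENNReal.ofReal ((K * a n) ^ 2) := by gcongr
    _ = ENNReal.ofReal (C * a n ^ 2 / (K * a n) ^ 2) := (ENNReal.ofReal_div_of_pos hpos).symm
    _ ≤ ENNReal.ofReal ε := by
        refine ENNReal.ofReal_le_ofReal ?_
        rw [div_le_iff₀ hpos]
        nlinarith [le_abs_self C, sq_nonneg (a n)]

theorem exists_forall_norm_le {ι E : Type*} [Fintype ι] [Norm E] {Z : ι → ℕ → Ω → E}
    {a : ι → ℕ → ℝ} (ha : ∀ i n, 0 ≤ a i n) (h : ∀ i, IsBigOP P (Z i) (a i)) {ε : ℝ}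
    (hε : 0 < ε) :
    ∃ K : ℝ, 0 < K ∧ ∀ᶠ n in atTop, P {ω | ¬ ∀ i, ‖Z i n ω‖ ≤ K * a i n} ≤ ENNReal.ofReal ε := by
  set δ : ℝ := ε / (Fintype.card ι + 1) with hδ
  have hδ0 : 0 < δ := by positivity
  choose K hK using fun i => h i δ hδ0
  set K' : ℝ := 1 + ∑ i, |K i| with hK'
  have hle : ∀ i, K i ≤ K' := fun i => by
    have := Finset.single_le_sum (f := fun i => |K i|) (fun _ _ => abs_nonneg _) (Finset.mem_univ i)
    have h2 := le_abs_self (K i)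
    linarith
  refine ⟨K', by positivity, ?_⟩
  filter_upwards [eventually_all.2 hK] with n hn
  calc P {ω | ¬ ∀ i, ‖Z i n ω‖ ≤ K' * a i n} ≤ P (⋃ i, {ω | K i * a i n < ‖Z i n ω‖}) := by
        refine measure_mono fun ω hω => ?_
        simp only [Set.mem_ofPred_eq, not_forall, not_le] at hω
        obtain ⟨i, hi⟩ := hω
        exact Set.mem_iUnion.2 ⟨i, (mul_le_mul_of_nonneg_right (hle i) (ha i n)).trans_lt hi⟩
    _ ≤ ∑ i, P {ω | K i * a i n < ‖Z i n ω‖} := measure_iUnion_fintype_le _ _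
    _ ≤ ∑ _i : ι, ENNReal.ofReal δ := Finset.sum_le_sum fun i _ => hn i
    _ ≤ ENNReal.ofReal ε := by
        rw [Finset.sum_const, Finset.card_univ, nsmul_eq_mul, ← ENNReal.ofReal_natCast,
          ← ENNReal.ofReal_mul (Nat.cast_nonneg _)]
        refine ENNReal.ofReal_le_ofReal ?_
        rw [hδ, ← mul_div_assoc, div_le_iff₀ (by positivity)]
        nlinarith

end Tightness

end NetFactor

namespace NetFactor

/-! ### Moment bounds for the error terms of the model. -/

section ModelBounds

variable {r : ℕ} {Ω : Type*} [MeasurableSpace Ω] {P : Measure Ω}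

theorem measurable_frobNorm {ι κ : Type*} [Fintype ι] [Fintype κ] {Z : Ω → Matrix ι κ ℝ}
    (hZ : ∀ i j, Measurable fun ω => Z ω i j) : Measurable fun ω => frobNorm (Z ω) := by
  unfold frobNorm
  exact (Finset.measurable_sum _ fun i _ => Finset.measurable_sum _ fun j _ =>
    (hZ i j).pow_const 2).sqrt

namespace Model

/-- Uniform bounds, by one constant, for the deterministic and random ingredients of the model. -/
structure Bounded (M : Model r Ω) (P : Measure Ω) (pen : Penalty) (κ : ℝ) : Prop where
  one_le : 1 ≤ κ
  noise : ∀ n, IsNoise P (fun (i : Fin (M.T n) × Fin (M.p n)) ω => M.eps n ω i.1 i.2) κ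
  P₁_le : ∀ n x, (M.P₁ n *ᵥ x) ⬝ᵥ (M.P₁ n *ᵥ x) ≤ κ * (x ⬝ᵥ x)
  P₁_transpose_le : ∀ n x, ((M.P₁ n)ᵀ *ᵥ x) ⬝ᵥ ((M.P₁ n)ᵀ *ᵥ x) ≤ κ * (x ⬝ᵥ x)
  load_le : ∀ n, frobNorm (M.P₂ n * (M.D pen n)⁻¹ * M.B n) ^ 2 ≤ κ * M.p n
  shrink_le : ∀ n, frobNorm (M.P₂ n * (M.D pen n)⁻¹ * (M.P₂ n)ᵀ) ^ 2 ≤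
    κ * frobNorm (M.D pen n)⁻¹ ^ 2
  factor_le : ∀ n v, ∫⁻ ω, ENNReal.ofReal (((M.F n ω)ᵀ *ᵥ v) ⬝ᵥ ((M.F n ω)ᵀ *ᵥ v)) ∂P ≤
    ENNReal.ofReal (κ * (v ⬝ᵥ v))

theorem exists_bounded [IsProbabilityMeasure P] (M : Model r Ω) (pen : Penalty)
    (hF : M.FactorConditions P) (hB : M.LoadingConditions) (hE : M.ErrorConditions P) :
    ∃ κ, M.Bounded P pen κ := by
  obtain ⟨KF, hKF0, -, hKF⟩ := hF.bounded
  obtain ⟨KB, hKB⟩ := hB.bounded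
  obtain ⟨K4, hK4⟩ := hE.fourth
  obtain ⟨c₁, c₂, hc₁, hc₂, hspec⟩ := hE.spectra
  have hnn : ∀ {m : ℕ} (z : Fin m → ℝ), 0 ≤ z ⬝ᵥ z := fun z =>
    Finset.sum_nonneg fun _ _ => mul_self_nonneg _
  -- After the `1`, the summands serve in turn the fourth moments, the norm of `P₁`, the loadings
  -- `P₂ D⁻¹ B`, the two factors `P₂` around `D⁻¹`, and the projections of the factor scores.
  set κ : ℝ := 1 + |K4| + c₁ + c₁ * (r * KB ^ 2) + c₁ ^ 2 + KF with hκ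
  have q1 : 0 ≤ |K4| := abs_nonneg _
  have q2 : 0 ≤ c₁ * (r * KB ^ 2) := by positivity
  have q3 : 0 ≤ c₁ ^ 2 := by positivity
  have hP₁ : ∀ n x, (M.P₁ n *ᵥ x) ⬝ᵥ (M.P₁ n *ᵥ x) ≤ c₁ * (x ⬝ᵥ x) := fun n x =>
    (mulVec_sq_bounds (hspec n).1 x).2
  have hP₂ : ∀ n x, (M.P₂ n *ᵥ x) ⬝ᵥ (M.P₂ n *ᵥ x) ≤ c₁ * (x ⬝ᵥ x) := fun n x =>
    (mulVec_sq_bounds (hspec n).2 x).2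
  have hc₁κ : c₁ ≤ κ := by rw [hκ]; linarith
  refine ⟨κ, by rw [hκ]; linarith, fun n => ?_, fun n x => ?_, fun n x => ?_, fun n => ?_,
    fun n => ?_, fun n v => ?_⟩
  · refine ⟨fun i => M.measurable_eps n i.1 i.2, hE.indep n, fun i => hE.mean n i.1 i.2,
      fun i => hE.second n i.1 i.2, fun i => hE.memLp n i.1 i.2,
      fun i => (hK4 n i.1 i.2).trans ?_⟩
    have := le_abs_self K4
    rw [hκ]; linarith
  · exact (hP₁ n x).trans (mul_le_mul_of_nonneg_right hc₁κ (hnn x))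
  · exact (transpose_mulVec_le hc₁.le (hP₁ n) x).trans (mul_le_mul_of_nonneg_right hc₁κ (hnn x))
  · rw [Matrix.mul_assoc]
    calc _ ≤ c₁ * frobNorm ((M.D pen n)⁻¹ * M.B n) ^ 2 := frobNorm_mul_sq_le (hP₂ n) _
      _ ≤ c₁ * (1 * frobNorm (M.B n) ^ 2) := by
          refine mul_le_mul_of_nonneg_left (frobNorm_mul_sq_le (fun x => ?_) _) hc₁.le
          rw [one_mul]; exact M.inv_D_contraction pen n x
      _ ≤ c₁ * (1 * (M.p n * (r * KB ^ 2))) := by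
          gcongr
          rw [frobNorm_sq]
          calc _ ≤ ∑ _i : Fin (M.p n), ∑ _j : Fin r, KB ^ 2 :=
                Finset.sum_le_sum fun i _ => Finset.sum_le_sum fun j _ => by
                  rw [← sq_abs]
                  exact pow_le_pow_left₀ (abs_nonneg _) (hKB n i j) 2
            _ = _ := by simp
      _ = c₁ * (r * KB ^ 2) * M.p n := by ring
      _ ≤ _ := by
          refine mul_le_mul_of_nonneg_right ?_ (Nat.cast_nonneg _)
          rw [hκ]; linarith
  · rw [Matrix.mul_assoc]
    calc _ ≤ c₁ * frobNorm ((M.D pen n)⁻¹ * (M.P₂ n)ᵀ) ^ 2 := frobNorm_mul_sq_le (hP₂ n) _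
      _ = c₁ * frobNorm (M.P₂ n * (M.D pen n)⁻¹) ^ 2 := by
          rw [← frobNorm_transpose, Matrix.transpose_mul, Matrix.transpose_transpose,
            M.inv_D_transpose]
      _ ≤ c₁ * (c₁ * frobNorm (M.D pen n)⁻¹ ^ 2) := by
          gcongr
          exact frobNorm_mul_sq_le (hP₂ n) _
      _ = c₁ ^ 2 * frobNorm (M.D pen n)⁻¹ ^ 2 := by ring
      _ ≤ _ := by
          refine mul_le_mul_of_nonneg_right ?_ (sq_nonneg _)
          rw [hκ]; linarith
  · have hmem : ∀ (u : Fin (M.T n) → ℝ) k, MemLp (fun ω => (u ᵥ* M.F n ω) k) 2 P := fun u k => by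
      simp only [Matrix.vecMul, dotProduct]
      exact memLp_finsetSum _ fun t _ =>
        ((hF.memLp n t k).mono_exponent (by norm_num)).const_mul (u t)
    have hsum : ∀ u : Fin (M.T n) → ℝ, Integrable (fun ω => ∑ k, (u ᵥ* M.F n ω) k ^ 2) P :=
      fun u => integrable_finsetSum _ fun k _ => (hmem u k).integrable_sq
    have hdot : ∀ ω, ((M.F n ω)ᵀ *ᵥ v) ⬝ᵥ ((M.F n ω)ᵀ *ᵥ v) = ∑ k, (v ᵥ* M.F n ω) k ^ 2 := by
      intro ω
      rw [Matrix.mulVec_transpose]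
      simp [dotProduct, sq]
    simp only [hdot]
    rw [← ofReal_integral_eq_lintegral_ofReal (hsum v) (Eventually.of_forall fun ω =>
      Finset.sum_nonneg fun _ _ => sq_nonneg _)]
    refine ENNReal.ofReal_le_ofReal ?_
    -- The assumption concerns unit vectors; the general case follows by homogeneity, with `v = 0`
    -- apart.
    rcases (hnn v).eq_or_lt with h0 | h0
    · have hv : v = 0 := dotProduct_self_eq_zero.1 h0.symm
      simp [hv]
    · set s := Real.sqrt (v ⬝ᵥ v) with hs
      have hs0 : 0 < s := Real.sqrt_pos.2 h0
      have hs2 : s ^ 2 = v ⬝ᵥ v := Real.sq_sqrt h0.le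
      have hu := hKF n (s⁻¹ • v) (by
        simp only [Pi.smul_apply, smul_eq_mul, mul_pow, ← Finset.mul_sum]
        rw [inv_pow, hs2, show ∑ t, v t ^ 2 = v ⬝ᵥ v by simp [dotProduct, sq]]
        exact inv_mul_cancel₀ h0.ne')
      simp only [Matrix.smul_vecMul, Pi.smul_apply, smul_eq_mul, mul_pow, ← Finset.mul_sum,
        integral_const_mul] at hu
      rw [inv_pow, hs2, inv_mul_le_iff₀ h0] at hu
      refine hu.trans ?_
      rw [mul_comm]
      refine mul_le_mul_of_nonneg_right ?_ h0.le
      rw [hκ]; linarith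

variable {M : Model r Ω} {pen : Penalty} {κ : ℝ}

theorem measurable_E (M : Model r Ω) (n : ℕ) (i : Fin (M.T n)) (j : Fin (M.p n)) :
    Measurable fun ω => M.E n ω i j := by
  have h1 : ∀ i j, Measurable fun ω => (M.P₁ n * M.eps n ω) i j :=
    measurable_mul_apply (A := fun _ => M.P₁ n) (fun _ _ => measurable_const) (M.measurable_eps n)
  exact measurable_mul_apply (B := fun _ => M.P₂ n) h1 (fun _ _ => measurable_const) i j

/-- The vector `E D⁻¹ e_t`. -/
noncomputable def crossError (M : Model r Ω) (pen : Penalty) (n : ℕ) (t : Fin (M.T n)) (ω : Ω) :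
    Fin (M.T n) → ℝ :=
  M.E n ω *ᵥ ((M.D pen n)⁻¹ *ᵥ M.E n ω t)

theorem E_row (M : Model r Ω) (n : ℕ) (t : Fin (M.T n)) (ω : Ω) :
    M.E n ω t = (M.P₂ n)ᵀ *ᵥ ((M.eps n ω)ᵀ *ᵥ M.P₁ n t) := by
  rw [Matrix.mulVec_transpose, Matrix.mulVec_transpose]
  rfl

theorem replicateCol_crossError (M : Model r Ω) (pen : Penalty) (n : ℕ) (t : Fin (M.T n)) (ω : Ω) :
    Matrix.replicateCol Unit (M.crossError pen n t ω) = M.P₁ n * M.eps n ω *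
      (M.P₂ n * (M.D pen n)⁻¹ * (M.P₂ n)ᵀ) * (M.eps n ω)ᵀ *
        Matrix.replicateCol Unit (M.P₁ n t) := by
  rw [← Matrix.replicateCol_mulVec, crossError, E_row]
  congr 1
  simp only [E, Matrix.mulVec_mulVec, Matrix.mul_assoc]

theorem measurable_crossError (M : Model r Ω) (pen : Penalty) (n : ℕ) (t : Fin (M.T n))
    (i : Fin (M.T n)) : Measurable fun ω => M.crossError pen n t ω i := by
  simp only [crossError, Matrix.mulVec, dotProduct]
  exact Finset.measurable_sum _ fun j _ => (M.measurable_E n i j).mul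
    (Finset.measurable_sum _ fun k _ => (M.measurable_E n t k).const_mul _)

theorem measurable_score (M : Model r Ω) (pen : Penalty) (n : ℕ) (t : Fin (M.T n)) (k : Fin r) :
    Measurable fun ω => M.score pen n t ω k := by
  simp only [score, Matrix.mulVec, dotProduct]
  exact Finset.measurable_sum _ fun j _ => (M.measurable_E n t j).const_mul _

theorem lintegral_indep [IsProbabilityMeasure P] (hE : M.ErrorConditions P) {n : ℕ}
    {φ : Matrix (Fin (M.T n)) (Fin (M.p n)) ℝ → Matrix (Fin (M.T n)) (Fin r) ℝ → ENNReal}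
    (hφ : Measurable fun z : (Fin (M.T n) × Fin (M.p n) → ℝ) × (Fin (M.T n) × Fin r → ℝ) =>
      φ (Matrix.of fun i j => z.1 (i, j)) (Matrix.of fun i j => z.2 (i, j))) :
    ∫⁻ ω, φ (M.eps n ω) (M.F n ω) ∂P = ∫⁻ ω, ∫⁻ ω', φ (M.eps n ω') (M.F n ω) ∂P ∂P :=
  lintegral_indepFun (φ := fun x y => φ (Matrix.of fun i j => x (i, j))
    (Matrix.of fun i j => y (i, j)))
    (measurable_pi_lambda _ fun i => M.measurable_eps n i.1 i.2)
    (measurable_pi_lambda _ fun i => M.measurable_F n i.1 i.2) (hE.indep_F n) hφ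

theorem gram_F (hF : M.FactorConditions P) {n : ℕ} (hT : 0 < M.T n) :
    ∀ᵐ ω ∂P, (M.F n ω)ᵀ * M.F n ω = (M.T n : ℝ) • 1 := by
  filter_upwards [hF.normalized n] with ω hω
  rw [← hω, smul_inv_smul₀ (Nat.cast_pos.2 hT).ne']

section Second

variable (h : M.Bounded P pen κ)
include h

theorem Bounded.κ_nonneg : 0 ≤ κ := zero_le_one.trans h.one_le

theorem Bounded.frobNorm_P₁_sq (n : ℕ) : frobNorm (M.P₁ n) ^ 2 ≤ κ * M.T n := by
  have := frobNorm_mul_sq_le (h.P₁_le n) (1 : Matrix (Fin (M.T n)) (Fin (M.T n)) ℝ)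
  rwa [Matrix.mul_one, frobNorm_sq_of_gram (A := (1 : Matrix (Fin (M.T n)) (Fin (M.T n)) ℝ))
    (c := 1) (by simp), one_mul, Fintype.card_fin] at this

theorem Bounded.row_P₁_sq (n : ℕ) (t : Fin (M.T n)) :
    frobNorm (Matrix.replicateCol Unit (M.P₁ n t)) ^ 2 ≤ κ := by
  have := h.P₁_transpose_le n (Pi.single t 1)
  rw [Matrix.mulVec_single_one, single_one_dotProduct, Pi.single_eq_same, mul_one] at this
  rw [frobNorm_replicateCol, norm_toLp_sq]
  exact this

theorem Bounded.trace_sq (n : ℕ) : (M.P₂ n * (M.D pen n)⁻¹ * (M.P₂ n)ᵀ).trace ^ 2 ≤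
    κ * (M.p n * frobNorm (M.D pen n)⁻¹ ^ 2) := by
  have h1 := abs_trace_le (M.P₂ n * (M.D pen n)⁻¹ * (M.P₂ n)ᵀ)
  rw [Fintype.card_fin] at h1
  rw [← sq_abs]
  calc _ ≤ (Real.sqrt (M.p n) * frobNorm (M.P₂ n * (M.D pen n)⁻¹ * (M.P₂ n)ᵀ)) ^ 2 :=
        pow_le_pow_left₀ (abs_nonneg _) h1 2
    _ = M.p n * frobNorm (M.P₂ n * (M.D pen n)⁻¹ * (M.P₂ n)ᵀ) ^ 2 := by
        rw [mul_pow, Real.sq_sqrt (Nat.cast_nonneg _)]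
    _ ≤ M.p n * (κ * frobNorm (M.D pen n)⁻¹ ^ 2) :=
        mul_le_mul_of_nonneg_left (h.shrink_le n) (Nat.cast_nonneg _)
    _ = _ := by ring

theorem Bounded.lintegral_load [IsProbabilityMeasure P] (n : ℕ) :
    ∫⁻ ω, ENNReal.ofReal (frobNorm (M.E n ω * (M.D pen n)⁻¹ * M.B n) ^ 2) ∂P ≤
      ENNReal.ofReal (κ ^ 2 * (M.T n * M.p n)) := by
  have h1 := lintegral_linear_frobNorm_sq (h.noise n) (M.P₁ n)
    (M.P₂ n * (M.D pen n)⁻¹ * M.B n)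
  simp only [E, Matrix.mul_assoc] at h1 ⊢
  refine h1.trans (ENNReal.ofReal_le_ofReal ?_)
  have e1 := h.frobNorm_P₁_sq n
  have e2 := h.load_le n
  rw [Matrix.mul_assoc] at e2
  calc _ ≤ (κ * M.T n) * (κ * M.p n) :=
        mul_le_mul e1 e2 (sq_nonneg _) (mul_nonneg h.κ_nonneg (Nat.cast_nonneg _))
    _ = _ := by ring

/-- With `F` frozen this is linear in the noise, and `‖Fᵀ P₁‖_F²` is at most `κ T r`, of the same
order `T` as `‖P₁‖_F²`. Hence `Fᵀ N` is no larger in order than `N` itself, although `F` has norm of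
order `√T`. -/
theorem Bounded.lintegral_factor_load [IsProbabilityMeasure P] (hF : M.FactorConditions P)
    (hE : M.ErrorConditions P)
    {n : ℕ} (hT : 0 < M.T n) :
    ∫⁻ ω, ENNReal.ofReal (frobNorm ((M.F n ω)ᵀ * (M.E n ω * (M.D pen n)⁻¹ * M.B n)) ^ 2) ∂P ≤
      ENNReal.ofReal (κ ^ 2 * r * (M.T n * M.p n)) := by
  have h0 := lintegral_indep hE (n := n) (φ := fun x y => ENNReal.ofReal
    (frobNorm (yᵀ * M.P₁ n * x * (M.P₂ n * (M.D pen n)⁻¹ * M.B n)) ^ 2)) (by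
      refine ((measurable_frobNorm ?_).pow_const 2).ennreal_ofReal
      refine measurable_mul_apply (measurable_mul_apply (measurable_mul_apply ?_ ?_) ?_) ?_
      · exact fun i j => (measurable_pi_apply (j, i)).comp measurable_snd
      · exact fun _ _ => measurable_const
      · exact fun i j => (measurable_pi_apply (i, j)).comp measurable_fst
      · exact fun _ _ => measurable_const)
  simp only [E, Matrix.mul_assoc] at h0 ⊢
  rw [h0]
  calc _ ≤ ∫⁻ _ω, ENNReal.ofReal (κ ^ 2 * r * (M.T n * M.p n)) ∂P := by
        refine lintegral_mono_ae ?_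
        filter_upwards [gram_F hF hT] with ω hω
        have h1 := lintegral_linear_frobNorm_sq (h.noise n) ((M.F n ω)ᵀ * M.P₁ n)
          (M.P₂ n * (M.D pen n)⁻¹ * M.B n)
        simp only [Matrix.mul_assoc] at h1
        refine h1.trans (ENNReal.ofReal_le_ofReal ?_)
        have e1 : frobNorm ((M.F n ω)ᵀ * M.P₁ n) ^ 2 ≤ κ * (M.T n * r) := by
          rw [← frobNorm_transpose, Matrix.transpose_mul, Matrix.transpose_transpose]
          have := frobNorm_mul_sq_le (h.P₁_transpose_le n) (M.F n ω)
          rwa [frobNorm_sq_of_gram hω, Fintype.card_fin] at this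
        have e2 := h.load_le n
        rw [Matrix.mul_assoc] at e2
        have hκ := h.κ_nonneg
        calc _ ≤ (κ * (M.T n * r)) * (κ * M.p n) :=
              mul_le_mul e1 e2 (sq_nonneg _) (by positivity)
          _ = _ := by ring
    _ = _ := by simp

/-- The mean contributes `‖P₁ P₁ᵀ‖_F²` times a squared trace, of order `T · p ‖D⁻¹‖_F²`; the
fluctuation contributes order `T² ‖D⁻¹‖_F²`. -/
theorem Bounded.lintegral_gram [IsProbabilityMeasure P] (n : ℕ) :
    ∫⁻ ω, ENNReal.ofReal (frobNorm (M.E n ω * (M.D pen n)⁻¹ * (M.E n ω)ᵀ) ^ 2) ∂P ≤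
      ENNReal.ofReal (2 * (κ ^ 3 + (κ + 2) * κ ^ 3) * (M.T n * (M.p n + M.T n) *
        frobNorm (M.D pen n)⁻¹ ^ 2)) := by
  have hκ := h.κ_nonneg
  have h1 := lintegral_quadratic_frobNorm_sq hκ (h.noise n) (M.P₁ n)
    (M.P₂ n * (M.D pen n)⁻¹ * (M.P₂ n)ᵀ) (M.P₁ n)ᵀ
  simp only [E, Matrix.mul_assoc, Matrix.transpose_mul] at h1 ⊢
  refine h1.trans (ENNReal.ofReal_le_ofReal ?_)
  have e1 := h.frobNorm_P₁_sq n
  have e2 := h.trace_sq n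
  have e3 := h.shrink_le n
  rw [Matrix.mul_assoc] at e2 e3
  have e4 := frobNorm_mul_sq_le (h.P₁_le n) (M.P₁ n)ᵀ
  rw [frobNorm_transpose] at e4
  rw [frobNorm_transpose]
  set w := frobNorm (M.D pen n)⁻¹ ^ 2 with hw
  have hw0 : 0 ≤ w := sq_nonneg _
  have hT0 : (0 : ℝ) ≤ M.T n := Nat.cast_nonneg _
  have hp0 : (0 : ℝ) ≤ M.p n := Nat.cast_nonneg _
  calc _ ≤ 2 * ((κ * (κ * M.T n)) * (κ * (M.p n * w))) +
        2 * (κ + 2) * ((κ * M.T n) * (κ * M.T n) * (κ * w)) := by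
        gcongr
        exact e4.trans (mul_le_mul_of_nonneg_left e1 hκ)
    _ = 2 * (κ ^ 3 * (M.T n * M.p n * w) + (κ + 2) * κ ^ 3 * (M.T n * M.T n * w)) := by ring
    _ ≤ 2 * (κ ^ 3 * (M.T n * M.p n * w + M.T n * M.T n * w) +
        (κ + 2) * κ ^ 3 * (M.T n * M.p n * w + M.T n * M.T n * w)) := by
        gcongr
        · exact le_add_of_nonneg_right (by positivity)
        · exact le_add_of_nonneg_left (by positivity)
    _ = _ := by ring

theorem Bounded.lintegral_crossError [IsProbabilityMeasure P] (n : ℕ) (t : Fin (M.T n)) :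
    ∫⁻ ω, ENNReal.ofReal (‖WithLp.toLp 2 (M.crossError pen n t ω)‖ ^ 2) ∂P ≤
      ENNReal.ofReal (2 * (κ ^ 3 + (κ + 2) * κ ^ 3) * ((M.p n + M.T n) *
        frobNorm (M.D pen n)⁻¹ ^ 2)) := by
  have hκ := h.κ_nonneg
  simp only [← frobNorm_replicateCol, replicateCol_crossError]
  refine (lintegral_quadratic_frobNorm_sq hκ (h.noise n) (M.P₁ n)
    (M.P₂ n * (M.D pen n)⁻¹ * (M.P₂ n)ᵀ) (Matrix.replicateCol Unit (M.P₁ n t))).trans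
      (ENNReal.ofReal_le_ofReal ?_)
  have e1 := h.frobNorm_P₁_sq n
  have e2 := h.trace_sq n
  have e3 := h.shrink_le n
  have e5 := h.row_P₁_sq n t
  have e4 := (frobNorm_mul_sq_le (h.P₁_le n) (Matrix.replicateCol Unit (M.P₁ n t))).trans
    (mul_le_mul_of_nonneg_left e5 hκ)
  set w := frobNorm (M.D pen n)⁻¹ ^ 2 with hw
  have hw0 : 0 ≤ w := sq_nonneg _
  have hT0 : (0 : ℝ) ≤ M.T n := Nat.cast_nonneg _
  have hp0 : (0 : ℝ) ≤ M.p n := Nat.cast_nonneg _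
  calc _ ≤ 2 * ((κ * κ) * (κ * (M.p n * w))) +
        2 * (κ + 2) * ((κ * M.T n) * κ * (κ * w)) := by
        gcongr
    _ = 2 * (κ ^ 3 * (M.p n * w) + (κ + 2) * κ ^ 3 * (M.T n * w)) := by ring
    _ ≤ 2 * (κ ^ 3 * (M.p n * w + M.T n * w) + (κ + 2) * κ ^ 3 * (M.p n * w + M.T n * w)) := by
        gcongr
        · exact le_add_of_nonneg_right (by positivity)
        · exact le_add_of_nonneg_left (by positivity)
    _ = _ := by ring

theorem Bounded.lintegral_factor_crossError [IsProbabilityMeasure P] (hF : M.FactorConditions P)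
    (hE : M.ErrorConditions P) {n : ℕ} (hT : 0 < M.T n) (t : Fin (M.T n)) :
    ∫⁻ ω, ENNReal.ofReal (‖WithLp.toLp 2 ((M.F n ω)ᵀ *ᵥ M.crossError pen n t ω)‖ ^ 2) ∂P ≤
      ENNReal.ofReal (2 * (κ ^ 4 + (κ + 2) * κ ^ 3 * r) * ((M.p n + M.T n) *
        frobNorm (M.D pen n)⁻¹ ^ 2)) := by
  have hκ := h.κ_nonneg
  set q := Matrix.replicateCol Unit (M.P₁ n t) with hq
  set S := M.P₂ n * (M.D pen n)⁻¹ * (M.P₂ n)ᵀ with hS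
  have h0 := lintegral_indep hE (n := n) (φ := fun x y => ENNReal.ofReal
    (frobNorm (yᵀ * M.P₁ n * x * S * xᵀ * q) ^ 2)) (by
      refine ((measurable_frobNorm ?_).pow_const 2).ennreal_ofReal
      refine measurable_mul_apply (measurable_mul_apply (measurable_mul_apply
        (measurable_mul_apply (measurable_mul_apply ?_ ?_) ?_) ?_) ?_) ?_
      · exact fun i j => (measurable_pi_apply (j, i)).comp measurable_snd
      · exact fun _ _ => measurable_const
      · exact fun i j => (measurable_pi_apply (i, j)).comp measurable_fst
      · exact fun _ _ => measurable_const
      · exact fun i j => (measurable_pi_apply (j, i)).comp measurable_fst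
      · exact fun _ _ => measurable_const)
  have hcol : ∀ ω, ‖WithLp.toLp 2 ((M.F n ω)ᵀ *ᵥ M.crossError pen n t ω)‖ =
      frobNorm ((M.F n ω)ᵀ * M.P₁ n * M.eps n ω * S * (M.eps n ω)ᵀ * q) := fun ω => by
    rw [← frobNorm_replicateCol, Matrix.replicateCol_mulVec, replicateCol_crossError]
    simp only [Matrix.mul_assoc, hq, hS]
  simp only [hcol]
  rw [h0]
  have e2 := h.trace_sq n
  have e3 := h.shrink_le n
  have e5 := h.row_P₁_sq n t
  rw [← hS] at e2 e3
  rw [← hq] at e5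
  set w := frobNorm (M.D pen n)⁻¹ ^ 2 with hw
  have hw0 : 0 ≤ w := sq_nonneg _
  have hT0 : (0 : ℝ) ≤ M.T n := Nat.cast_nonneg _
  have hp0 : (0 : ℝ) ≤ M.p n := Nat.cast_nonneg _
  -- The mean of the quadratic form, given `F`, is a multiple of `Fᵀ v`. The normalization of `F`
  -- alone would bound `‖Fᵀ v‖²` by order `T`; the factor assumption bounds its expectation by a
  -- constant, since `v` has bounded length.
  set v := M.P₁ n *ᵥ M.P₁ n t with hv
  have hvv : v ⬝ᵥ v ≤ κ ^ 2 := by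
    refine (h.P₁_le n _).trans ?_
    rw [hq, frobNorm_replicateCol, norm_toLp_sq] at e5
    calc _ ≤ κ * κ := mul_le_mul_of_nonneg_left e5 hκ
      _ = _ := by ring
  have hint : ∀ᵐ ω ∂P, ∫⁻ ω', ENNReal.ofReal (frobNorm ((M.F n ω)ᵀ * M.P₁ n * M.eps n ω' * S *
      (M.eps n ω')ᵀ * q) ^ 2) ∂P ≤ ENNReal.ofReal (2 * (κ * (M.p n * w))) *
        ENNReal.ofReal (((M.F n ω)ᵀ *ᵥ v) ⬝ᵥ ((M.F n ω)ᵀ *ᵥ v)) +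
        ENNReal.ofReal (2 * (κ + 2) * ((κ * (M.T n * r)) * κ * (κ * w))) := by
    filter_upwards [gram_F hF hT] with ω hω
    refine (lintegral_quadratic_frobNorm_sq hκ (h.noise n) ((M.F n ω)ᵀ * M.P₁ n) S q).trans ?_
    have e1 : frobNorm ((M.F n ω)ᵀ * M.P₁ n) ^ 2 ≤ κ * (M.T n * r) := by
      rw [← frobNorm_transpose, Matrix.transpose_mul, Matrix.transpose_transpose]
      have := frobNorm_mul_sq_le (h.P₁_transpose_le n) (M.F n ω)
      rwa [frobNorm_sq_of_gram hω, Fintype.card_fin] at this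
    have e6 : frobNorm ((M.F n ω)ᵀ * M.P₁ n * q) ^ 2 =
        ((M.F n ω)ᵀ *ᵥ v) ⬝ᵥ ((M.F n ω)ᵀ *ᵥ v) := by
      rw [hq, Matrix.mul_assoc, ← Matrix.replicateCol_mulVec, ← Matrix.replicateCol_mulVec,
        frobNorm_replicateCol, norm_toLp_sq]
    rw [e6]
    have hnn : 0 ≤ ((M.F n ω)ᵀ *ᵥ v) ⬝ᵥ ((M.F n ω)ᵀ *ᵥ v) :=
      Finset.sum_nonneg fun _ _ => mul_self_nonneg _
    rw [← ENNReal.ofReal_mul (by positivity), ← ENNReal.ofReal_add (by positivity) (by positivity)]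
    refine ENNReal.ofReal_le_ofReal ?_
    calc _ ≤ 2 * (((M.F n ω)ᵀ *ᵥ v) ⬝ᵥ ((M.F n ω)ᵀ *ᵥ v) * (κ * (M.p n * w))) +
          2 * (κ + 2) * ((κ * (M.T n * r)) * κ * (κ * w)) := by gcongr
      _ = _ := by ring
  have hmeas : Measurable fun ω =>
      ENNReal.ofReal (((M.F n ω)ᵀ *ᵥ v) ⬝ᵥ ((M.F n ω)ᵀ *ᵥ v)) := by
    have : ∀ k, Measurable fun ω => ((M.F n ω)ᵀ *ᵥ v) k := fun k => by
      simp only [Matrix.mulVec, dotProduct, Matrix.transpose_apply]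
      exact Finset.measurable_sum _ fun s _ => (M.measurable_F n s k).mul_const _
    exact (Finset.measurable_sum _ fun k _ => (this k).mul (this k)).ennreal_ofReal
  refine (lintegral_mono_ae hint).trans ?_
  rw [lintegral_add_right _ measurable_const, lintegral_const_mul _ hmeas, lintegral_const,
    measure_univ, mul_one]
  calc _ ≤ ENNReal.ofReal (2 * (κ * (M.p n * w))) * ENNReal.ofReal (κ * κ ^ 2) +
        ENNReal.ofReal (2 * (κ + 2) * ((κ * (M.T n * r)) * κ * (κ * w))) := by
        gcongr
        exact (h.factor_le n v).trans (ENNReal.ofReal_le_ofReal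
          (mul_le_mul_of_nonneg_left hvv hκ))
    _ = ENNReal.ofReal (2 * (κ ^ 4 * (M.p n * w) + (κ + 2) * κ ^ 3 * r * (M.T n * w))) := by
        rw [← ENNReal.ofReal_mul (by positivity),
          ← ENNReal.ofReal_add (by positivity) (by positivity)]
        congr 1; ring
    _ ≤ ENNReal.ofReal (2 * (κ ^ 4 * (M.p n * w + M.T n * w) +
        (κ + 2) * κ ^ 3 * r * (M.p n * w + M.T n * w))) := by
        refine ENNReal.ofReal_le_ofReal ?_
        gcongr
        · exact le_add_of_nonneg_right (by positivity)
        · exact le_add_of_nonneg_left (by positivity)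
    _ = _ := by congr 1; ring

theorem Bounded.lintegral_score [IsProbabilityMeasure P] (n : ℕ) (t : Fin (M.T n)) :
    ∫⁻ ω, ENNReal.ofReal (‖WithLp.toLp 2 (M.score pen n t ω)‖ ^ 2) ∂P ≤
      ENNReal.ofReal (κ ^ 2 * M.p n) := by
  have hcol : ∀ ω, ‖WithLp.toLp 2 (M.score pen n t ω)‖ =
      frobNorm ((Matrix.replicateCol Unit (M.P₁ n t))ᵀ * M.eps n ω *
        (M.P₂ n * (M.D pen n)⁻¹ * M.B n)) := fun ω => by
    rw [← frobNorm_replicateCol, ← frobNorm_transpose ((Matrix.replicateCol Unit (M.P₁ n t))ᵀ * _ * _),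
      score, E_row]
    congr 1
    simp only [Matrix.transpose_mul, Matrix.transpose_transpose, M.inv_D_transpose,
      ← Matrix.replicateCol_mulVec, Matrix.mulVec_mulVec, Matrix.mul_assoc]
  simp only [hcol]
  refine (lintegral_linear_frobNorm_sq (h.noise n) _ _).trans (ENNReal.ofReal_le_ofReal ?_)
  rw [frobNorm_transpose]
  calc _ ≤ κ * (κ * M.p n) :=
        mul_le_mul (h.row_P₁_sq n t) (h.load_le n) (sq_nonneg _) h.κ_nonneg
    _ = _ := by ring

end Second

theorem lintegral_factor_row [IsProbabilityMeasure P] (hF : M.FactorConditions P) (n : ℕ)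
    (t : Fin (M.T n)) :
    ∫⁻ ω, ENNReal.ofReal (‖WithLp.toLp 2 (M.F n ω t)‖ ^ 2) ∂P ≤ ENNReal.ofReal r := by
  have hm : ∀ k, MemLp (fun ω => M.F n ω t k) 2 P := fun k =>
    (hF.memLp n t k).mono_exponent (by norm_num)
  have he : ∀ ω, ‖WithLp.toLp 2 (M.F n ω t)‖ ^ 2 = ∑ k, M.F n ω t k ^ 2 := fun ω => by
    rw [norm_toLp_sq]; simp [dotProduct, sq]
  simp only [he]
  rw [← ofReal_integral_eq_lintegral_ofReal
    (integrable_finsetSum _ fun k _ => (hm k).integrable_sq)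
    (Eventually.of_forall fun ω => Finset.sum_nonneg fun _ _ => sq_nonneg _),
    integral_finsetSum _ fun k _ => (hm k).integrable_sq]
  simp [hF.second]

end Model

end ModelBounds

end NetFactor

namespace NetFactor

/-! ### Gaussian limits with non-convergent covariances. -/

section GaussianLimits

variable {r : ℕ}

theorem map_multivariateGaussian {V : Matrix (Fin r) (Fin r) ℝ} (hV : V.PosSemidef)
    (A : Matrix (Fin r) (Fin r) ℝ) :
    (multivariateGaussian 0 V).map (Matrix.toEuclideanCLM (𝕜 := ℝ) A) =
      multivariateGaussian 0 (A * V * Aᵀ) := by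
  have hAV : (A * V * Aᵀ).PosSemidef := hV.mul_mul_conjTranspose_same A
  have hprob : IsProbabilityMeasure ((multivariateGaussian 0 V).map
      (Matrix.toEuclideanCLM (𝕜 := ℝ) A)) := Measure.isProbabilityMeasure_map (by fun_prop)
  refine Measure.ext_of_charFun ?_
  funext x
  rw [charFun_multivariateGaussian hAV, charFun_apply, integral_map (by fun_prop) (by fun_prop)]
  have hin : ∀ y : EuclideanSpace ℝ (Fin r), inner ℝ (Matrix.toEuclideanCLM (𝕜 := ℝ) A y) x =
      inner ℝ y (Matrix.toEuclideanCLM (𝕜 := ℝ) Aᵀ x) := fun y => by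
    simp only [PiLp.inner_apply, Matrix.ofLp_toEuclideanCLM]
    have := Matrix.dotProduct_mulVec x.ofLp A y.ofLp
    rw [← Matrix.mulVec_transpose] at this
    simpa [dotProduct, mul_comm] using this
  simp only [hin]
  rw [← charFun_apply, charFun_multivariateGaussian hV]
  congr 1
  simp only [inner_zero_right, Matrix.ofLp_toEuclideanCLM]
  congr 3
  rw [Matrix.mulVec_mulVec, Matrix.mul_assoc, ← Matrix.mulVec_mulVec x.ofLp A,
    Matrix.dotProduct_mulVec x.ofLp A, Matrix.mulVec_transpose A]

theorem continuous_toEuclideanCLM :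
    Continuous fun A : Matrix (Fin r) (Fin r) ℝ => Matrix.toEuclideanCLM (𝕜 := ℝ) A :=
  LinearMap.continuous_of_finiteDimensional
    ((Matrix.toEuclideanCLM (𝕜 := ℝ) (n := Fin r)).toAlgEquiv.toLinearMap)

theorem exists_tendsto_subseq {A : ℕ → Matrix (Fin r) (Fin r) ℝ} {m : ℝ}
    (hA : ∀ᶠ n in atTop, frobNorm (A n) ≤ m) {ns : ℕ → ℕ} (hns : Tendsto ns atTop atTop) :
    ∃ (φ : ℕ → ℕ) (L : Matrix (Fin r) (Fin r) ℝ), Tendsto (fun k => ns (φ k)) atTop atTop ∧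
      Tendsto (fun k => A (ns (φ k))) atTop (𝓝 L) := by
  have hc : IsCompact (Set.univ.pi fun _ : Fin r => Set.univ.pi fun _ : Fin r => Set.Icc (-m) m) :=
    isCompact_univ_pi fun _ => isCompact_univ_pi fun _ => isCompact_Icc
  obtain ⟨L, -, φ, hφ, hL⟩ := hc.tendsto_subseq' (X := Fin r → Fin r → ℝ)
    (x := fun k => A (ns k)) ((hns.eventually hA).mono fun k hk i _ j _ =>
      abs_le.1 ((abs_le_frobNorm _ i j).trans hk)).frequently
  exact ⟨φ, L, hns.comp hφ.tendsto_atTop, hL⟩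

/-- All the Gaussian laws are images of the single law `N(0, V)` under `A n`, so dominated
convergence suffices. -/
theorem tendsto_integral_gaussian {V : Matrix (Fin r) (Fin r) ℝ} (hV : V.PosSemidef)
    {A : ℕ → Matrix (Fin r) (Fin r) ℝ} {L : Matrix (Fin r) (Fin r) ℝ}
    (hA : Tendsto A atTop (𝓝 L))
    (f : BoundedContinuousFunction (EuclideanSpace ℝ (Fin r)) ℝ) :
    Tendsto (fun n => ∫ x, f x ∂(multivariateGaussian 0 (A n * V * (A n)ᵀ))) atTop
      (𝓝 (∫ x, f x ∂(multivariateGaussian 0 (L * V * Lᵀ)))) := by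
  have hint : ∀ B : Matrix (Fin r) (Fin r) ℝ,
      ∫ x, f x ∂(multivariateGaussian 0 (B * V * Bᵀ)) =
        ∫ x, f (Matrix.toEuclideanCLM (𝕜 := ℝ) B x) ∂(multivariateGaussian 0 V) := fun B => by
    rw [← map_multivariateGaussian hV, integral_map (by fun_prop)
      f.continuous.aestronglyMeasurable]
  simp only [hint]
  refine tendsto_integral_of_dominated_convergence (fun _ => ‖f‖) (fun n => ?_)
    (integrable_const _) (fun n => Eventually.of_forall fun x => f.norm_coe_le_norm _)
    (Eventually.of_forall fun x => ?_)
  · exact (f.continuous.comp (Matrix.toEuclideanCLM (𝕜 := ℝ) (A n)).continuous).aestronglyMeasurable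
  · refine (f.continuous.tendsto _).comp ?_
    have := (continuous_toEuclideanCLM.tendsto L).comp hA
    exact ((ContinuousLinearMap.apply ℝ _ x).continuous.tendsto _).comp this

variable {Ω : Type*} [MeasurableSpace Ω] {P : Measure Ω} [IsProbabilityMeasure P]

/-- Slutsky's theorem, with the deterministic maps `A n` viewed as random elements converging in
measure to the constant `L`. -/
theorem tendsto_integral_of_linear {V : Matrix (Fin r) (Fin r) ℝ} (hV : V.PosSemidef)
    {W Z : ℕ → Ω → EuclideanSpace ℝ (Fin r)} {A : ℕ → Matrix (Fin r) (Fin r) ℝ}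
    {L : Matrix (Fin r) (Fin r) ℝ} (hA : Tendsto A atTop (𝓝 L))
    (hW : TendstoInDistribution W atTop (id : EuclideanSpace ℝ (Fin r) → EuclideanSpace ℝ (Fin r))
      (fun _ => P) (multivariateGaussian 0 V))
    (hZ : ∀ n, AEMeasurable (Z n) P)
    (hZW : TendstoInMeasure P
      (fun n ω => Z n ω - Matrix.toEuclideanCLM (𝕜 := ℝ) (A n) (W n ω)) atTop (fun _ => 0))
    (f : BoundedContinuousFunction (EuclideanSpace ℝ (Fin r)) ℝ) :
    Tendsto (fun n => ∫ ω, f (Z n ω) ∂P) atTop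
      (𝓝 (∫ x, f x ∂(multivariateGaussian 0 (L * V * Lᵀ)))) := by
  let E := EuclideanSpace ℝ (Fin r)
  have hAc : TendstoInMeasure P (fun n (_ : Ω) => Matrix.toEuclideanCLM (𝕜 := ℝ) (A n)) atTop
      (fun _ => Matrix.toEuclideanCLM (𝕜 := ℝ) L) :=
    tendstoInMeasure_of_tendsto_ae (fun n => aestronglyMeasurable_const)
      (Eventually.of_forall fun _ => (continuous_toEuclideanCLM.tendsto L).comp hA)
  have h1 : TendstoInDistribution (fun n ω => Matrix.toEuclideanCLM (𝕜 := ℝ) (A n) (W n ω)) atTop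
      (fun x : E => Matrix.toEuclideanCLM (𝕜 := ℝ) L x) (fun _ => P)
      (multivariateGaussian 0 V) :=
    hW.continuous_comp_prodMk_of_tendstoInMeasure_const (g := fun z : E × (E →L[ℝ] E) => z.2 z.1)
      (by fun_prop) hAc (fun _ => aemeasurable_const)
  have h2 := tendstoInDistribution_of_tendstoInMeasure_sub Z _ h1 hZW hZ
  have h3 := ProbabilityMeasure.tendsto_iff_forall_integral_tendsto.1 h2.tendsto f
  simp only [ProbabilityMeasure.coe_mk] at h3
  rw [map_multivariateGaussian hV] at h3
  refine h3.congr fun n => ?_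
  rw [integral_map (hZ n) f.continuous.aestronglyMeasurable]

/-- Bounded matrices have convergent subsequences; along one of them both expectations tend to the
integral under `N(0, L V Lᵀ)`, so their difference tends to zero. -/
theorem asymptoticallyNormal_of_linear {V : Matrix (Fin r) (Fin r) ℝ} (hV : V.PosSemidef)
    {W Z : ℕ → Ω → EuclideanSpace ℝ (Fin r)} {A : ℕ → Matrix (Fin r) (Fin r) ℝ} {m : ℝ}
    (hA : ∀ᶠ n in atTop, frobNorm (A n) ≤ m)
    (hW : TendstoInDistribution W atTop (id : EuclideanSpace ℝ (Fin r) → EuclideanSpace ℝ (Fin r))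
      (fun _ => P) (multivariateGaussian 0 V))
    (hZ : ∀ n, AEMeasurable (Z n) P)
    (hZW : TendstoInMeasure P
      (fun n ω => Z n ω - Matrix.toEuclideanCLM (𝕜 := ℝ) (A n) (W n ω)) atTop (fun _ => 0)) :
    AsymptoticallyNormal P Z (fun n => A n * V * (A n)ᵀ) := by
  intro f
  refine tendsto_of_subseq_tendsto fun ns hns => ?_
  obtain ⟨φ, L, hφ, hL⟩ := exists_tendsto_subseq hA hns
  have hW' : TendstoInDistribution (fun k => W (ns (φ k))) atTop
      (id : EuclideanSpace ℝ (Fin r) → EuclideanSpace ℝ (Fin r))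
      (fun _ => P) (multivariateGaussian 0 V) :=
    ⟨fun k => hW.forall_aemeasurable _, hW.aemeasurable_limit, hW.tendsto.comp hφ⟩
  have h1 := tendsto_integral_of_linear hV hL hW' (fun k => hZ (ns (φ k)))
    (fun ε hε => (hZW ε hε).comp hφ) f
  have h2 := tendsto_integral_gaussian hV hL f
  exact ⟨φ, by simpa using h1.sub h2⟩

theorem AsymptoticallyNormal.tendstoInDistribution {V : Matrix (Fin r) (Fin r) ℝ}
    (hV : V.PosSemidef) {Z : ℕ → Ω → EuclideanSpace ℝ (Fin r)}
    {A : ℕ → Matrix (Fin r) (Fin r) ℝ} {m : ℝ} (hA : ∀ᶠ n in atTop, frobNorm (A n) ≤ m)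
    (hZ : ∀ n, AEMeasurable (Z n) P)
    (h : AsymptoticallyNormal P Z (fun n => A n * V * (A n)ᵀ)) {C : Matrix (Fin r) (Fin r) ℝ}
    (hC : Tendsto (fun n => A n * V * (A n)ᵀ) atTop (𝓝 C)) :
    TendstoInDistribution Z atTop (id : EuclideanSpace ℝ (Fin r) → EuclideanSpace ℝ (Fin r))
      (fun _ => P) (multivariateGaussian 0 C) := by
  refine ⟨hZ, aemeasurable_id, ProbabilityMeasure.tendsto_iff_forall_integral_tendsto.2 fun f => ?_⟩
  have hg : Tendsto (fun n => ∫ x, f x ∂(multivariateGaussian 0 (A n * V * (A n)ᵀ))) atTop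
      (𝓝 (∫ x, f x ∂(multivariateGaussian 0 C))) := by
    refine tendsto_of_subseq_tendsto fun ns hns => ?_
    obtain ⟨φ, L, hφ, hL⟩ := exists_tendsto_subseq hA hns
    have hcont : Continuous fun B : Matrix (Fin r) (Fin r) ℝ => B * V * Bᵀ := by fun_prop
    -- The `A n` may have several limit points `L`, but all of them give the same covariance.
    have hCL : C = L * V * Lᵀ :=
      tendsto_nhds_unique (hC.comp hφ) ((hcont.tendsto L).comp hL)
    exact ⟨φ, hCL ▸ tendsto_integral_gaussian hV hL f⟩
  have h2 := (h f).add hg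
  simp only [sub_add_cancel, zero_add] at h2
  simp only [ProbabilityMeasure.coe_mk, Measure.map_id]
  refine h2.congr fun n => ?_
  rw [integral_map (hZ n) f.continuous.aestronglyMeasurable]

end GaussianLimits

end NetFactor

namespace NetFactor

/-! ### Good events, and the Gram matrix as a spiked matrix. -/

section Assembly

variable {r : ℕ} {Ω : Type*} [MeasurableSpace Ω] {P : Measure Ω}

/-- The passage from deterministic estimates on good events to probabilities. Only monotonicity of
the measure is used, so neither the events nor the sets have to be measurable, and no measurability
of `H` is needed here. -/
theorem tendsto_measure_zero_of_tight {good : ℝ → ℕ → Ω → Prop} {A : ℕ → Set Ω}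
    (htight : ∀ ε : ℝ, 0 < ε → ∃ K : ℝ, 0 < K ∧
      ∀ᶠ n in atTop, P {ω | ¬ good K n ω} ≤ ENNReal.ofReal ε)
    (h : ∀ K : ℝ, 0 < K → ∀ᶠ n in atTop, ∀ᵐ ω ∂P, good K n ω → ω ∉ A n) :
    Tendsto (fun n => P (A n)) atTop (𝓝 0) := by
  refine ENNReal.tendsto_nhds_zero.2 fun ε hε => ?_
  obtain ⟨δ, hδ0, hδ⟩ : ∃ δ : ℝ, 0 < δ ∧ ENNReal.ofReal δ ≤ ε := by
    rcases eq_or_ne ε ⊤ with rfl | htop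
    · exact ⟨1, one_pos, le_top⟩
    · exact ⟨ε.toReal, ENNReal.toReal_pos hε.ne' htop, ENNReal.ofReal_toReal_le⟩
  obtain ⟨K, hK, hev⟩ := htight δ hδ0
  filter_upwards [hev, h K hK] with n h1 h2
  refine le_trans (measure_mono_ae ?_) (h1.trans hδ)
  filter_upwards [h2] with ω hω hA hgood
  exact hω hgood hA

namespace Model

/-- The matrix `E D⁻¹ B`. -/
noncomputable def noiseLoad (M : Model r Ω) (pen : Penalty) (n : ℕ) (ω : Ω) :
    Matrix (Fin (M.T n)) (Fin r) ℝ :=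
  M.E n ω * (M.D pen n)⁻¹ * M.B n

/-- The matrix `E D⁻¹ Eᵀ`. -/
noncomputable def noiseGram (M : Model r Ω) (pen : Penalty) (n : ℕ) (ω : Ω) :
    Matrix (Fin (M.T n)) (Fin (M.T n)) ℝ :=
  M.E n ω * (M.D pen n)⁻¹ * (M.E n ω)ᵀ

/-- The perturbation of the Gram matrix `(pT)⁻¹ X D⁻¹ Xᵀ` due to the errors. -/
noncomputable def perturbation (M : Model r Ω) (pen : Penalty) (n : ℕ) (ω : Ω) :
    Matrix (Fin (M.T n)) (Fin (M.T n)) ℝ :=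
  ((M.p n : ℝ) * (M.T n : ℝ))⁻¹ • (M.F n ω * (M.noiseLoad pen n ω)ᵀ +
    M.noiseLoad pen n ω * (M.F n ω)ᵀ + M.noiseGram pen n ω)

theorem gram_eq (M : Model r Ω) (pen : Penalty) (n : ℕ) (ω : Ω) :
    M.gram pen n ω = (M.T n : ℝ)⁻¹ • (M.F n ω * M.S pen n * (M.F n ω)ᵀ) +
      M.perturbation pen n ω := by
  simp only [gram, perturbation, S, X, noiseLoad, noiseGram, Matrix.transpose_add,
    Matrix.transpose_mul, Matrix.transpose_transpose, M.inv_D_transpose, Matrix.smul_mul,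
    Matrix.mul_smul, smul_smul, Matrix.add_mul, Matrix.mul_add, smul_add, Matrix.mul_assoc]
  rw [mul_inv, mul_comm (M.p n : ℝ)⁻¹]
  abel

theorem gram_isHermitian (M : Model r Ω) (pen : Penalty) (n : ℕ) (ω : Ω) :
    (M.gram pen n ω).IsHermitian := by
  rw [Matrix.IsHermitian, Matrix.conjTranspose_eq_transpose_of_trivial]
  simp only [gram, Matrix.transpose_smul, Matrix.transpose_mul, Matrix.transpose_transpose,
    M.inv_D_transpose, Matrix.mul_assoc]

theorem noiseLoad_row (M : Model r Ω) (pen : Penalty) (n : ℕ) (t : Fin (M.T n)) (ω : Ω) :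
    M.noiseLoad pen n ω t = M.score pen n t ω := by
  have h : (M.B n)ᵀ * (M.D pen n)⁻¹ = ((M.D pen n)⁻¹ * M.B n)ᵀ := by
    rw [Matrix.transpose_mul, M.inv_D_transpose]
  rw [score, h, Matrix.mulVec_transpose, noiseLoad, Matrix.mul_assoc]
  rfl

theorem noiseGram_row (M : Model r Ω) (pen : Penalty) (n : ℕ) (t : Fin (M.T n)) (ω : Ω) :
    M.noiseGram pen n ω t = M.crossError pen n t ω := by
  have h : M.E n ω * (M.D pen n)⁻¹ = ((M.D pen n)⁻¹ * (M.E n ω)ᵀ)ᵀ := by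
    rw [Matrix.transpose_mul, M.inv_D_transpose, Matrix.transpose_transpose]
  rw [crossError, Matrix.mulVec_mulVec, h, Matrix.mulVec_transpose, noiseGram, Matrix.mul_assoc]
  rfl

theorem perturbation_row (M : Model r Ω) (pen : Penalty) (n : ℕ) (t : Fin (M.T n)) (ω : Ω) :
    M.perturbation pen n ω t = ((M.p n : ℝ) * (M.T n : ℝ))⁻¹ •
      (M.F n ω *ᵥ M.score pen n t ω + (M.noiseLoad pen n ω *ᵥ M.F n ω t +
        M.crossError pen n t ω)) := by
  have h1 : (M.F n ω * (M.noiseLoad pen n ω)ᵀ) t = M.noiseLoad pen n ω *ᵥ M.F n ω t := by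
    rw [← Matrix.vecMul_transpose]; rfl
  have h2 : (M.noiseLoad pen n ω * (M.F n ω)ᵀ) t = M.F n ω *ᵥ M.score pen n t ω := by
    rw [← Matrix.vecMul_transpose, ← noiseLoad_row]; rfl
  rw [← h1, ← h2, ← noiseGram_row, perturbation]
  funext j
  simp only [Matrix.smul_apply, Matrix.add_apply, Pi.smul_apply, Pi.add_apply]
  congr 1
  ring

/-- The event that the error terms in the Gram matrix are at most `K` times their orders. -/
structure GramControl (M : Model r Ω) (pen : Penalty) (K : ℝ) (n : ℕ) (ω : Ω) : Prop where
  noiseLoad_le : frobNorm (M.noiseLoad pen n ω) ≤ K * Real.sqrt (M.T n * M.p n)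
  noiseGram_le : frobNorm (M.noiseGram pen n ω) ≤
    K * (Real.sqrt (M.T n * M.p n) * frobNorm (M.D pen n)⁻¹)

/-- The event that all error terms in the estimation error at time `t` are at most `K` times their
orders. -/
structure ErrorControl (M : Model r Ω) (pen : Penalty) (t : ∀ n, Fin (M.T n)) (K : ℝ) (n : ℕ)
    (ω : Ω) : Prop extends M.GramControl pen K n ω where
  factor_noiseLoad_le : frobNorm ((M.F n ω)ᵀ * M.noiseLoad pen n ω) ≤
    K * Real.sqrt (M.T n * M.p n)
  crossError_le : ‖WithLp.toLp 2 (M.crossError pen n (t n) ω)‖ ≤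
    K * (Real.sqrt (M.p n) * frobNorm (M.D pen n)⁻¹)
  factor_crossError_le : ‖WithLp.toLp 2 ((M.F n ω)ᵀ *ᵥ M.crossError pen n (t n) ω)‖ ≤
    K * (Real.sqrt (M.p n) * frobNorm (M.D pen n)⁻¹)
  factor_le : ‖WithLp.toLp 2 (M.F n ω (t n))‖ ≤ K * 1
  score_le : ‖WithLp.toLp 2 (M.score pen n (t n) ω)‖ ≤ K * Real.sqrt (M.p n)

section Tight

variable {M : Model r Ω} {pen : Penalty} {κ : ℝ}

theorem DimensionRegime.p_pos (hdim : M.DimensionRegime) : ∀ᶠ n in atTop, 0 < M.p n :=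
  hdim.p_tendsto.eventually_gt_atTop 0

theorem DimensionRegime.T_pos (hdim : M.DimensionRegime) : ∀ᶠ n in atTop, 0 < M.T n :=
  hdim.T_tendsto.eventually_gt_atTop 0

theorem measurable_noiseLoad (M : Model r Ω) (pen : Penalty) (n : ℕ) (i : Fin (M.T n)) (k : Fin r) :
    Measurable fun ω => M.noiseLoad pen n ω i k := by
  simp only [noiseLoad_row]
  exact M.measurable_score pen n i k

theorem measurable_noiseGram (M : Model r Ω) (pen : Penalty) (n : ℕ) (i j : Fin (M.T n)) :
    Measurable fun ω => M.noiseGram pen n ω i j := by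
  simp only [noiseGram_row]
  exact M.measurable_crossError pen n i j

theorem measurable_norm_toLp {m : ℕ} {v : Ω → Fin m → ℝ} (hv : ∀ i, Measurable fun ω => v ω i) :
    Measurable fun ω => ‖WithLp.toLp 2 (v ω)‖ := by
  simp only [← frobNorm_replicateCol]
  exact measurable_frobNorm fun i _ => hv i

variable [IsProbabilityMeasure P]

theorem isBigOP_noiseLoad (h : M.Bounded P pen κ) (hdim : M.DimensionRegime) :
    IsBigOP P (fun n ω => frobNorm (M.noiseLoad pen n ω))
      (fun n => Real.sqrt (M.T n * M.p n)) := by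
  refine isBigOP_of_lintegral (C := κ ^ 2)
    (fun n => measurable_frobNorm (M.measurable_noiseLoad pen n)) ?_ ?_
  · filter_upwards [hdim.p_pos, hdim.T_pos] with n hp hT
    positivity
  · refine Eventually.of_forall fun n => ?_
    rw [Real.sq_sqrt (by positivity)]
    exact h.lintegral_load n

theorem isBigOP_noiseGram (h : M.Bounded P pen κ) (hdim : M.DimensionRegime) :
    IsBigOP P (fun n ω => frobNorm (M.noiseGram pen n ω))
      (fun n => Real.sqrt (M.T n * M.p n) * frobNorm (M.D pen n)⁻¹) := by
  obtain ⟨C, hC⟩ := hdim.T_le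
  have hκ := h.κ_nonneg
  refine isBigOP_of_lintegral (C := 2 * (κ ^ 3 + (κ + 2) * κ ^ 3) * (1 + C))
    (fun n => measurable_frobNorm (M.measurable_noiseGram pen n)) ?_ ?_
  · filter_upwards [hdim.p_pos, hdim.T_pos] with n hp hT
    have := M.frobNorm_inv_D_pos pen hp
    positivity
  · filter_upwards [hC] with n hn
    refine (h.lintegral_gram n).trans (ENNReal.ofReal_le_ofReal ?_)
    rw [mul_pow, Real.sq_sqrt (by positivity)]
    calc _ ≤ 2 * (κ ^ 3 + (κ + 2) * κ ^ 3) * (M.T n * (M.p n + C * M.p n) *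
          frobNorm (M.D pen n)⁻¹ ^ 2) := by gcongr
      _ = _ := by ring

theorem isBigOP_factor_noiseLoad (h : M.Bounded P pen κ) (hdim : M.DimensionRegime)
    (hF : M.FactorConditions P) (hE : M.ErrorConditions P) :
    IsBigOP P (fun n ω => frobNorm ((M.F n ω)ᵀ * M.noiseLoad pen n ω))
      (fun n => Real.sqrt (M.T n * M.p n)) := by
  refine isBigOP_of_lintegral (C := κ ^ 2 * r)
    (fun n => measurable_frobNorm (measurable_mul_apply (fun i j => M.measurable_F n j i)
      (M.measurable_noiseLoad pen n))) ?_ ?_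
  · filter_upwards [hdim.p_pos, hdim.T_pos] with n hp hT
    positivity
  · filter_upwards [hdim.T_pos] with n hT
    rw [Real.sq_sqrt (by positivity)]
    exact h.lintegral_factor_load hF hE hT

theorem isBigOP_crossError (h : M.Bounded P pen κ) (hdim : M.DimensionRegime)
    (t : ∀ n, Fin (M.T n)) :
    IsBigOP P (fun n ω => ‖WithLp.toLp 2 (M.crossError pen n (t n) ω)‖)
      (fun n => Real.sqrt (M.p n) * frobNorm (M.D pen n)⁻¹) := by
  obtain ⟨C, hC⟩ := hdim.T_le
  have hκ := h.κ_nonneg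
  refine isBigOP_of_lintegral (C := 2 * (κ ^ 3 + (κ + 2) * κ ^ 3) * (1 + C))
    (fun n => measurable_norm_toLp (M.measurable_crossError pen n (t n))) ?_ ?_
  · filter_upwards [hdim.p_pos] with n hp
    have := M.frobNorm_inv_D_pos pen hp
    positivity
  · filter_upwards [hC] with n hn
    refine (h.lintegral_crossError n (t n)).trans (ENNReal.ofReal_le_ofReal ?_)
    rw [mul_pow, Real.sq_sqrt (by positivity)]
    calc _ ≤ 2 * (κ ^ 3 + (κ + 2) * κ ^ 3) * ((M.p n + C * M.p n) *
          frobNorm (M.D pen n)⁻¹ ^ 2) := by gcongr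
      _ = _ := by ring

theorem isBigOP_factor_crossError (h : M.Bounded P pen κ) (hdim : M.DimensionRegime)
    (hF : M.FactorConditions P) (hE : M.ErrorConditions P) (t : ∀ n, Fin (M.T n)) :
    IsBigOP P (fun n ω => ‖WithLp.toLp 2 ((M.F n ω)ᵀ *ᵥ M.crossError pen n (t n) ω)‖)
      (fun n => Real.sqrt (M.p n) * frobNorm (M.D pen n)⁻¹) := by
  obtain ⟨C, hC⟩ := hdim.T_le
  have hκ := h.κ_nonneg
  refine isBigOP_of_lintegral (C := 2 * (κ ^ 4 + (κ + 2) * κ ^ 3 * r) * (1 + C))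
    (fun n => measurable_norm_toLp fun k => ?_) ?_ ?_
  · simp only [Matrix.mulVec, dotProduct, Matrix.transpose_apply]
    exact Finset.measurable_sum _ fun s _ =>
      (M.measurable_F n s k).mul (M.measurable_crossError pen n (t n) s)
  · filter_upwards [hdim.p_pos] with n hp
    have := M.frobNorm_inv_D_pos pen hp
    positivity
  · filter_upwards [hC, hdim.T_pos] with n hn hT
    refine (h.lintegral_factor_crossError hF hE hT (t n)).trans (ENNReal.ofReal_le_ofReal ?_)
    rw [mul_pow, Real.sq_sqrt (by positivity)]
    calc _ ≤ 2 * (κ ^ 4 + (κ + 2) * κ ^ 3 * r) * ((M.p n + C * M.p n) *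
          frobNorm (M.D pen n)⁻¹ ^ 2) := by gcongr
      _ = _ := by ring

theorem isBigOP_factor_row (hF : M.FactorConditions P) (t : ∀ n, Fin (M.T n)) :
    IsBigOP P (fun n ω => ‖WithLp.toLp 2 (M.F n ω (t n))‖) (fun _ => 1) := by
  refine isBigOP_of_lintegral (C := r)
    (fun n => measurable_norm_toLp (M.measurable_F n (t n)))
    (Eventually.of_forall fun _ => one_pos) (Eventually.of_forall fun n => ?_)
  simpa using lintegral_factor_row hF n (t n)

theorem isBigOP_score (h : M.Bounded P pen κ) (hdim : M.DimensionRegime) (t : ∀ n, Fin (M.T n)) :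
    IsBigOP P (fun n ω => ‖WithLp.toLp 2 (M.score pen n (t n) ω)‖)
      (fun n => Real.sqrt (M.p n)) := by
  refine isBigOP_of_lintegral (C := κ ^ 2)
    (fun n => measurable_norm_toLp (M.measurable_score pen n (t n))) ?_ ?_
  · filter_upwards [hdim.p_pos] with n hp
    positivity
  · refine Eventually.of_forall fun n => ?_
    rw [Real.sq_sqrt (by positivity)]
    exact h.lintegral_score n (t n)

theorem exists_errorControl (h : M.Bounded P pen κ) (hdim : M.DimensionRegime)
    (hF : M.FactorConditions P) (hE : M.ErrorConditions P) (t : ∀ n, Fin (M.T n)) (ε : ℝ)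
    (hε : 0 < ε) : ∃ K : ℝ, 0 < K ∧
      ∀ᶠ n in atTop, P {ω | ¬ M.ErrorControl pen t K n ω} ≤ ENNReal.ofReal ε := by
  have hw : ∀ n, 0 ≤ frobNorm (M.D pen n)⁻¹ := fun n => frobNorm_nonneg _
  obtain ⟨K, hK, hev⟩ := exists_forall_norm_le (ι := Fin 7) (P := P)
    (Z := ![fun n ω => frobNorm (M.noiseLoad pen n ω), fun n ω => frobNorm (M.noiseGram pen n ω),
      fun n ω => frobNorm ((M.F n ω)ᵀ * M.noiseLoad pen n ω),
      fun n ω => ‖WithLp.toLp 2 (M.crossError pen n (t n) ω)‖,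
      fun n ω => ‖WithLp.toLp 2 ((M.F n ω)ᵀ *ᵥ M.crossError pen n (t n) ω)‖,
      fun n ω => ‖WithLp.toLp 2 (M.F n ω (t n))‖,
      fun n ω => ‖WithLp.toLp 2 (M.score pen n (t n) ω)‖])
    (a := ![fun n => Real.sqrt (M.T n * M.p n),
      fun n => Real.sqrt (M.T n * M.p n) * frobNorm (M.D pen n)⁻¹,
      fun n => Real.sqrt (M.T n * M.p n), fun n => Real.sqrt (M.p n) * frobNorm (M.D pen n)⁻¹,
      fun n => Real.sqrt (M.p n) * frobNorm (M.D pen n)⁻¹, fun _ => 1,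
      fun n => Real.sqrt (M.p n)])
    (fun i n => by
      have := hw n
      fin_cases i <;> simp <;> positivity)
    (fun i => by
      fin_cases i
      · exact isBigOP_noiseLoad h hdim
      · exact isBigOP_noiseGram h hdim
      · exact isBigOP_factor_noiseLoad h hdim hF hE
      · exact isBigOP_crossError h hdim t
      · exact isBigOP_factor_crossError h hdim hF hE t
      · exact isBigOP_factor_row hF t
      · exact isBigOP_score h hdim t) hε
  refine ⟨K, hK, hev.mono fun n hn => le_trans (measure_mono fun ω hω => ?_) hn⟩
  refine fun hall => hω ?_
  have e : ∀ i, _ := fun i => (le_abs_self _).trans (hall i)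
  exact ⟨⟨e 0, e 1⟩, e 2, e 3, e 4, e 5, e 6⟩

theorem exists_gramControl (h : M.Bounded P pen κ) (hdim : M.DimensionRegime) (ε : ℝ)
    (hε : 0 < ε) : ∃ K : ℝ, 0 < K ∧
      ∀ᶠ n in atTop, P {ω | ¬ M.GramControl pen K n ω} ≤ ENNReal.ofReal ε := by
  have hw : ∀ n, 0 ≤ frobNorm (M.D pen n)⁻¹ := fun n => frobNorm_nonneg _
  obtain ⟨K, hK, hev⟩ := exists_forall_norm_le (ι := Fin 2) (P := P)
    (Z := ![fun n ω => frobNorm (M.noiseLoad pen n ω), fun n ω => frobNorm (M.noiseGram pen n ω)])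
    (a := ![fun n => Real.sqrt (M.T n * M.p n),
      fun n => Real.sqrt (M.T n * M.p n) * frobNorm (M.D pen n)⁻¹])
    (fun i n => by
      have := hw n
      fin_cases i <;> simp <;> positivity)
    (fun i => by
      fin_cases i
      · exact isBigOP_noiseLoad h hdim
      · exact isBigOP_noiseGram h hdim) hε
  refine ⟨K, hK, hev.mono fun n hn => le_trans (measure_mono fun ω hω => ?_) hn⟩
  refine fun hall => hω ?_
  have e : ∀ i, _ := fun i => (le_abs_self _).trans (hall i)
  exact ⟨e 0, e 1⟩

end Tight

section Spiked

variable {M : Model r Ω} {pen : Penalty}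
  {Fhat : ∀ n, Ω → Matrix (Fin (M.T n)) (Fin r) ℝ} {Γ : ℕ → Matrix (Fin r) (Fin r) ℝ} {c : ℝ}

/-- The cross terms are of order `p^{-1/2}`, which `T ≤ C p` turns into `T^{-1/2}`; the quadratic
term is of order `‖D⁻¹‖_F / √(Tp)`, where `‖D⁻¹‖_F ≤ √p`. -/
theorem frobNorm_perturbation_le {K C : ℝ} (hK : 0 < K) (hC : 0 ≤ C) {n : ℕ} {ω : Ω}
    (hp : 0 < M.p n) (hT : 0 < M.T n) (hTp : (M.T n : ℝ) ≤ C * M.p n)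
    (hF : (M.F n ω)ᵀ * M.F n ω = (M.T n : ℝ) • 1) (h : M.GramControl pen K n ω) :
    frobNorm (M.perturbation pen n ω) ≤
      K * (2 * Real.sqrt r * Real.sqrt C + 1) / Real.sqrt (M.T n) := by
  have hp' : (0 : ℝ) < M.p n := Nat.cast_pos.2 hp
  have hT' : (0 : ℝ) < M.T n := Nat.cast_pos.2 hT
  have h1 := h.noiseLoad_le
  have h2 := h.noiseGram_le
  have hF' := frobNorm_eq_of_gram hF
  rw [Fintype.card_fin, Real.sqrt_mul hT'.le] at hF'
  rw [Real.sqrt_mul hT'.le] at h1 h2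
  set a := Real.sqrt (M.T n) with ha
  set b := Real.sqrt (M.p n) with hb
  have ha0 : 0 < a := Real.sqrt_pos.2 hT'
  have hb0 : 0 < b := Real.sqrt_pos.2 hp'
  have haa : a * a = M.T n := Real.mul_self_sqrt hT'.le
  have hbb : b * b = M.p n := Real.mul_self_sqrt hp'.le
  have hab : a ≤ Real.sqrt C * b := by
    rw [ha, hb, ← Real.sqrt_mul hC]
    exact Real.sqrt_le_sqrt hTp
  have hw : frobNorm (M.D pen n)⁻¹ ≤ b := by
    rw [hb]
    exact Real.le_sqrt_of_sq_le (M.frobNorm_inv_D_le pen n)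
  have hw0 := frobNorm_nonneg (M.D pen n)⁻¹
  set w := frobNorm (M.D pen n)⁻¹ with hwdef
  have hsum : frobNorm (M.F n ω * (M.noiseLoad pen n ω)ᵀ +
      M.noiseLoad pen n ω * (M.F n ω)ᵀ + M.noiseGram pen n ω) ≤
      2 * ((a * Real.sqrt r) * (K * (a * b))) + K * (a * b * w) := by
    refine (frobNorm_add_le _ _).trans ?_
    have e0 := frobNorm_add_le (M.F n ω * (M.noiseLoad pen n ω)ᵀ)
      (M.noiseLoad pen n ω * (M.F n ω)ᵀ)
    have e1 := frobNorm_mul_le (M.F n ω) (M.noiseLoad pen n ω)ᵀ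
    have e2 := frobNorm_mul_le (M.noiseLoad pen n ω) (M.F n ω)ᵀ
    rw [frobNorm_transpose, hF'] at e1 e2
    have e3 : a * Real.sqrt r * frobNorm (M.noiseLoad pen n ω) ≤
        (a * Real.sqrt r) * (K * (a * b)) := by gcongr
    linarith
  rw [perturbation, frobNorm_smul, abs_of_pos (by positivity), inv_mul_le_iff₀ (by positivity)]
  refine hsum.trans ?_
  have : (M.p n : ℝ) * M.T n * (K * (2 * Real.sqrt r * Real.sqrt C + 1) / a) =
      2 * ((a * Real.sqrt r) * (K * ((Real.sqrt C * b) * b))) + K * (a * b * b) := by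
    rw [← haa, ← hbb]
    field_simp
  rw [this]
  gcongr

theorem eventually_spikedGram (hdim : M.DimensionRegime) (hF : M.FactorConditions P)
    (hFhat : M.IsScoreEstimator P pen Fhat) (hc : 0 < c)
    (hS : ∀ᶠ n in atTop, (∀ k : Fin r, c ≤ eig (M.S pen n) k) ∧
      ∀ k l : Fin r, k < l → c ≤ eig (M.S pen n) k - eig (M.S pen n) l)
    (hΓ : ∀ n, (Γ n)ᵀ * Γ n = 1) (hSΓ : ∀ n, M.S pen n = Γ n * M.ΛS pen n * (Γ n)ᵀ)
    {K : ℝ} (hK : 0 < K) :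
    ∃ L : ℝ, 0 ≤ L ∧ ∀ᶠ n in atTop, ∀ᵐ ω ∂P, M.GramControl pen K n ω →
      SpikedGram (M.F n ω) (Fhat n ω) (M.S pen n) (Γ n) (fun k => eig (M.S pen n) k)
        (M.gram pen n ω) (M.perturbation pen n ω) c (L / Real.sqrt (M.T n)) := by
  obtain ⟨C, hC⟩ := hdim.T_le
  -- No sign is known for `C`, hence the maximum with `0`.
  set L : ℝ := K * (2 * Real.sqrt r * Real.sqrt (max C 0) + 1) with hL
  have hL0 : 0 ≤ L := by positivity
  have hlim : Tendsto (fun n => L / Real.sqrt (M.T n)) atTop (𝓝 0) :=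
    tendsto_const_nhds.div_atTop (Real.tendsto_sqrt_atTop.comp
      (tendsto_natCast_atTop_atTop.comp hdim.T_tendsto))
  refine ⟨L, hL0, ?_⟩
  filter_upwards [hC, hS, hdim.p_pos, hdim.T_pos, hlim.eventually_le_const (half_pos hc)]
    with n hTp hSn hp hT hsmall
  filter_upwards [gram_F hF hT, hFhat.normalized n, hFhat.eigenvectors n] with ω h1 h2 h3 hgood
  exact ⟨hT, h1, h2, M.gram_isHermitian pen n ω, h3, hΓ n, hSΓ n, hc, hSn.1, hSn.2,
    M.gram_eq pen n ω, frobNorm_perturbation_le hK (le_max_right _ _) hp hT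
      (hTp.trans (mul_le_mul_of_nonneg_right (le_max_left _ _) (Nat.cast_nonneg _))) h1 hgood,
    hsmall⟩

theorem tendsto_rate (hdim : M.DimensionRegime) (L : ℝ) :
    Tendsto (fun n => L / Real.sqrt (M.T n)) atTop (𝓝 0) :=
  tendsto_const_nhds.div_atTop (Real.tendsto_sqrt_atTop.comp
    (tendsto_natCast_atTop_atTop.comp hdim.T_tendsto))

theorem eventually_rot_gram (hdim : M.DimensionRegime) (hF : M.FactorConditions P)
    (hFhat : M.IsScoreEstimator P pen Fhat) (hc : 0 < c)
    (hS : ∀ᶠ n in atTop, (∀ k : Fin r, c ≤ eig (M.S pen n) k) ∧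
      ∀ k l : Fin r, k < l → c ≤ eig (M.S pen n) k - eig (M.S pen n) l)
    (hΓ : ∀ n, (Γ n)ᵀ * Γ n = 1) (hSΓ : ∀ n, M.S pen n = Γ n * M.ΛS pen n * (Γ n)ᵀ)
    {η : ℝ} (hη : 0 < η) (K : ℝ) (hK : 0 < K) :
    ∀ᶠ n in atTop, ∀ᵐ ω ∂P, M.GramControl pen K n ω →
      frobNorm ((M.H pen Fhat n ω)ᵀ * M.H pen Fhat n ω - 1) < η := by
  obtain ⟨L, -, hev⟩ := eventually_spikedGram hdim hF hFhat hc hS hΓ hSΓ hK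
  have hlim : Tendsto (fun n => (2 * Real.sqrt r + 2 / c * (L / Real.sqrt (M.T n) * Real.sqrt r)) *
      (2 / c * (L / Real.sqrt (M.T n) * Real.sqrt r))) atTop (𝓝 0) := by
    have h1 := ((tendsto_rate hdim L).mul_const (Real.sqrt r)).const_mul (2 / c)
    rw [zero_mul, mul_zero] at h1
    have := (h1.const_add (2 * Real.sqrt r)).mul h1
    rwa [mul_zero] at this
  filter_upwards [hev, hlim.eventually_lt_const hη] with n hn hsmall
  filter_upwards [hn] with ω hω hgood
  exact (hω hgood).frobNorm_rot_gram_sub.trans_lt hsmall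

end Spiked

end Model

/-- On a kernel vector `x` of `H` the form of `HᵀH - 1` equals `-‖x‖²`, which a norm below one
forbids unless `x = 0`. -/
theorem isUnit_of_gram_near_one {r : ℕ} {H : Matrix (Fin r) (Fin r) ℝ}
    (h : frobNorm (Hᵀ * H - 1) < 1) : IsUnit H := by
  rw [← Matrix.mulVec_injective_iff_isUnit]
  refine (injective_iff_map_eq_zero (Matrix.mulVecLin H)).2 fun x hx => ?_
  have h1 : x ⬝ᵥ ((Hᵀ * H - 1) *ᵥ x) = -(x ⬝ᵥ x) := by
    rw [Matrix.sub_mulVec, Matrix.one_mulVec, dotProduct_sub, ← dotProduct_mulVec_self,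
      show H *ᵥ x = 0 from hx, dotProduct_zero, zero_sub]
  have h2 := abs_dotProduct_mulVec_le (Hᵀ * H - 1) x
  have h3 : 0 ≤ x ⬝ᵥ x := Finset.sum_nonneg fun _ _ => mul_self_nonneg _
  rw [h1, abs_neg, abs_of_nonneg h3] at h2
  exact dotProduct_self_eq_zero.1 (le_antisymm (by nlinarith) h3)

namespace SpikedGram

variable {T : ℕ} {F Fh : Matrix (Fin T) (Fin r) ℝ} {S Γ : Matrix (Fin r) (Fin r) ℝ}
  {s : Fin r → ℝ} {G Δ : Matrix (Fin T) (Fin T) ℝ} {c δ : ℝ}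

theorem norm_inv_Λ_mulVec_le (h : SpikedGram F Fh S Γ s G Δ c δ) (v : Fin r → ℝ) :
    ‖WithLp.toLp 2 ((Matrix.diagonal fun k : Fin r => eig G k)⁻¹ *ᵥ v)‖ ≤
      2 / c * ‖WithLp.toLp 2 v‖ := by
  have hc : 0 ≤ 2 / c := div_nonneg two_pos.le h.c_pos.le
  have := frobNorm_mul_diagonal_le (Matrix.replicateCol Unit v)ᵀ hc h.inv_eig_le
  rw [h.inv_Λ, ← frobNorm_replicateCol, ← frobNorm_replicateCol, Matrix.replicateCol_mulVec,
    ← frobNorm_transpose, Matrix.transpose_mul, Matrix.diagonal_transpose]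
  rwa [frobNorm_transpose (Matrix.replicateCol Unit v)] at this

/-- `Fh` depends on the noise, so moments of `Fhᵀ v` are not accessible directly. Writing `Fh = F H
+ ρ` leaves `Fᵀ v`, whose moments are controlled by independence, and a term where `δ√T` is bounded
for `δ` of order `T^{-1/2}`. -/
theorem norm_Fh_mulVec_le (h : SpikedGram F Fh S Γ s G Δ c δ) (v : Fin T → ℝ) :
    ‖WithLp.toLp 2 (Fhᵀ *ᵥ v)‖ ≤ 2 * Real.sqrt r * ‖WithLp.toLp 2 (Fᵀ *ᵥ v)‖ +
      2 / c * (δ * (Real.sqrt T * Real.sqrt r)) * ‖WithLp.toLp 2 v‖ := by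
  set ρ := Fh - F * rot F Fh S G with hρ
  have hFh : Fhᵀ *ᵥ v = (rot F Fh S G)ᵀ *ᵥ (Fᵀ *ᵥ v) + ρᵀ *ᵥ v := by
    have : Fh = F * rot F Fh S G + ρ := by rw [hρ]; abel
    conv_lhs => rw [this]
    rw [Matrix.transpose_add, Matrix.add_mulVec, Matrix.transpose_mul, Matrix.mulVec_mulVec]
  rw [hFh, WithLp.toLp_add]
  refine (norm_add_le _ _).trans (add_le_add ?_ ?_)
  · refine (norm_toLp_mulVec_le _ _).trans ?_
    rw [frobNorm_transpose]
    exact mul_le_mul_of_nonneg_right h.frobNorm_rot_le (norm_nonneg _)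
  · refine (norm_toLp_mulVec_le _ _).trans ?_
    rw [frobNorm_transpose]
    exact mul_le_mul_of_nonneg_right h.frobNorm_sub_mul_rot (norm_nonneg _)

end SpikedGram

end Assembly

end NetFactor

namespace NetFactor

/-! ### Invertibility of `H` and expansion of the estimation error. -/

section ScoreError

variable {r : ℕ} {Ω : Type*} [MeasurableSpace Ω] {P : Measure Ω}

theorem SpikedGram.row_error {T : ℕ} {F Fh : Matrix (Fin T) (Fin r) ℝ}
    {S Γ : Matrix (Fin r) (Fin r) ℝ} {s : Fin r → ℝ} {G Δ : Matrix (Fin T) (Fin T) ℝ} {c δ : ℝ}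
    (h : SpikedGram F Fh S Γ s G Δ c δ) (t : Fin T) :
    Fh t - (rot F Fh S G)ᵀ *ᵥ F t =
      (Matrix.diagonal fun k : Fin r => eig G k)⁻¹ *ᵥ (Fhᵀ *ᵥ Δ t) := by
  have h1 := congrFun h.sub_mul_rot t
  have h2 : (F * rot F Fh S G) t = (rot F Fh S G)ᵀ *ᵥ F t := by
    rw [Matrix.mulVec_transpose]; rfl
  have h3 : (Δ * Fh * (Matrix.diagonal fun k : Fin r => eig G k)⁻¹) t =
      ((Matrix.diagonal fun k : Fin r => eig G k)⁻¹)ᵀ *ᵥ (Fhᵀ *ᵥ Δ t) := by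
    rw [Matrix.mulVec_transpose, Matrix.mulVec_transpose]; rfl
  have h4 : ((Matrix.diagonal fun k : Fin r => eig G k)⁻¹)ᵀ =
      (Matrix.diagonal fun k : Fin r => eig G k)⁻¹ := by
    rw [Matrix.transpose_nonsing_inv, Matrix.diagonal_transpose]
  rw [h4] at h3
  rw [← h2, ← h3, ← h1]
  rfl

namespace Model

variable {M : Model r Ω} {pen : Penalty} {Fhat : ∀ n, Ω → Matrix (Fin (M.T n)) (Fin r) ℝ}
  {Γ : ℕ → Matrix (Fin r) (Fin r) ℝ} {c : ℝ}

theorem tendsto_measure_not_isUnit_H [IsProbabilityMeasure P] (hdim : M.DimensionRegime)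
    (hF : M.FactorConditions P) (hFhat : M.IsScoreEstimator P pen Fhat) (hc : 0 < c)
    (hS : ∀ᶠ n in atTop, (∀ k : Fin r, c ≤ eig (M.S pen n) k) ∧
      ∀ k l : Fin r, k < l → c ≤ eig (M.S pen n) k - eig (M.S pen n) l)
    (hΓ : ∀ n, (Γ n)ᵀ * Γ n = 1) (hSΓ : ∀ n, M.S pen n = Γ n * M.ΛS pen n * (Γ n)ᵀ)
    {κ : ℝ} (h : M.Bounded P pen κ) :
    Tendsto (fun n => P {ω | ¬ IsUnit (M.H pen Fhat n ω)}) atTop (𝓝 0) := by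
  refine tendsto_measure_zero_of_tight (exists_gramControl h hdim) fun K hK => ?_
  filter_upwards [eventually_rot_gram hdim hF hFhat hc hS hΓ hSΓ one_pos K hK] with n hn
  filter_upwards [hn] with ω hω hgood
  exact not_not.2 (isUnit_of_gram_near_one (hω hgood))

theorem tendstoInMeasure_H_gram [IsProbabilityMeasure P] (hdim : M.DimensionRegime)
    (hF : M.FactorConditions P) (hFhat : M.IsScoreEstimator P pen Fhat) (hc : 0 < c)
    (hS : ∀ᶠ n in atTop, (∀ k : Fin r, c ≤ eig (M.S pen n) k) ∧
      ∀ k l : Fin r, k < l → c ≤ eig (M.S pen n) k - eig (M.S pen n) l)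
    (hΓ : ∀ n, (Γ n)ᵀ * Γ n = 1) (hSΓ : ∀ n, M.S pen n = Γ n * M.ΛS pen n * (Γ n)ᵀ)
    {κ : ℝ} (h : M.Bounded P pen κ) (k l : Fin r) :
    TendstoInMeasure P (fun n ω => ((M.H pen Fhat n ω)ᵀ * M.H pen Fhat n ω) k l) atTop
      (fun _ => (1 : Matrix (Fin r) (Fin r) ℝ) k l) := by
  rw [tendstoInMeasure_iff_norm]
  intro η hη
  refine tendsto_measure_zero_of_tight (exists_gramControl h hdim) fun K hK => ?_
  filter_upwards [eventually_rot_gram hdim hF hFhat hc hS hΓ hSΓ hη K hK] with n hn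
  filter_upwards [hn] with ω hω hgood
  exact not_le.2 ((abs_le_frobNorm _ k l).trans_lt (hω hgood))

/-- The part of the scaled estimation error which is linear in the score. -/
noncomputable def leadingError (M : Model r Ω) (pen : Penalty)
    (Fhat : ∀ n, Ω → Matrix (Fin (M.T n)) (Fin r) ℝ) (t : ∀ n, Fin (M.T n)) (n : ℕ) (ω : Ω) :
    Fin r → ℝ :=
  (M.Λr pen n ω)⁻¹ *ᵥ (((M.T n : ℝ)⁻¹ • ((M.F n ω)ᵀ * Fhat n ω))ᵀ *ᵥ
    ((Real.sqrt (M.p n))⁻¹ • M.score pen n (t n) ω))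

theorem norm_remainder_le {t : ∀ n, Fin (M.T n)} {n : ℕ} {ω : Ω} {K L : ℝ} (hL : 0 ≤ L)
    (hp : 0 < M.p n) (hK : 0 < K)
    (hgood : M.ErrorControl pen t K n ω)
    (h : SpikedGram (M.F n ω) (Fhat n ω) (M.S pen n) (Γ n) (fun k => eig (M.S pen n) k)
        (M.gram pen n ω) (M.perturbation pen n ω) c (L / Real.sqrt (M.T n))) :
    ‖Real.sqrt (M.p n) • M.scoreError pen Fhat t n ω -
        WithLp.toLp 2 (M.leadingError pen Fhat t n ω)‖ ≤
      2 / c * (2 * Real.sqrt r + 2 / c * (L * Real.sqrt r)) *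
        (K ^ 2 / Real.sqrt (M.T n) + K * (frobNorm (M.D pen n)⁻¹ / M.T n)) := by
  have hp' : (0 : ℝ) < M.p n := Nat.cast_pos.2 hp
  have hT' := h.T_pos'
  have hc := h.c_pos
  set F := M.F n ω with hFdef
  set N := M.noiseLoad pen n ω with hN
  set ce := M.crossError pen n (t n) ω with hce
  set sc := M.score pen n (t n) ω with hsc
  have h1 := hgood.noiseLoad_le
  have h2 := hgood.factor_noiseLoad_le
  have h3 := hgood.crossError_le
  have h4 := hgood.factor_crossError_le
  have h5 := hgood.factor_le
  rw [Real.sqrt_mul hT'.le] at h1 h2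
  set a := Real.sqrt (M.T n) with ha
  set b := Real.sqrt (M.p n) with hb
  set w := frobNorm (M.D pen n)⁻¹ with hw
  have ha0 : 0 < a := Real.sqrt_pos.2 hT'
  have hb0 : 0 < b := Real.sqrt_pos.2 hp'
  have haa : a * a = M.T n := Real.mul_self_sqrt hT'.le
  have hbb : b * b = M.p n := Real.mul_self_sqrt hp'.le
  have hw0 : 0 ≤ w := frobNorm_nonneg _
  -- Of the three terms in row `t` of the perturbation, the one with the score is exactly
  -- `leadingError`; the noise loadings times `F_t` and the cross error remain.
  have hdiff : b • M.scoreError pen Fhat t n ω - WithLp.toLp 2 (M.leadingError pen Fhat t n ω) =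
      (b * (M.T n : ℝ))⁻¹ • WithLp.toLp 2 ((M.Λr pen n ω)⁻¹ *ᵥ ((Fhat n ω)ᵀ *ᵥ
        (N *ᵥ F (t n) + ce))) := by
    have e1 : M.scoreError pen Fhat t n ω = WithLp.toLp 2 ((M.Λr pen n ω)⁻¹ *ᵥ
        ((Fhat n ω)ᵀ *ᵥ M.perturbation pen n ω (t n))) :=
      congrArg (WithLp.toLp 2) (h.row_error (t n))
    rw [e1, perturbation_row, leadingError, ← WithLp.toLp_smul, ← WithLp.toLp_smul,
      ← WithLp.toLp_sub]
    congr 1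
    simp only [Matrix.mulVec_smul, Matrix.mulVec_add, Matrix.transpose_smul, Matrix.smul_mulVec,
      Matrix.transpose_mul, Matrix.transpose_transpose, ← Matrix.mulVec_mulVec, smul_add,
      smul_smul, ← hFdef, ← hN, ← hce, ← hsc]
    rw [show b * ((M.p n : ℝ) * M.T n)⁻¹ = (b * (M.T n : ℝ))⁻¹ by
      rw [← hbb]; field_simp, show (b : ℝ)⁻¹ * (M.T n : ℝ)⁻¹ = (b * (M.T n : ℝ))⁻¹ by
      rw [mul_inv]]
    abel
  have hNf : ‖WithLp.toLp 2 (N *ᵥ F (t n))‖ ≤ K * (a * b) * (K * 1) :=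
    (norm_toLp_mulVec_le _ _).trans (mul_le_mul h1 h5 (norm_nonneg _) (by positivity))
  have hFNf : ‖WithLp.toLp 2 (Fᵀ *ᵥ (N *ᵥ F (t n)))‖ ≤ K * (a * b) * (K * 1) := by
    rw [Matrix.mulVec_mulVec]
    exact (norm_toLp_mulVec_le _ _).trans (mul_le_mul h2 h5 (norm_nonneg _) (by positivity))
  have hv1 : ‖WithLp.toLp 2 (N *ᵥ F (t n) + ce)‖ ≤ K * (a * b) * (K * 1) + K * (b * w) := by
    rw [WithLp.toLp_add]
    exact (norm_add_le _ _).trans (add_le_add hNf h3)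
  have hv2 : ‖WithLp.toLp 2 (Fᵀ *ᵥ (N *ᵥ F (t n) + ce))‖ ≤
      K * (a * b) * (K * 1) + K * (b * w) := by
    rw [Matrix.mulVec_add, WithLp.toLp_add]
    exact (norm_add_le _ _).trans (add_le_add hFNf h4)
  have h6 := (h.norm_inv_Λ_mulVec_le ((Fhat n ω)ᵀ *ᵥ (N *ᵥ F (t n) + ce)))
  have h7 := h.norm_Fh_mulVec_le (N *ᵥ F (t n) + ce)
  rw [hdiff, norm_smul, Real.norm_of_nonneg (by positivity)]
  -- The rate `δ = L / √T` cancels the factor `√T` of `‖Fhat‖`, so both terms of `norm_Fh_mulVec_le`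
  -- have the same order.
  calc _ ≤ (b * (M.T n : ℝ))⁻¹ * (2 / c * (2 * Real.sqrt r * (K * (a * b) * (K * 1) + K * (b * w)) +
        2 / c * (L / a * (a * Real.sqrt r)) * (K * (a * b) * (K * 1) + K * (b * w)))) := by
        refine mul_le_mul_of_nonneg_left (h6.trans ?_) (by positivity)
        refine mul_le_mul_of_nonneg_left (h7.trans ?_) (by positivity)
        gcongr
    _ = _ := by
        rw [← haa]
        field_simp

end Model

end ScoreError

end NetFactor

namespace NetFactor

/-! ### Linearization of the error and its rate. -/

section Limits

variable {r : ℕ} {Ω : Type*} [MeasurableSpace Ω] {P : Measure Ω}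

namespace Model

variable {M : Model r Ω} {pen : Penalty} {Fhat : ∀ n, Ω → Matrix (Fin (M.T n)) (Fin r) ℝ}
  {Γ : ℕ → Matrix (Fin r) (Fin r) ℝ} {c : ℝ}

theorem norm_scaled_score_le {t : ∀ n, Fin (M.T n)} {n : ℕ} {ω : Ω} {K : ℝ} (hp : 0 < M.p n)
    (hgood : M.ErrorControl pen t K n ω) :
    ‖WithLp.toLp 2 ((Real.sqrt (M.p n))⁻¹ • M.score pen n (t n) ω)‖ ≤ K := by
  have hb : 0 < Real.sqrt (M.p n) := Real.sqrt_pos.2 (Nat.cast_pos.2 hp)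
  rw [WithLp.toLp_smul, norm_smul, Real.norm_of_nonneg (inv_nonneg.2 hb.le),
    inv_mul_le_iff₀ hb, mul_comm]
  exact hgood.score_le

theorem norm_leadingError_le {t : ∀ n, Fin (M.T n)} {n : ℕ} {ω : Ω} {K δ : ℝ}
    (hp : 0 < M.p n) (hgood : M.ErrorControl pen t K n ω)
    (h : SpikedGram (M.F n ω) (Fhat n ω) (M.S pen n) (Γ n) (fun k => eig (M.S pen n) k)
        (M.gram pen n ω) (M.perturbation pen n ω) c δ) :
    ‖WithLp.toLp 2 (M.leadingError pen Fhat t n ω)‖ ≤ 2 / c * (r * K) := by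
  have hc := h.c_pos
  have hT := h.T_pos'
  refine (h.norm_inv_Λ_mulVec_le _).trans (mul_le_mul_of_nonneg_left ?_ (by positivity))
  refine (norm_toLp_mulVec_le _ _).trans (mul_le_mul ?_ (norm_scaled_score_le hp hgood)
    (norm_nonneg _) (Nat.cast_nonneg _))
  rw [frobNorm_transpose, frobNorm_smul, abs_of_pos (inv_pos.2 hT), inv_mul_le_iff₀ hT]
  refine (frobNorm_mul_le _ _).trans (le_of_eq ?_)
  rw [frobNorm_transpose, h.frobNorm_F, h.frobNorm_Fh, mul_mul_mul_comm,
    Real.mul_self_sqrt hT.le, Real.mul_self_sqrt (Nat.cast_nonneg _)]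

/-- Inserting `Γ Γᵀ = 1` turns the difference of the two matrices into the alignment error times
`Γᵀ`, while the scaled score is bounded on the good event. -/
theorem norm_leadingError_sub_le {t : ∀ n, Fin (M.T n)} {n : ℕ} {ω : Ω} {K δ : ℝ}
    (hp : 0 < M.p n) (hgood : M.ErrorControl pen t K n ω)
    (h : SpikedGram (M.F n ω) (Fhat n ω) (M.S pen n) (Γ n) (fun k => eig (M.S pen n) k)
        (M.gram pen n ω) (M.perturbation pen n ω) c δ)
    (hsign : ∀ k : Fin r, 0 ≤ ((Γ n)ᵀ * (M.F n ω)ᵀ * Fhat n ω) k k) :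
    ‖WithLp.toLp 2 (M.leadingError pen Fhat t n ω) - WithLp.toLp 2
      (((M.ΛS pen n)⁻¹ * (Γ n)ᵀ) *ᵥ ((Real.sqrt (M.p n))⁻¹ • M.score pen n (t n) ω))‖ ≤
      SpikedGram.alignConst r c * δ * Real.sqrt r * K := by
  set z := (Real.sqrt (M.p n))⁻¹ • M.score pen n (t n) ω with hz
  have hA := h.frobNorm_align_le hsign
  have e : M.leadingError pen Fhat t n ω - ((M.ΛS pen n)⁻¹ * (Γ n)ᵀ) *ᵥ z =
      (((M.Λr pen n ω)⁻¹ * ((M.T n : ℝ)⁻¹ • ((M.F n ω)ᵀ * Fhat n ω))ᵀ * Γ n -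
        (M.ΛS pen n)⁻¹) * (Γ n)ᵀ) *ᵥ z := by
    rw [Matrix.sub_mul, Matrix.mul_assoc _ (Γ n) (Γ n)ᵀ, h.orthogonal', Matrix.mul_one,
      Matrix.sub_mulVec, leadingError, Matrix.mulVec_mulVec]
  have hΓn : frobNorm (Γ n)ᵀ = Real.sqrt r := by
    have := frobNorm_eq_of_gram (A := Γ n) (c := 1) (by rw [h.orthogonal, one_smul])
    rw [frobNorm_transpose, this, one_mul, Fintype.card_fin]
  rw [← WithLp.toLp_sub, e]
  refine (norm_toLp_mulVec_le _ _).trans (mul_le_mul ?_ (norm_scaled_score_le hp hgood)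
    (norm_nonneg _) ?_)
  · refine (frobNorm_mul_le _ _).trans ?_
    rw [hΓn]
    exact mul_le_mul_of_nonneg_right hA (Real.sqrt_nonneg _)
  · exact mul_nonneg ((frobNorm_nonneg _).trans hA) (Real.sqrt_nonneg _)

theorem tendstoInMeasure_scoreError [IsProbabilityMeasure P] (hdim : M.DimensionRegime)
    (hF : M.FactorConditions P) (hE : M.ErrorConditions P)
    (hFhat : M.IsScoreEstimator P pen Fhat) (hc : 0 < c)
    (hS : ∀ᶠ n in atTop, (∀ k : Fin r, c ≤ eig (M.S pen n) k) ∧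
      ∀ k l : Fin r, k < l → c ≤ eig (M.S pen n) k - eig (M.S pen n) l)
    (hΓ : ∀ n, (Γ n)ᵀ * Γ n = 1) (hSΓ : ∀ n, M.S pen n = Γ n * M.ΛS pen n * (Γ n)ᵀ)
    {κ : ℝ} (h : M.Bounded P pen κ) (t : ∀ n, Fin (M.T n))
    (hw : Tendsto (fun n => frobNorm (M.D pen n)⁻¹ / M.T n) atTop (𝓝 0))
    (hsign : ∀ n, ∀ᵐ ω ∂P, ∀ k : Fin r, 0 ≤ ((Γ n)ᵀ * (M.F n ω)ᵀ * Fhat n ω) k k) :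
    TendstoInMeasure P (fun n ω => Real.sqrt (M.p n) • M.scoreError pen Fhat t n ω -
      Matrix.toEuclideanCLM (𝕜 := ℝ) ((M.ΛS pen n)⁻¹ * (Γ n)ᵀ)
        (WithLp.toLp 2 ((Real.sqrt (M.p n))⁻¹ • M.score pen n (t n) ω))) atTop
      (fun _ => 0) := by
  rw [tendstoInMeasure_iff_norm]
  intro η hη
  refine tendsto_measure_zero_of_tight (exists_errorControl h hdim hF hE t) fun K hK => ?_
  obtain ⟨L, hL, hev⟩ := eventually_spikedGram hdim hF hFhat hc hS hΓ hSΓ hK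
  have hlim : Tendsto (fun n => 2 / c * (2 * Real.sqrt r + 2 / c * (L * Real.sqrt r)) *
        (K ^ 2 / Real.sqrt (M.T n) + K * (frobNorm (M.D pen n)⁻¹ / M.T n)) +
        SpikedGram.alignConst r c * (L / Real.sqrt (M.T n)) * Real.sqrt r * K) atTop (𝓝 0) := by
    have h1 := ((tendsto_rate hdim (K ^ 2)).add (hw.const_mul K)).const_mul
      (2 / c * (2 * Real.sqrt r + 2 / c * (L * Real.sqrt r)))
    have h2 := (((tendsto_rate hdim L).const_mul (SpikedGram.alignConst r c)).mul_const
      (Real.sqrt r)).mul_const K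
    simpa using h1.add h2
  filter_upwards [hev, hlim.eventually_lt_const hη, hdim.p_pos] with n hn hsmall hp
  filter_upwards [hn, hsign n] with ω hω hsω hgood
  have hsp := hω hgood.toGramControl
  refine not_le.2 (lt_of_le_of_lt ?_ hsmall)
  rw [sub_zero, Matrix.toEuclideanCLM_toLp]
  exact (norm_sub_le_norm_sub_add_norm_sub _
    (WithLp.toLp 2 (M.leadingError pen Fhat t n ω)) _).trans
    (add_le_add (norm_remainder_le hL hp hK hgood hsp)
      (norm_leadingError_sub_le hp hgood hsp hsω))

theorem isBigOP_scoreError [IsProbabilityMeasure P] (hdim : M.DimensionRegime)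
    (hF : M.FactorConditions P) (hE : M.ErrorConditions P)
    (hFhat : M.IsScoreEstimator P pen Fhat) (hc : 0 < c)
    (hS : ∀ᶠ n in atTop, (∀ k : Fin r, c ≤ eig (M.S pen n) k) ∧
      ∀ k l : Fin r, k < l → c ≤ eig (M.S pen n) k - eig (M.S pen n) l)
    (hΓ : ∀ n, (Γ n)ᵀ * Γ n = 1) (hSΓ : ∀ n, M.S pen n = Γ n * M.ΛS pen n * (Γ n)ᵀ)
    {κ : ℝ} (h : M.Bounded P pen κ) (t : ∀ n, Fin (M.T n)) {w₀ : ℝ} (hw₀ : 0 < w₀)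
    (hw : ∀ᶠ n in atTop, w₀ ≤ frobNorm (M.D pen n)⁻¹ / M.T n) :
    IsBigOP P (M.scoreError pen Fhat t)
      (fun n => frobNorm (M.D pen n)⁻¹ / (M.T n * Real.sqrt (M.p n))) := by
  intro ε hε
  obtain ⟨K, hK, hgood⟩ := exists_errorControl h hdim hF hE t ε hε
  obtain ⟨L, hL, hev⟩ := eventually_spikedGram hdim hF hFhat hc hS hΓ hSΓ hK
  set C := 2 / c * (2 * Real.sqrt r + 2 / c * (L * Real.sqrt r)) with hC
  have hC0 : 0 ≤ C := by positivity
  -- The leading term and the `K²/√T` part of the remainder are only bounded; since `1 ≤ q / w₀`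
  -- with `q = ‖D⁻¹‖_F / T`, they are absorbed into multiples of `q`, whence the divisions by `w₀`.
  refine ⟨C * (K ^ 2 / w₀ + K) + 2 / c * (r * K) / w₀, ?_⟩
  filter_upwards [hgood, hev, hw, hdim.p_pos, hdim.T_pos] with n hgn hn hwn hp hT
  refine le_trans (measure_mono_ae ?_) hgn
  filter_upwards [hn] with ω hω hlarge hctl
  have hsp := hω hctl.toGramControl
  have hb : 0 < Real.sqrt (M.p n) := Real.sqrt_pos.2 (Nat.cast_pos.2 hp)
  have ha : 1 ≤ Real.sqrt (M.T n) := Real.one_le_sqrt.2 (by exact_mod_cast hT)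
  have h1 := norm_remainder_le hL hp hK hctl hsp
  have h2 := norm_leadingError_le hp hctl hsp
  have h3 := norm_le_norm_sub_add (Real.sqrt (M.p n) • M.scoreError pen Fhat t n ω)
    (WithLp.toLp 2 (M.leadingError pen Fhat t n ω))
  rw [norm_smul, Real.norm_of_nonneg hb.le] at h3
  refine absurd (hlarge : _ < _) (not_lt.2 ?_)
  set q := frobNorm (M.D pen n)⁻¹ / M.T n with hq
  have hq1 : 1 ≤ q / w₀ := (one_le_div hw₀).2 hwn
  rw [← div_div, mul_div_assoc', le_div_iff₀ hb, mul_comm]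
  refine h3.trans ((add_le_add h1 h2).trans ?_)
  have e1 : K ^ 2 / Real.sqrt (M.T n) ≤ K ^ 2 * (q / w₀) :=
    (div_le_self (sq_nonneg K) ha).trans (le_mul_of_one_le_right (sq_nonneg K) hq1)
  have e2 : 2 / c * (r * K) ≤ 2 / c * (r * K) * (q / w₀) :=
    le_mul_of_one_le_right (by positivity) hq1
  calc _ ≤ C * (K ^ 2 * (q / w₀) + K * q) + 2 / c * (r * K) * (q / w₀) := by gcongr
    _ = _ := by ring

end Model

end Limits

end NetFactor

namespace NetFactor

/-! ### Measurability of the error, and the limiting covariance. -/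

section Covariance

variable {r : ℕ} {Ω : Type*} [MeasurableSpace Ω] {P : Measure Ω}

theorem measurable_inv_diagonal_apply {m : ℕ} {d : Ω → Fin m → ℝ}
    (hd : ∀ k, Measurable fun ω => d ω k) (i j : Fin m) :
    Measurable fun ω => (Matrix.diagonal (d ω))⁻¹ i j := by
  classical
  -- The matrix inverse is zero as soon as one diagonal entry vanishes, so the entry is a case
  -- distinction and not simply a reciprocal.
  have e : (fun ω => (Matrix.diagonal (d ω))⁻¹ i j) = fun ω =>
      if ∀ k, d ω k ≠ 0 then (if i = j then (d ω i)⁻¹ else 0) else 0 := by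
    funext ω
    split_ifs with h1 h2
    · rw [inv_diagonal_of_ne_zero h1, h2, Matrix.diagonal_apply_eq, ← h2]
    · rw [inv_diagonal_of_ne_zero h1, Matrix.diagonal_apply_ne _ h2]
    · rw [Matrix.nonsing_inv_apply_not_isUnit, Matrix.zero_apply]
      rw [Matrix.det_diagonal, isUnit_iff_ne_zero, Finset.prod_ne_zero_iff]
      simpa using h1
  rw [e]
  refine Measurable.ite ?_ (Measurable.ite (MeasurableSet.const _) (hd i).inv measurable_const)
    measurable_const
  rw [Set.ofPred_forall]
  exact MeasurableSet.iInter fun k => (hd k (measurableSet_singleton 0)).compl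

namespace Model

variable {M : Model r Ω} {pen : Penalty} {Fhat : ∀ n, Ω → Matrix (Fin (M.T n)) (Fin r) ℝ}

/-- Rayleigh quotients express the eigenvalues as polynomials in measurable entries, so that
measurability of `eig` never has to be discussed. -/
theorem IsScoreEstimator.diagonal_eq (hFhat : M.IsScoreEstimator P pen Fhat) {n : ℕ}
    (hT : 0 < M.T n) : ∀ᵐ ω ∂P, M.Λr pen n ω = Matrix.diagonal fun k =>
      (M.T n : ℝ)⁻¹ * ((Fhat n ω)ᵀ * (M.gram pen n ω * Fhat n ω)) k k := by
  filter_upwards [hFhat.normalized n, hFhat.eigenvectors n] with ω h1 h2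
  have hT' : (M.T n : ℝ) ≠ 0 := Nat.cast_ne_zero.2 hT.ne'
  have e : (Fhat n ω)ᵀ * (M.gram pen n ω * Fhat n ω) = (M.T n : ℝ) • M.Λr pen n ω := by
    rw [h2, ← Matrix.mul_assoc, h1, Matrix.smul_mul, Matrix.one_mul]
  rw [e]
  conv_lhs => rw [Λr]
  congr 1
  funext k
  rw [Matrix.smul_apply, Λr, Matrix.diagonal_apply_eq, smul_eq_mul, inv_mul_cancel_left₀ hT']

theorem measurable_gram (M : Model r Ω) (pen : Penalty) (n : ℕ) (i j : Fin (M.T n)) :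
    Measurable fun ω => M.gram pen n ω i j := by
  have hX : ∀ i j, Measurable fun ω => M.X n ω i j := fun i j =>
    (measurable_mul_apply (B := fun _ => (M.B n)ᵀ) (M.measurable_F n)
      (fun _ _ => measurable_const) i j).add (M.measurable_E n i j)
  simp only [gram, Matrix.smul_apply, smul_eq_mul]
  exact (measurable_mul_apply (B := fun ω => (M.X n ω)ᵀ) (measurable_mul_apply
    (B := fun _ => (M.D pen n)⁻¹) hX fun _ _ => measurable_const) (fun k l => hX l k) i j).const_mul _

theorem IsScoreEstimator.aemeasurable_scoreError (hFhat : M.IsScoreEstimator P pen Fhat)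
    (t : ∀ n, Fin (M.T n)) (n : ℕ) : AEMeasurable (M.scoreError pen Fhat t n) P := by
  set Λ : Ω → Matrix (Fin r) (Fin r) ℝ := fun ω => Matrix.diagonal fun k =>
      (M.T n : ℝ)⁻¹ * ((Fhat n ω)ᵀ * (M.gram pen n ω * Fhat n ω)) k k with hΛ
  have hΛm : ∀ i j, Measurable fun ω => (Λ ω)⁻¹ i j :=
    measurable_inv_diagonal_apply fun k => (measurable_mul_apply
      (fun i j => hFhat.measurable n j i) (measurable_mul_apply (M.measurable_gram pen n)
        (hFhat.measurable n)) k k).const_mul _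
  have hH : ∀ i j, Measurable fun ω => (M.S pen n *
      ((M.T n : ℝ)⁻¹ • ((M.F n ω)ᵀ * Fhat n ω)) * (Λ ω)⁻¹) i j := by
    refine measurable_mul_apply (measurable_mul_apply (A := fun _ => M.S pen n)
      (fun _ _ => measurable_const) fun i j => ?_) hΛm
    simp only [Matrix.smul_apply, smul_eq_mul]
    exact (measurable_mul_apply (A := fun ω => (M.F n ω)ᵀ) (fun i j => M.measurable_F n j i)
      (hFhat.measurable n) i j).const_mul _
  refine ⟨fun ω => WithLp.toLp 2 (Fhat n ω (t n) - (M.S pen n *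
      ((M.T n : ℝ)⁻¹ • ((M.F n ω)ᵀ * Fhat n ω)) * (Λ ω)⁻¹)ᵀ *ᵥ M.F n ω (t n)), ?_, ?_⟩
  · refine (WithLp.measurable_toLp 2 _).comp (measurable_pi_iff.2 fun k => ?_)
    simp only [Pi.sub_apply, Matrix.mulVec, dotProduct, Matrix.transpose_apply]
    exact (hFhat.measurable n (t n) k).sub (Finset.measurable_sum _ fun l _ =>
      (hH l k).mul (M.measurable_F n (t n) l))
  · filter_upwards [hFhat.diagonal_eq (n := n) (t n).pos] with ω hω
    rw [scoreError, H, hω]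

theorem score_apply (M : Model r Ω) (pen : Penalty) (n : ℕ) (t : Fin (M.T n)) (ω : Ω)
    (k : Fin r) : M.score pen n t ω k = ∑ i : Fin (M.T n) × Fin (M.p n),
      M.P₁ n t i.1 * (M.P₂ n * (M.D pen n)⁻¹ * M.B n) i.2 k * M.eps n ω i.1 i.2 := by
  have h : (M.B n)ᵀ * (M.D pen n)⁻¹ * (M.P₂ n)ᵀ = (M.P₂ n * (M.D pen n)⁻¹ * M.B n)ᵀ := by
    rw [Matrix.transpose_mul, Matrix.transpose_mul, M.inv_D_transpose, Matrix.mul_assoc]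
  rw [score, E_row, Matrix.mulVec_mulVec, h, Fintype.sum_prod_type, Finset.sum_comm]
  simp only [Matrix.mulVec, dotProduct, Matrix.transpose_apply, Finset.mul_sum]
  exact Finset.sum_congr rfl fun j _ => Finset.sum_congr rfl fun s _ => by ring

/-- The score is linear in the noise with coefficients that are products of an entry of row `t` of
`P₁` and an entry of `P₂ D⁻¹ B`, so the covariance sum factors. -/
theorem Bounded.covariance_score [IsProbabilityMeasure P] {κ : ℝ} (h : M.Bounded P pen κ) (n : ℕ)
    (t : Fin (M.T n)) :
    (Matrix.of fun k l : Fin r => covariance (fun ω => M.score pen n t ω k)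
      (fun ω => M.score pen n t ω l) P) = (∑ s, M.P₁ n t s ^ 2) •
        ((M.B n)ᵀ * (M.D pen n)⁻¹ * (M.P₂ n)ᵀ * M.P₂ n * (M.D pen n)⁻¹ * M.B n) := by
  have hN : (M.B n)ᵀ * (M.D pen n)⁻¹ * (M.P₂ n)ᵀ * M.P₂ n * (M.D pen n)⁻¹ * M.B n =
      (M.P₂ n * (M.D pen n)⁻¹ * M.B n)ᵀ * (M.P₂ n * (M.D pen n)⁻¹ * M.B n) := by
    simp only [Matrix.transpose_mul, M.inv_D_transpose, Matrix.mul_assoc]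
  have hno := h.noise n
  rw [hN]
  ext k l
  have hL := hno.memLp_linear Finset.univ
  have hI := hno.integral_linear Finset.univ
  simp only [Matrix.of_apply, score_apply]
  rw [covariance_eq_sub (hL _) (hL _), hI, zero_mul, sub_zero]
  refine (hno.integral_linear_mul Finset.univ _ _).trans ?_
  rw [Matrix.smul_apply, Matrix.mul_apply, smul_eq_mul, Finset.sum_mul_sum, ← Finset.sum_product']
  exact Finset.sum_congr rfl fun i _ => by rw [Matrix.transpose_apply]; ring

theorem ScoreCLT.tendsto_covariance [IsProbabilityMeasure P] {κ : ℝ} (h : M.Bounded P pen κ)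
    {t : ∀ n, Fin (M.T n)} {V : Matrix (Fin r) (Fin r) ℝ} (hV : M.ScoreCLT P pen t V) :
    Tendsto (fun n => (∑ s, M.P₁ n (t n) s ^ 2) • ((M.p n : ℝ)⁻¹ •
      ((M.B n)ᵀ * (M.D pen n)⁻¹ * (M.P₂ n)ᵀ * M.P₂ n * (M.D pen n)⁻¹ * M.B n))) atTop (𝓝 V) := by
  refine hV.cov.congr fun n => ?_
  rw [h.covariance_score, smul_comm]

/-- `V` is a limit of covariance matrices, and positive semidefiniteness is a closed condition. It
is required for the characteristic function of `N(0, V)`. -/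
theorem ScoreCLT.posSemidef [IsProbabilityMeasure P] {κ : ℝ} (h : M.Bounded P pen κ)
    {t : ∀ n, Fin (M.T n)} {V : Matrix (Fin r) (Fin r) ℝ} (hV : M.ScoreCLT P pen t V) :
    V.PosSemidef := by
  have hpsd : ∀ n, ((∑ s, M.P₁ n (t n) s ^ 2) • ((M.p n : ℝ)⁻¹ •
      ((M.B n)ᵀ * (M.D pen n)⁻¹ * (M.P₂ n)ᵀ * M.P₂ n * (M.D pen n)⁻¹ * M.B n))).PosSemidef := by
    intro n
    have hN : (M.B n)ᵀ * (M.D pen n)⁻¹ * (M.P₂ n)ᵀ * M.P₂ n * (M.D pen n)⁻¹ * M.B n =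
        (M.P₂ n * (M.D pen n)⁻¹ * M.B n)ᴴ * (M.P₂ n * (M.D pen n)⁻¹ * M.B n) := by
      rw [Matrix.conjTranspose_eq_transpose_of_trivial]
      simp only [Matrix.transpose_mul, M.inv_D_transpose, Matrix.mul_assoc]
    rw [hN]
    exact ((Matrix.posSemidef_conjTranspose_mul_self _).smul (by positivity)).smul
      (Finset.sum_nonneg fun _ _ => sq_nonneg _)
  have hlim := hV.tendsto_covariance h
  refine Matrix.PosSemidef.of_dotProduct_mulVec_nonneg ?_ fun x => ?_
  · have h1 := (continuous_id.matrix_conjTranspose.tendsto V).comp hlim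
    exact tendsto_nhds_unique h1 (hlim.congr fun n => (hpsd n).isHermitian.symm)
  · have hc : Continuous fun A : Matrix (Fin r) (Fin r) ℝ => star x ⬝ᵥ (A *ᵥ x) :=
      continuous_const.dotProduct (continuous_id.matrix_mulVec continuous_const)
    exact ge_of_tendsto' ((hc.tendsto V).comp hlim) fun n => (hpsd n).dotProduct_mulVec_nonneg x

theorem ErrorConditions.exists_pos_le_row (hE : M.ErrorConditions P) :
    ∃ c : ℝ, 0 < c ∧ ∀ n (t : Fin (M.T n)), c ≤ ∑ s, M.P₁ n t s ^ 2 := by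
  obtain ⟨c₁, c₂, -, hc₂, hspec⟩ := hE.spectra
  refine ⟨c₂, hc₂, fun n t => ?_⟩
  have := le_transpose_mulVec hc₂ (fun x => (mulVec_sq_bounds (hspec n).1 x).1) (Pi.single t 1)
  rw [Matrix.mulVec_single_one, single_one_dotProduct, Pi.single_eq_same, mul_one] at this
  simpa [dotProduct, pow_two] using this

/-- The spectral lower bound on `P₁ᵀ P₁` keeps the squared row norms, and hence `ρ`, away from zero,
so one can divide by them. -/
theorem ScoreCLT.exists_tendsto [IsProbabilityMeasure P] {κ : ℝ} (h : M.Bounded P pen κ)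
    (hE : M.ErrorConditions P)
    {t : ∀ n, Fin (M.T n)} {V : Matrix (Fin r) (Fin r) ℝ} (hV : M.ScoreCLT P pen t V) {ρ : ℝ}
    (hρ : Tendsto (fun n => ∑ s, M.P₁ n (t n) s ^ 2) atTop (𝓝 ρ)) :
    ∃ L : Matrix (Fin r) (Fin r) ℝ, Tendsto (fun n => (M.p n : ℝ)⁻¹ •
      ((M.B n)ᵀ * (M.D pen n)⁻¹ * (M.P₂ n)ᵀ * M.P₂ n * (M.D pen n)⁻¹ * M.B n)) atTop (𝓝 L) ∧
      V = ρ • L := by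
  obtain ⟨c, hc, hrow⟩ := hE.exists_pos_le_row
  have hρ0 : ρ ≠ 0 := (hc.trans_le (ge_of_tendsto' hρ fun n => hrow n (t n))).ne'
  refine ⟨ρ⁻¹ • V, ?_, by rw [smul_inv_smul₀ hρ0]⟩
  refine ((hρ.inv₀ hρ0).smul (hV.tendsto_covariance h)).congr fun n => ?_
  rw [inv_smul_smul₀ (hc.trans_le (hrow n (t n))).ne']

end Model

end Covariance

end NetFactor

namespace NetFactor

/-! ### The leading matrix `Λ_S⁻¹ Γᵀ`. -/

section LeadingMatrix

variable {r : ℕ} {Ω : Type*} [MeasurableSpace Ω] {M : Model r Ω} {pen : Penalty}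
  {Γ : ℕ → Matrix (Fin r) (Fin r) ℝ} {c : ℝ}

/-- Supplies the boundedness that the subsequence argument for the Gaussian limit needs. -/
theorem Model.eventually_frobNorm_inv_ΛS_le (hc : 0 < c)
    (hS : ∀ᶠ n in atTop, ∀ k : Fin r, c ≤ eig (M.S pen n) k)
    (hΓ : ∀ n, (Γ n)ᵀ * Γ n = 1) :
    ∀ᶠ n in atTop, frobNorm ((M.ΛS pen n)⁻¹ * (Γ n)ᵀ) ≤ c⁻¹ * Real.sqrt r := by
  filter_upwards [hS] with n hn
  have hpos : ∀ k : Fin r, 0 < eig (M.S pen n) k := fun k => hc.trans_le (hn k)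
  have hΓn : frobNorm (Γ n) = Real.sqrt r := by
    rw [frobNorm_eq_of_gram (A := Γ n) (c := 1) (by rw [hΓ n, one_smul]), one_mul,
      Fintype.card_fin]
  rw [Model.ΛS, inv_diagonal_of_ne_zero fun k => (hpos k).ne', ← frobNorm_transpose,
    Matrix.transpose_mul, Matrix.transpose_transpose, Matrix.diagonal_transpose, ← hΓn]
  refine frobNorm_mul_diagonal_le _ (inv_nonneg.2 hc.le) fun k => ?_
  rw [abs_of_pos (inv_pos.2 (hpos k))]
  exact inv_anti₀ hc (hn k)

theorem Model.limit_covariance_eq (V : Matrix (Fin r) (Fin r) ℝ) (n : ℕ) :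
    (M.ΛS pen n)⁻¹ * (Γ n)ᵀ * V * Γ n * (M.ΛS pen n)⁻¹ =
      (M.ΛS pen n)⁻¹ * (Γ n)ᵀ * V * ((M.ΛS pen n)⁻¹ * (Γ n)ᵀ)ᵀ := by
  have h : ((M.ΛS pen n)⁻¹)ᵀ = (M.ΛS pen n)⁻¹ := by
    rw [Matrix.transpose_nonsing_inv, Model.ΛS, Matrix.diagonal_transpose]
  rw [Matrix.transpose_mul, Matrix.transpose_transpose, h, Matrix.mul_assoc _ (Γ n)]

end LeadingMatrix

end NetFactor

/-! ### The main theorem. -/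

theorem theorem4p2 {r : ℕ} {Ω : Type*} [MeasurableSpace Ω] (P : Measure Ω)
    [IsProbabilityMeasure P] (M : NetFactor.Model r Ω) (pen : NetFactor.Penalty)
    (hdim : M.DimensionRegime) (hF : M.FactorConditions P) (hB : M.LoadingConditions)
    (hE : M.ErrorConditions P) (hS : M.ShrunkLoadingCondition pen)
    -- the estimated factor scores
    (Fhat : ∀ n, Ω → Matrix (Fin (M.T n)) (Fin r) ℝ) (hFhat : M.IsScoreEstimator P pen Fhat)
    -- the spectral decomposition of `S`
    (Γ : ℕ → Matrix (Fin r) (Fin r) ℝ) (hΓ : ∀ n, (Γ n)ᵀ * Γ n = 1)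
    (hSΓ : ∀ n, M.S pen n = Γ n * M.ΛS pen n * (Γ n)ᵀ) :
    -- `H` is invertible with probability tending to one, and `Hᵀ H → I` in probability
    Tendsto (fun n => P {ω | ¬ IsUnit (M.H pen Fhat n ω)}) atTop (𝓝 0) ∧
    (∀ k l : Fin r, TendstoInMeasure P
      (fun n ω => ((M.H pen Fhat n ω)ᵀ * M.H pen Fhat n ω) k l) atTop
      (fun _ => (1 : Matrix (Fin r) (Fin r) ℝ) k l)) ∧
    ∀ (t : ∀ n, Fin (M.T n)) (V : Matrix (Fin r) (Fin r) ℝ), M.ScoreCLT P pen t V →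
      -- asymptotic normality, the signs of the columns of `Fhat` being aligned with `F Γ`
      (Tendsto (fun n => NetFactor.frobNorm (M.D pen n)⁻¹ / M.T n) atTop (𝓝 0) →
        (∀ n, ∀ᵐ ω ∂P, ∀ k : Fin r, 0 ≤ ((Γ n)ᵀ * (M.F n ω)ᵀ * Fhat n ω) k k) →
        NetFactor.AsymptoticallyNormal P
          (fun n ω => Real.sqrt (M.p n) • M.scoreError pen Fhat t n ω)
          (fun n => (M.ΛS pen n)⁻¹ * (Γ n)ᵀ * V * Γ n * (M.ΛS pen n)⁻¹) ∧
        ∀ C : Matrix (Fin r) (Fin r) ℝ,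
          Tendsto (fun n => (M.ΛS pen n)⁻¹ * (Γ n)ᵀ * V * Γ n * (M.ΛS pen n)⁻¹) atTop (𝓝 C) →
          TendstoInDistribution
            (fun n ω => Real.sqrt (M.p n) • M.scoreError pen Fhat t n ω)
            atTop (id : EuclideanSpace ℝ (Fin r) → EuclideanSpace ℝ (Fin r))
            (fun _ => P) (multivariateGaussian 0 C)) ∧
      -- the form of `V`
      Tendsto (fun n => (∑ s, M.P₁ n (t n) s ^ 2) • ((M.p n : ℝ)⁻¹ •
        ((M.B n)ᵀ * (M.D pen n)⁻¹ * (M.P₂ n)ᵀ * M.P₂ n * (M.D pen n)⁻¹ * M.B n)))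
        atTop (𝓝 V) ∧
      (∀ ρ : ℝ, Tendsto (fun n => ∑ s, M.P₁ n (t n) s ^ 2) atTop (𝓝 ρ) →
        ∃ L : Matrix (Fin r) (Fin r) ℝ,
          Tendsto (fun n => (M.p n : ℝ)⁻¹ •
            ((M.B n)ᵀ * (M.D pen n)⁻¹ * (M.P₂ n)ᵀ * M.P₂ n * (M.D pen n)⁻¹ * M.B n))
            atTop (𝓝 L) ∧ V = ρ • L) ∧
      -- the rate when `‖D⁻¹‖_F / T` is bounded away from zero
      ((∃ c : ℝ, 0 < c ∧ ∀ᶠ n in atTop, c ≤ NetFactor.frobNorm (M.D pen n)⁻¹ / M.T n) →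
        NetFactor.IsBigOP P (M.scoreError pen Fhat t)
          (fun n => NetFactor.frobNorm (M.D pen n)⁻¹ / (M.T n * Real.sqrt (M.p n)))) := by
  obtain ⟨κ, hκ⟩ := M.exists_bounded pen hF hB hE
  obtain ⟨c, hc, hev⟩ := hS
  refine ⟨NetFactor.Model.tendsto_measure_not_isUnit_H hdim hF hFhat hc hev hΓ hSΓ hκ,
    NetFactor.Model.tendstoInMeasure_H_gram hdim hF hFhat hc hev hΓ hSΓ hκ,
    fun t V hV => ⟨fun hw hsign => ?_, hV.tendsto_covariance hκ,
      fun ρ hρ => hV.exists_tendsto hκ hE hρ, fun ⟨w₀, hw₀, hw⟩ =>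
        NetFactor.Model.isBigOP_scoreError hdim hF hE hFhat hc hev hΓ hSΓ hκ t hw₀ hw⟩⟩
  have hA := NetFactor.Model.eventually_frobNorm_inv_ΛS_le hc (hev.mono fun _ h => h.1) hΓ
  have hZ : ∀ n, AEMeasurable (fun ω => Real.sqrt (M.p n) • M.scoreError pen Fhat t n ω) P :=
    fun n => (hFhat.aemeasurable_scoreError t n).const_smul (Real.sqrt (M.p n))
  have hpsd := hV.posSemidef hκ
  have hZW := NetFactor.Model.tendstoInMeasure_scoreError hdim hF hE hFhat hc hev hΓ hSΓ hκ t
    hw hsign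
  simp only [NetFactor.Model.limit_covariance_eq]
  have hnormal := NetFactor.asymptoticallyNormal_of_linear hpsd hA hV.clt hZ hZW
  exact ⟨hnormal, fun C hC => hnormal.tendstoInDistribution hpsd hA hZ hC⟩
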